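/- Let $K$ be a field, $S=K[x_1,\dots,x_n]$ the standard graded polynomial ring with graded maximal ideal $\mathfrak m=(x_1,\dots,x_n)$, and let $I\subset S$ be a graded ideal of codimension (height) $2$. Let $$0\to\bigoplus_{j=1}^{b_p}S(-d_{pj})\to\cdots\to\bigoplus_{j=1}^{b_1}S(-d_{1j})\to S\to 0$$ be a graded minimal free resolution of $S/I$, with $b_p\neq 0$, and put $M_i=\max_j d_{ij}$ and $m_i=\min_j d_{ij}$ for $1\le i\le p$. Call the resolution pure if for every $i$ the shifts $d_{ij}$ do not depend on $j$. Let $e(S/I)$ be the multiplicity of $S/I$: if the Hilbert polynomial $P$ of $S/I$ is nonzero, then $e(S/I)=(\deg P)!$ times the leading coefficient of $P$; if $P=0$, then $e(S/I)=\dim_K S/I$. Call $S/I$ Cohen–Macaulay if its depth (the maximal length of an $S/I$-regular sequence in $\mathfrak m(S/I)$) equals its Krull dimension. Then $S/I$ satisfies the improved multiplicity conjecture, that is: 1. $e(S/I)\le \dfrac{M_1M_2}{2}$, and if equality holds, then $S/I$ is Cohen–Macaulay and the resolution is pure. 2. If $S/I$ is Cohen–Macaulay, then $$\frac{1}{p!}\prod_{i=1}^{p}m_i\;\le\;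 e(S/I)\;\le\;\frac{1}{p!}\prod_{i=1}^{p}M_i ,$$ and if one of these two inequalities is an equality, then the resolution is pure. -/

import Mathlib

open MvPolynomial

attribute [local instance] MvPolynomial.gradedAlgebra

noncomputable section

namespace MultiplicityConjecture

variable {K : Type*} [Field K] {n : ℕ}

/-- The graded maximal ideal `(x_1, …, x_n)` of `K[x_1, …, x_n]`. -/
def maxIdeal (K : Type*) [Field K] (n : ℕ) : Ideal (MvPolynomial (Fin n) K) :=
  Ideal.span (Set.range X)

/-- The graded component of degree `k` of `S/I`, i.e. the image of `S_k`. -/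
def component (I : Ideal (MvPolynomial (Fin n) K)) (k : ℕ) :
    Submodule K (MvPolynomial (Fin n) K ⧸ I) :=
  (homogeneousSubmodule (Fin n) K k).map (Ideal.Quotient.mkₐ K I).toLinearMap

/-- The Hilbert function `k ↦ dim_K (S/I)_k`. -/
def hilbertFunction (I : Ideal (MvPolynomial (Fin n) K)) (k : ℕ) : ℕ :=
  Module.finrank K (component I k)

/-- `P` is the Hilbert polynomial of `S/I`: it agrees with the Hilbert function in all
sufficiently large degrees. -/
def IsHilbertPolynomial (I : Ideal (MvPolynomial (Fin n) K)) (P : Polynomial ℚ) : Prop :=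
  ∀ᶠ k : ℕ in Filter.atTop, P.eval (k : ℚ) = (hilbertFunction I k : ℚ)

/-- `e` is the multiplicity of `S/I`. If the Hilbert polynomial `P` is nonzero, then
`e = (deg P)! · lc(P)`; if `P = 0` (i.e. `S/I` has finite length), then `e` is the length
`dim_K S/I`. These conditions determine `e` uniquely. -/
def IsMultiplicity (I : Ideal (MvPolynomial (Fin n) K)) (e : ℕ) : Prop :=
  ∃ P : Polynomial ℚ, IsHilbertPolynomial I P ∧
    (P ≠ 0 → (e : ℚ) = (P.natDegree.factorial : ℚ) * P.leadingCoeff) ∧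
    (P = 0 → e = Module.finrank K (MvPolynomial (Fin n) K ⧸ I))

/-- The depth of `S/I`: the supremum of the lengths of the `S/I`-regular sequences in the graded
maximal ideal of `S/I`. -/
def depth (I : Ideal (MvPolynomial (Fin n) K)) : ℕ∞ :=
  ⨆ rs : {rs : List (MvPolynomial (Fin n) K ⧸ I) //
      (∀ r ∈ rs, r ∈ (maxIdeal K n).map (Ideal.Quotient.mk I)) ∧
      RingTheory.Sequence.IsRegular (MvPolynomial (Fin n) K ⧸ I) rs},
    (rs.1.length : ℕ∞)

/-- `S/I` is Cohen–Macaulay: its depth equals its Krull dimension. -/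
def IsCohenMacaulay (I : Ideal (MvPolynomial (Fin n) K)) : Prop :=
  (depth I : WithBot ℕ∞) = ringKrullDim (MvPolynomial (Fin n) K ⧸ I)

/-- A graded minimal free resolution
`0 → ⨁_j S(-d_{pj}) → ⋯ → ⨁_j S(-d_{1j}) → S → 0` of `S/I`. -/
structure MinimalGradedFreeResolution (I : Ideal (MvPolynomial (Fin n) K)) where
  /-- The length `p` of the resolution. -/
  length : ℕ
  /-- The rank `b_i` of the `i`-th free module (zero for `i > p`). -/
  rank : ℕ → ℕ
  /-- The shifts `d_{ij}`. -/
  shift : (i : ℕ) → Fin (rank i) → ℕ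
  /-- The differential from the `(i+1)`-st to the `i`-th free module. -/
  diff : (i : ℕ) → (Fin (rank (i + 1)) → MvPolynomial (Fin n) K) →ₗ[MvPolynomial (Fin n) K]
    (Fin (rank i) → MvPolynomial (Fin n) K)
  rank_length : rank length ≠ 0
  rank_eq_zero : ∀ i, length < i → rank i = 0
  rank_zero : rank 0 = 1
  shift_zero : ∀ j, shift 0 j = 0
  /-- The differentials are homogeneous of degree zero: the `(k, j)` entry of the matrix is
  homogeneous of degree `d_{i+1,j} - d_{i,k}`, and zero if this number is negative. -/
  homogeneous : ∀ i j k, diff i (Pi.single j 1) k = 0 ∨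
    ∃ t, shift i k + t = shift (i + 1) j ∧ (diff i (Pi.single j 1) k).IsHomogeneous t
  /-- The cokernel of the first differential is `S/I`. -/
  range_diff_zero : ∀ v, v ∈ LinearMap.range (diff 0) ↔ ∀ j, v j ∈ I
  exact : ∀ i, Function.Exact (diff (i + 1)) (diff i)
  minimal : ∀ i j k, diff i (Pi.single j 1) k ∈ maxIdeal K n

namespace MinimalGradedFreeResolution

variable {I : Ideal (MvPolynomial (Fin n) K)} (F : MinimalGradedFreeResolution I)

/-- `M_i = max {d_{ij} : j}`. -/
def maxShift (i : ℕ) : ℕ := Finset.univ.sup (F.shift i)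

/-- `m_i = min {d_{ij} : j}`. -/
def minShift (i : ℕ) : ℕ := sInf (Set.range (F.shift i))

/-- `(∏_{i=1}^s M_i) / s!` -/
def upperBound (s : ℕ) : ℚ := (∏ i ∈ Finset.Icc 1 s, (F.maxShift i : ℚ)) / s.factorial

/-- `(∏_{i=1}^s m_i) / s!` -/
def lowerBound (s : ℕ) : ℚ := (∏ i ∈ Finset.Icc 1 s, (F.minShift i : ℚ)) / s.factorial

/-- The resolution is pure: the shifts `d_{ij}` depend only on `i`. -/
def IsPure : Prop := ∀ i j k, F.shift i j = F.shift i k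

end MinimalGradedFreeResolution

end MultiplicityConjecture

end

noncomputable section

namespace MultiplicityConjecture

/-! ### Graded pieces of free modules and degree-zero maps -/

section Graded

variable {K : Type*} [Field K] {n : ℕ}

/-! The Hilbert series of $S/I$ is the alternating sum of the $t^{d_{ij}}$ divided by $(1-t)^n$.
Height two means that this numerator is $Q(t)(1-t)^2$ with $Q(1)=e\neq 0$
(`exists_multiplicity_of_height_eq_two`); this is where dimension theory enters.

Suppose the resolution has length two, with sorted first shifts $a_0\le\dots\le a_r$ and second
shifts $c_0\le\dots\le c_{r-1}$. Comparing values and two derivatives at $t=1$ gives one generator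
more than relations, $\sum c_j=\sum a_i$ and $2e=\sum c_j^2-\sum a_i^2$
(`moments_of_eq_mul_one_sub_sq`). A determinant argument gives $a_{j+1}\le c_j$
(`shift_succ_le_of_relations`), strictly for a minimal resolution. Hence $2e=\sum
(c_j-a_{j+1})(c_j+a_{j+1})-a_0^2$ with nonnegative weights $c_j-a_{j+1}$ of total $a_0$, and both
bounds with their equality cases are elementary (`bounds_of_length_le_two`).

In general, pass to the algebraic closure, which changes neither the shifts nor $Q$, and cut by
$d=n-2$ filter-regular linear forms down to two variables (`exists_linear_section`). The length of
the section is at least $e$, with equality only if $S/I$ has a regular sequence of length $d$. The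
resolution need not stay exact under the cut, but in two variables the syzygies of the images of the
generators are free (`exists_homogeneous_basis`), and their basis lives in degrees at most $M_2$:
the images of the original second syzygies span the Koszul relations, which already have full rank
(`two_mul_eval_one_le`). So the same estimate applies, now with weak inequalities.

Equality $e=M_1M_2/2$ thus yields a regular sequence of length $d$, hence a resolution of length at
most two, for which purity is known. The equivalence of these two conditions, a case of the
Auslander–Buchsbaum formula, comes from Ext out of the residue field
(`hasRegularSequence_of_length_le_two`, `length_le_two_of_hasRegularSequence`). As the length
survives base change, Cohen–Macaulayness descends to $K$. -/

lemma finrank_map_add_finrank_inf_ker {V W : Type*} [AddCommGroup V] [Module K V]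
    [AddCommGroup W] [Module K W] (f : V →ₗ[K] W) (U : Submodule K V) [FiniteDimensional K U] :
    Module.finrank K (U.map f) + Module.finrank K (U ⊓ LinearMap.ker f : Submodule K V) =
      Module.finrank K U := by
  have h := (f.domRestrict U).finrank_range_add_finrank_ker
  have h1 : LinearMap.range (f.domRestrict U) = U.map f := by
    rw [LinearMap.range_domRestrict]
  have h2 : (LinearMap.ker (f.domRestrict U)).map U.subtype = U ⊓ LinearMap.ker f := by
    ext v; simp [and_comm]
  rw [h1, ← Submodule.finrank_map_subtype_eq, h2] at h
  exact h

lemma homogeneousSubmodule_eq_restrictSupport (k : ℕ) :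
    homogeneousSubmodule (Fin n) K k = restrictSupport K {d | d.degree = k} := by
  rw [homogeneousSubmodule_eq_finsupp_supported]; rfl

instance finiteDimensional_homogeneousSubmodule (k : ℕ) :
    FiniteDimensional K (homogeneousSubmodule (Fin n) K k) :=
  Module.Finite.iff_fg.mpr (homogeneousSubmodule_fg (Fin n) K k)

lemma finrank_homogeneousSubmodule (k : ℕ) :
    Module.finrank K (homogeneousSubmodule (Fin n) K k) = n.multichoose k := by
  classical
  rw [homogeneousSubmodule_eq_restrictSupport,
    Module.finrank_eq_nat_card_basis (basisRestrictSupport K {d : Fin n →₀ ℕ | d.degree = k})]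
  have h : {d : Fin n →₀ ℕ | d.degree = k} =
      ((Finset.univ.finsuppAntidiag k : Finset (Fin n →₀ ℕ)) : Set (Fin n →₀ ℕ)) := by
    ext d
    simp [Finsupp.degree_eq_sum]
  rw [h, Nat.card_coe_set_eq, Set.ncard_coe_finset, Finset.card_finsuppAntidiag_nat_eq_multichoose]
  simp

/-- The Hilbert series of the polynomial ring in `n` variables is `1 / (1 - t)^n`. -/
lemma mk_multichoose_mul_one_sub_pow (n : ℕ) :
    PowerSeries.mk (fun k => ((n.multichoose k : ℕ) : ℚ)) * (1 - PowerSeries.X) ^ n = 1 := by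
  have h : PowerSeries.mk (fun k => ((n.multichoose k : ℕ) : ℚ)) =
      (PowerSeries.invOneSubPow ℚ n).val := by
    rcases n with _ | d
    · ext k
      rcases k with _ | k <;> simp [PowerSeries.invOneSubPow_zero, PowerSeries.coeff_one]
    · rw [PowerSeries.invOneSubPow_val_succ_eq_mk_add_choose]
      ext k
      simp only [PowerSeries.coeff_mk, Nat.multichoose_eq]
      congr 1
      rw [show d + 1 + k - 1 = d + k by omega]
      exact (Nat.choose_symm_add ).symm
  rw [h, ← PowerSeries.invOneSubPow_inv_eq_one_sub_pow ℚ n]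
  exact (PowerSeries.invOneSubPow ℚ n).val_inv

/-- The degree `k` part of the free module `S(-s)` of rank one. -/
def shiftedDegree (s k : ℕ) : Submodule K (MvPolynomial (Fin n) K) :=
  if s ≤ k then homogeneousSubmodule (Fin n) K (k - s) else ⊥

/-- The projection of `S(-s)` onto its degree `k` part. -/
def shiftedComponent (s k : ℕ) : MvPolynomial (Fin n) K →ₗ[K] MvPolynomial (Fin n) K :=
  if s ≤ k then homogeneousComponent (k - s) else 0

instance (s k : ℕ) : FiniteDimensional K (shiftedDegree (K := K) (n := n) s k) := by
  by_cases h : s ≤ k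
  · rw [shiftedDegree, if_pos h]; infer_instance
  · rw [shiftedDegree, if_neg h]; infer_instance

lemma mem_shiftedDegree {s k : ℕ} {p : MvPolynomial (Fin n) K} :
    p ∈ shiftedDegree s k ↔ p = 0 ∨ ∃ t, s + t = k ∧ p.IsHomogeneous t := by
  unfold shiftedDegree
  split_ifs with h
  · rw [mem_homogeneousSubmodule]
    constructor
    · intro hp; exact Or.inr ⟨k - s, by omega, hp⟩
    · rintro (rfl | ⟨t, ht, hp⟩)
      · exact isHomogeneous_zero _ _ _
      · obtain rfl : t = k - s := by omega
        exact hp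
  · rw [Submodule.mem_bot]
    constructor
    · exact Or.inl
    · rintro (h | ⟨t, ht, -⟩)
      · exact h
      · omega

lemma shiftedComponent_mem (s k : ℕ) (p : MvPolynomial (Fin n) K) :
    shiftedComponent s k p ∈ shiftedDegree s k := by
  unfold shiftedDegree shiftedComponent
  split_ifs
  · exact homogeneousComponent_mem _ _
  · simp

lemma shiftedComponent_of_mem {s k : ℕ} {p : MvPolynomial (Fin n) K}
    (hp : p ∈ shiftedDegree s k) : shiftedComponent s k p = p := by
  unfold shiftedDegree at hp
  unfold shiftedComponent
  split_ifs at hp ⊢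
  · rw [homogeneousComponent_of_mem hp, if_pos rfl]
  · simpa using hp.symm

lemma homogeneousComponent_mul_of_isHomogeneous {q : MvPolynomial (Fin n) K} {t : ℕ}
    (hq : q.IsHomogeneous t) (p : MvPolynomial (Fin n) K) (m : ℕ) :
    homogeneousComponent m (p * q) =
      if t ≤ m then homogeneousComponent (m - t) p * q else 0 := by
  have h := DirectSum.coe_decompose_mul_of_right_mem (homogeneousSubmodule (Fin n) K)
    (a := p) (b := q) (i := t) m ((mem_homogeneousSubmodule _ _).mpr hq)
  rw [← decomposition.decompose'_apply, ← decomposition.decompose'_apply]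
  exact h

/-- Here `q` is a matrix entry of a degree-zero map $S(-s')\to S(-s)$. The alternative `q = 0`
covers $s'<s$, where there is no degree for `q` to have. -/
lemma shiftedComponent_mul {s s' k : ℕ} {p q : MvPolynomial (Fin n) K}
    (hq : q = 0 ∨ ∃ t, s + t = s' ∧ q.IsHomogeneous t) :
    shiftedComponent s k (p * q) = shiftedComponent s' k p * q := by
  rcases hq with rfl | ⟨t, rfl, hq⟩
  · simp
  · unfold shiftedComponent
    by_cases h1 : s ≤ k
    · rw [if_pos h1, homogeneousComponent_mul_of_isHomogeneous hq]
      by_cases h2 : s + t ≤ k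
      · rw [if_pos h2, if_pos (by omega), Nat.sub_sub]
      · rw [if_neg h2, if_neg (by omega)]; simp
    · rw [if_neg h1, if_neg (by omega)]; simp

variable {ι κ : Type*}

/-- The degree `k` part of the graded free module `⨁_i S(-s_i)`. -/
def gradedPiece (s : ι → ℕ) (k : ℕ) : Submodule K (ι → MvPolynomial (Fin n) K) :=
  Submodule.pi Set.univ fun i => shiftedDegree (s i) k

lemma mem_gradedPiece {s : ι → ℕ} {k : ℕ} {v : ι → MvPolynomial (Fin n) K} :
    v ∈ gradedPiece s k ↔ ∀ i, v i ∈ shiftedDegree (s i) k := by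
  simp [gradedPiece, Submodule.mem_pi]

/-- The projection of `⨁_i S(-s_i)` onto its degree `k` part. -/
def pieceProj (s : ι → ℕ) (k : ℕ) :
    (ι → MvPolynomial (Fin n) K) →ₗ[K] (ι → MvPolynomial (Fin n) K) :=
  LinearMap.pi fun i => (shiftedComponent (s i) k).comp (LinearMap.proj i)

lemma pieceProj_apply (s : ι → ℕ) (k : ℕ) (v : ι → MvPolynomial (Fin n) K) (i : ι) :
    pieceProj s k v i = shiftedComponent (s i) k (v i) := rfl

lemma pieceProj_mem (s : ι → ℕ) (k : ℕ) (v : ι → MvPolynomial (Fin n) K) :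
    pieceProj s k v ∈ gradedPiece s k :=
  mem_gradedPiece.mpr fun _ => shiftedComponent_mem _ _ _

lemma pieceProj_of_mem {s : ι → ℕ} {k : ℕ} {v : ι → MvPolynomial (Fin n) K}
    (hv : v ∈ gradedPiece s k) : pieceProj s k v = v :=
  funext fun i => shiftedComponent_of_mem (mem_gradedPiece.mp hv i)

variable [Fintype ι]

/-- The degree `k` part of `⨁_i S(-s_i)` as a product. -/
def gradedPieceEquiv (s : ι → ℕ) (k : ℕ) :
    gradedPiece (K := K) (n := n) s k ≃ₗ[K]
      ((i : ι) → shiftedDegree (K := K) (n := n) (s i) k) where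
  toFun v i := ⟨v.1 i, mem_gradedPiece.mp v.2 i⟩
  map_add' _ _ := rfl
  map_smul' _ _ := rfl
  invFun w := ⟨fun i => (w i).1, mem_gradedPiece.mpr fun i => (w i).2⟩
  left_inv _ := rfl
  right_inv _ := rfl

instance (s : ι → ℕ) (k : ℕ) : FiniteDimensional K (gradedPiece (K := K) (n := n) s k) :=
  (gradedPieceEquiv s k).symm.finiteDimensional

variable (K n) in
lemma finrank_shiftedDegree (s k : ℕ) :
    (Module.finrank K (shiftedDegree (K := K) (n := n) s k) : ℚ) =
      PowerSeries.coeff k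
        (PowerSeries.X ^ s * PowerSeries.mk (fun k => ((n.multichoose k : ℕ) : ℚ))) := by
  rw [PowerSeries.coeff_X_pow_mul', shiftedDegree]
  split_ifs with h
  · rw [if_pos h, finrank_homogeneousSubmodule, PowerSeries.coeff_mk]
  · rw [if_neg h]; simp

variable (K n) in
/-- The Hilbert series of `⨁_i S(-s_i)` is `(∑_i t^{s_i}) / (1 - t)^n`. -/
lemma mk_finrank_gradedPiece_mul (s : ι → ℕ) :
    PowerSeries.mk (fun k => (Module.finrank K (gradedPiece (K := K) (n := n) s k) : ℚ)) *
      (1 - PowerSeries.X) ^ n = ∑ i, PowerSeries.X ^ s i := by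
  have h : PowerSeries.mk
      (fun k => (Module.finrank K (gradedPiece (K := K) (n := n) s k) : ℚ)) =
      (∑ i, PowerSeries.X ^ s i) * PowerSeries.mk (fun k => ((n.multichoose k : ℕ) : ℚ)) := by
    ext k
    rw [PowerSeries.coeff_mk, (gradedPieceEquiv s k).finrank_eq, Module.finrank_pi_fintype,
      Nat.cast_sum, Finset.sum_mul, map_sum]
    exact Finset.sum_congr rfl fun i _ => finrank_shiftedDegree K n (s i) k
  rw [h, mul_assoc, mk_multichoose_mul_one_sub_pow, mul_one]

/-- A homomorphism `⨁_j S(-s'_j) → ⨁_i S(-s_i)` is homogeneous of degree zero. -/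
def IsGradedMap [DecidableEq ι]
    (d : (ι → MvPolynomial (Fin n) K) →ₗ[MvPolynomial (Fin n) K] (κ → MvPolynomial (Fin n) K))
    (s' : ι → ℕ) (s : κ → ℕ) : Prop :=
  ∀ j k, d (Pi.single j 1) k = 0 ∨
    ∃ t, s k + t = s' j ∧ (d (Pi.single j 1) k).IsHomogeneous t

section GradedMap

variable [DecidableEq ι]
  {d : (ι → MvPolynomial (Fin n) K) →ₗ[MvPolynomial (Fin n) K] (κ → MvPolynomial (Fin n) K)}
  {s' : ι → ℕ} {s : κ → ℕ}

lemma apply_eq_sum_mul_single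
    (d : (ι → MvPolynomial (Fin n) K) →ₗ[MvPolynomial (Fin n) K] (κ → MvPolynomial (Fin n) K))
    (v : ι → MvPolynomial (Fin n) K) (k : κ) :
    d v k = ∑ j, v j * d (Pi.single j 1) k := by
  conv_lhs => rw [pi_eq_sum_univ' v]
  simp only [map_sum, map_smul, Finset.sum_apply, Pi.smul_apply, smul_eq_mul]

/-- Commutation with the projections is the working form of gradedness: it makes kernels graded and
lets preimages be chosen in the right degree. -/
lemma IsGradedMap.map_pieceProj (hd : IsGradedMap d s' s) (k : ℕ)
    (v : ι → MvPolynomial (Fin n) K) : d (pieceProj s' k v) = pieceProj s k (d v) := by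
  funext i
  rw [pieceProj_apply, apply_eq_sum_mul_single, apply_eq_sum_mul_single d v, map_sum]
  exact Finset.sum_congr rfl fun j _ => (shiftedComponent_mul (hd j i)).symm

lemma IsGradedMap.map_gradedPiece (hd : IsGradedMap d s' s) (k : ℕ) :
    (gradedPiece s' k).map (d.restrictScalars K) =
      (LinearMap.range d).restrictScalars K ⊓ gradedPiece s k := by
  ext w
  constructor
  · rintro ⟨v, hv, rfl⟩
    refine ⟨⟨v, rfl⟩, ?_⟩
    rw [LinearMap.restrictScalars_apply, ← pieceProj_of_mem hv, hd.map_pieceProj]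
    exact pieceProj_mem _ _ _
  · rintro ⟨⟨v, rfl⟩, hw⟩
    refine ⟨pieceProj s' k v, pieceProj_mem _ _ _, ?_⟩
    rw [LinearMap.restrictScalars_apply, hd.map_pieceProj, pieceProj_of_mem hw]

lemma IsGradedMap.finrank_range_add_finrank_ker (hd : IsGradedMap d s' s) (k : ℕ) :
    Module.finrank K ((LinearMap.range d).restrictScalars K ⊓ gradedPiece s k : Submodule K _) +
      Module.finrank K ((LinearMap.ker d).restrictScalars K ⊓ gradedPiece s' k : Submodule K _) =
      Module.finrank K (gradedPiece (K := K) (n := n) s' k) := by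
  rw [← hd.map_gradedPiece, ← finrank_map_add_finrank_inf_ker (d.restrictScalars K)
    (gradedPiece s' k), inf_comm (gradedPiece s' k)]
  rfl

end GradedMap

end Graded

/-! ### The Hilbert series from the resolution -/

section HilbertSeries

variable {K : Type*} [Field K] {n : ℕ}

/-- The degree `k` part of an ideal. -/
def idealPiece (I : Ideal (MvPolynomial (Fin n) K)) (k : ℕ) :
    Submodule K (MvPolynomial (Fin n) K) :=
  homogeneousSubmodule (Fin n) K k ⊓ I.restrictScalars K

lemma mem_idealPiece {I : Ideal (MvPolynomial (Fin n) K)} {k : ℕ} {p : MvPolynomial (Fin n) K} :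
    p ∈ idealPiece I k ↔ p.IsHomogeneous k ∧ p ∈ I := Iff.rfl

instance (I : Ideal (MvPolynomial (Fin n) K)) (k : ℕ) : FiniteDimensional K (idealPiece I k) :=
  Submodule.finiteDimensional_inf_left _ _

lemma hilbertFunction_add_finrank_idealPiece (I : Ideal (MvPolynomial (Fin n) K)) (k : ℕ) :
    hilbertFunction I k + Module.finrank K (idealPiece I k) = n.multichoose k := by
  rw [← finrank_homogeneousSubmodule (K := K),
    ← finrank_map_add_finrank_inf_ker (Ideal.Quotient.mkₐ K I).toLinearMap
      (homogeneousSubmodule (Fin n) K k)]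
  have h : homogeneousSubmodule (Fin n) K k ⊓
      LinearMap.ker (Ideal.Quotient.mkₐ K I).toLinearMap = idealPiece I k := by
    ext p
    simp [Ideal.Quotient.eq_zero_iff_mem, mem_idealPiece]
  rw [h]
  rfl

/-- The Hilbert series of `S/I`. -/
def hilbertSeries (I : Ideal (MvPolynomial (Fin n) K)) : PowerSeries ℚ :=
  PowerSeries.mk fun k => (hilbertFunction I k : ℚ)

lemma coeff_hilbertSeries (I : Ideal (MvPolynomial (Fin n) K)) (k : ℕ) :
    PowerSeries.coeff k (hilbertSeries I) = hilbertFunction I k :=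
  PowerSeries.coeff_mk _ _

/-- If `⨁_i S(-s_i) → S` is a homogeneous map with image `I`, then the Hilbert series of its
kernel and of `S/I` are related by additivity. -/
lemma hilbertFunction_add_of_gradedMap {ι κ : Type*} [Fintype ι] [DecidableEq ι] [Unique κ]
    {I : Ideal (MvPolynomial (Fin n) K)}
    {d : (ι → MvPolynomial (Fin n) K) →ₗ[MvPolynomial (Fin n) K] (κ → MvPolynomial (Fin n) K)}
    {s' : ι → ℕ} {s : κ → ℕ} (hs : ∀ j, s j = 0) (hd : IsGradedMap d s' s)
    (hI : ∀ v, v ∈ LinearMap.range d ↔ ∀ j, v j ∈ I) (k : ℕ) :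
    hilbertFunction I k + Module.finrank K (gradedPiece (K := K) (n := n) s' k) =
      n.multichoose k + Module.finrank K
        ((LinearMap.ker d).restrictScalars K ⊓ gradedPiece s' k : Submodule K _) := by
  have h1 := hilbertFunction_add_finrank_idealPiece I k
  have h2 := hd.finrank_range_add_finrank_ker k
  have h3 : Module.finrank K
      ((LinearMap.range d).restrictScalars K ⊓ gradedPiece s k : Submodule K _) =
      Module.finrank K (idealPiece I k) := by
    let e : (κ → MvPolynomial (Fin n) K) ≃ₗ[K] MvPolynomial (Fin n) K :=
      LinearEquiv.funUnique κ K _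
    rw [← e.finrank_map_eq]
    have : Submodule.map e.toLinearMap
        ((LinearMap.range d).restrictScalars K ⊓ gradedPiece s k) = idealPiece I k := by
      ext p
      simp only [Submodule.mem_map, mem_idealPiece, Submodule.mem_inf,
        Submodule.restrictScalars_mem, hI, mem_gradedPiece]
      constructor
      · rintro ⟨v, ⟨h1, h2⟩, rfl⟩
        refine ⟨?_, h1 default⟩
        have := h2 default
        rw [hs, shiftedDegree, if_pos (Nat.zero_le _)] at this
        exact this
      · rintro ⟨h1, h2⟩
        refine ⟨fun _ => p, ⟨fun _ => h2, fun j => ?_⟩, rfl⟩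
        rw [hs, shiftedDegree, if_pos (Nat.zero_le _)]
        exact h1
    rw [← this]
  omega

namespace MinimalGradedFreeResolution

variable {I : Ideal (MvPolynomial (Fin n) K)} (F : MinimalGradedFreeResolution I)

/-- The numerator `∑_i (-1)^i ∑_j t^{d_{ij}}` of the Hilbert series of `S/I`. -/
def numerator : Polynomial ℚ :=
  ∑ i ∈ Finset.range (F.length + 1), (-1) ^ i * ∑ j, Polynomial.X ^ F.shift i j

lemma isGradedMap_diff (i : ℕ) : IsGradedMap (F.diff i) (F.shift (i + 1)) (F.shift i) :=
  F.homogeneous i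

lemma range_diff_succ (i : ℕ) : LinearMap.range (F.diff (i + 1)) = LinearMap.ker (F.diff i) :=
  (LinearMap.exact_iff.mp (F.exact i)).symm

/-- The sum is truncated so that induction can run: each step replaces the kernel of one
differential, which is the range of the next, by the next kernel. The error term dies for `m =
F.length`, since the free module after that index is zero. -/
lemma sum_finrank_gradedPiece (k m : ℕ) :
    ∑ i ∈ Finset.range (m + 2),
        (-1 : ℚ) ^ i * Module.finrank K (gradedPiece (K := K) (n := n) (F.shift i) k) =
      hilbertFunction I k - (-1) ^ m * Module.finrank K
        ((LinearMap.ker (F.diff m)).restrictScalars K ⊓ gradedPiece (F.shift (m + 1)) k :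
          Submodule K _) := by
  induction m with
  | zero =>
    have : Unique (Fin (F.rank 0)) := by
      rw [F.rank_zero]; exact inferInstance
    have h := hilbertFunction_add_of_gradedMap F.shift_zero (F.isGradedMap_diff 0)
      F.range_diff_zero k
    have h0 : Module.finrank K (gradedPiece (K := K) (n := n) (F.shift 0) k) =
        n.multichoose k := by
      rw [(gradedPieceEquiv _ k).finrank_eq, Module.finrank_pi_fintype, Fintype.sum_unique,
        F.shift_zero, shiftedDegree, if_pos (Nat.zero_le _), finrank_homogeneousSubmodule,
        Nat.sub_zero]
    rw [← h0] at h
    have h' := congrArg (Nat.cast (R := ℚ)) h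
    push_cast at h'
    rw [Finset.sum_range_succ, Finset.sum_range_one]
    simp only [pow_zero, one_mul, pow_one] at h' ⊢
    linarith
  | succ m ih =>
    have h := (F.isGradedMap_diff (m + 1)).finrank_range_add_finrank_ker k
    rw [F.range_diff_succ] at h
    have h' := congrArg (Nat.cast (R := ℚ)) h
    push_cast at h'
    rw [Finset.sum_range_succ, ih, ← h', pow_succ, pow_succ]
    ring

/-- The Hilbert series of `S/I` is `numerator / (1 - t)^n`. -/
lemma hilbertSeries_mul_one_sub_pow :
    hilbertSeries I * (1 - PowerSeries.X) ^ n = (F.numerator : PowerSeries ℚ) := by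
  have h : hilbertSeries I = ∑ i ∈ Finset.range (F.length + 1), (-1) ^ i *
      PowerSeries.mk fun k =>
        (Module.finrank K (gradedPiece (K := K) (n := n) (F.shift i) k) : ℚ) := by
    ext k
    have h1 := F.sum_finrank_gradedPiece k F.length
    have h0 : Module.finrank K
        (gradedPiece (K := K) (n := n) (F.shift (F.length + 1)) k) = 0 := by
      have : IsEmpty (Fin (F.rank (F.length + 1))) := by
        rw [F.rank_eq_zero _ (Nat.lt_succ_self _)]; exact inferInstance
      rw [(gradedPieceEquiv _ k).finrank_eq, Module.finrank_pi_fintype, Finset.univ_eq_empty,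
        Finset.sum_empty]
    have h2 : Module.finrank K ((LinearMap.ker (F.diff F.length)).restrictScalars K ⊓
        gradedPiece (F.shift (F.length + 1)) k : Submodule K _) = 0 :=
      Nat.le_zero.mp (h0 ▸ Submodule.finrank_mono inf_le_right)
    rw [h2, Finset.sum_range_succ, h0] at h1
    rw [coeff_hilbertSeries, map_sum]
    simp only [Nat.cast_zero, mul_zero, add_zero, sub_zero] at h1
    rw [← h1]
    refine Finset.sum_congr rfl fun i _ => ?_
    rcases Nat.even_or_odd i with he | he <;> simp [he.neg_one_pow]
  rw [h, Finset.sum_mul, numerator, ← Polynomial.coeToPowerSeries.ringHom_apply, map_sum]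
  refine Finset.sum_congr rfl fun i _ => ?_
  rw [mul_assoc, mk_finrank_gradedPiece_mul]
  rw [map_mul, map_pow, map_neg, map_one, map_sum]
  simp [Polynomial.coeToPowerSeries.ringHom_apply]

end MinimalGradedFreeResolution

end HilbertSeries

/-! ### Inequalities between shifts and their second moments -/

section Numerics

/-- Relations among nonzero elements, with the vanishing pattern forced by degrees: after sorting,
the degree of the `j`-th relation is at least the degree of the `(j+1)`-st element. -/
lemma shift_succ_le_of_relations {R : Type*} [CommRing R] [IsDomain R] {r : ℕ}
    {z : Fin r → Fin (r + 1) → R} (hz : LinearIndependent R z) {f : Fin (r + 1) → R}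
    (hf : ∀ i, f i ≠ 0) (hfz : ∀ j, ∑ i, z j i * f i = 0)
    {a : Fin (r + 1) → ℕ} {c : Fin r → ℕ} (hac : ∀ j i, z j i ≠ 0 → a i ≤ c j)
    {σ : Equiv.Perm (Fin (r + 1))} {τ : Equiv.Perm (Fin r)} (hσ : Monotone (a ∘ σ))
    (hτ : Monotone (c ∘ τ)) (j : Fin r) : a (σ j.succ) ≤ c (τ j) := by
  -- Otherwise the first `j + 1` sorted relations involve only the first `j + 1` sorted elements.
  -- This square block kills the nonzero vector of those elements, so it is singular.
  by_contra! hlt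
  have hzero : ∀ l i, l ≤ j → j.succ ≤ i → z (τ l) (σ i) = 0 := by
    intro l i hl hi
    by_contra h
    have h1 := hac _ _ h
    have h2 : c (τ l) ≤ c (τ j) := hτ hl
    have h3 : a (σ j.succ) ≤ a (σ i) := hσ hi
    omega
  let e : Fin (j + 1) → Fin r := Fin.castLE (by omega)
  let e' : Fin (j + 1) → Fin (r + 1) := Fin.castLE (by omega)
  let M : Matrix (Fin (j + 1)) (Fin (j + 1)) R := Matrix.of fun l m => z (τ (e l)) (σ (e' m))
  have hle : ∀ l, e l ≤ j := fun l => by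
    rw [Fin.le_def]; exact Nat.lt_succ_iff.mp l.2
  have hi : ∀ i, i ∉ Set.range e' → j.succ ≤ i := by
    intro i hi
    by_contra! h
    exact hi ⟨⟨i, by simpa [Fin.lt_def] using h⟩, rfl⟩
  have hinj : Function.Injective e' := Fin.castLE_injective _
  have hM : M.det = 0 := by
    rw [← Matrix.exists_mulVec_eq_zero_iff]
    refine ⟨fun m => f (σ (e' m)), fun h => hf _ (congrFun h 0), ?_⟩
    funext l
    rw [Matrix.mulVec, dotProduct, Pi.zero_apply, ← hfz (τ (e l)),
      ← Equiv.sum_comp σ (fun i => z (τ (e l)) i * f i)]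
    refine Finset.sum_of_injOn e' hinj.injOn (by simp) ?_ (fun m _ => rfl)
    intro i _ hi'
    rw [hzero _ _ (hle l) (hi i (by simpa using hi')), zero_mul]
  -- A singular block over a domain also has a left null vector. The remaining columns of these rows
  -- vanish, so it is a dependence among the full relations.
  obtain ⟨v, hv, hvM⟩ := Matrix.exists_vecMul_eq_zero_iff.mpr hM
  have hli : LinearIndependent R fun l => z (τ (e l)) :=
    hz.comp _ (τ.injective.comp (Fin.castLE_injective _))
  rw [Fintype.linearIndependent_iff] at hli
  refine hv (funext (hli v ?_))
  funext i
  obtain ⟨i, rfl⟩ := σ.surjective i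
  rw [Finset.sum_apply, Pi.zero_apply]
  by_cases h : i ∈ Set.range e'
  · obtain ⟨m, rfl⟩ := h
    exact congrFun hvM m
  · refine Finset.sum_eq_zero fun l _ => ?_
    rw [Pi.smul_apply, hzero _ _ (hle l) (hi i h), smul_zero]

section Bounds

variable {r : ℕ} {α : Fin (r + 1) → ℚ} {γ : Fin r → ℚ}

/-- Pairing each `γ j` with `α j.succ` leaves `α 0` alone. The factors `γ j - α j.succ` act as
weights, of total mass `α 0` by `sum_sub_eq`. -/
lemma sum_sq_sub_sum_sq_eq (α : Fin (r + 1) → ℚ) (γ : Fin r → ℚ) :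
    ∑ j, γ j ^ 2 - ∑ i, α i ^ 2 =
      ∑ j, (γ j - α j.succ) * (γ j + α j.succ) - α 0 ^ 2 := by
  have : ∀ j, (γ j - α j.succ) * (γ j + α j.succ) = γ j ^ 2 - α j.succ ^ 2 := fun j => by ring
  rw [Fin.sum_univ_succ]
  simp only [this, Finset.sum_sub_distrib]
  ring

lemma sum_sub_eq (hsum : ∑ j, γ j = ∑ i, α i) : ∑ j, (γ j - α j.succ) = α 0 := by
  rw [Finset.sum_sub_distrib, hsum, Fin.sum_univ_succ]
  ring

/-- Replacing `γ j + α j.succ` by `M₁ + M₂` under the weights gives at most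
$\alpha_0(M_1+M_2)-\alpha_0^2$, which differs from $M_1M_2$ by $(M_1-\alpha_0)(M_2-\alpha_0)\ge 0$.
-/
lemma sum_sq_sub_sum_sq_le {M₁ M₂ : ℚ} (hα : Monotone α) (hαγ : ∀ j, α j.succ ≤ γ j)
    (hsum : ∑ j, γ j = ∑ i, α i) (hM₁ : ∀ i, α i ≤ M₁) (hM₂ : ∀ j, γ j ≤ M₂) (hM₂0 : 0 ≤ M₂)
    (h0 : 0 ≤ α 0) : ∑ j, γ j ^ 2 - ∑ i, α i ^ 2 ≤ M₁ * M₂ := by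
  rw [sum_sq_sub_sum_sq_eq]
  have h1 : ∑ j, (γ j - α j.succ) * (γ j + α j.succ) ≤ ∑ j, (γ j - α j.succ) * (M₂ + M₁) := by
    refine Finset.sum_le_sum fun j _ => mul_le_mul_of_nonneg_left ?_ (sub_nonneg.mpr (hαγ j))
    exact add_le_add (hM₂ j) (hM₁ _)
  rw [← Finset.sum_mul, sum_sub_eq hsum] at h1
  have h2 : α 0 ≤ M₂ := by
    -- Without any `γ` the equality of sums forces `α 0 = 0`.
    rcases r with _ | r
    · have := sum_sub_eq hsum
      simp at this
      linarith
    · exact (hα (Fin.zero_le _)).trans ((hαγ 0).trans (hM₂ 0))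
  nlinarith [mul_nonneg (sub_nonneg.mpr (hM₁ 0)) (sub_nonneg.mpr h2)]

/-- Both losses in the estimate must vanish. Since $\alpha_0<M_2$, the product
$(M_1-\alpha_0)(M_2-\alpha_0)=0$ gives $\alpha_0=M_1$, so `α` is constant; since the weights are
positive, every `γ j + α j.succ` is `M₁ + M₂`. -/
lemma eq_of_sum_sq_sub_sum_sq_eq {M₁ M₂ : ℚ} (hα : Monotone α) (hαγ : ∀ j, α j.succ < γ j)
    (hsum : ∑ j, γ j = ∑ i, α i) (hM₁ : ∀ i, α i ≤ M₁) (hM₂ : ∀ j, γ j ≤ M₂)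
    (h0 : 0 < α 0) (heq : ∑ j, γ j ^ 2 - ∑ i, α i ^ 2 = M₁ * M₂) :
    (∀ i, α i = M₁) ∧ ∀ j, γ j = M₂ := by
  rw [sum_sq_sub_sum_sq_eq] at heq
  have hle : ∀ j ∈ Finset.univ, (γ j - α j.succ) * (γ j + α j.succ) ≤
      (γ j - α j.succ) * (M₂ + M₁) := fun j _ =>
    mul_le_mul_of_nonneg_left (add_le_add (hM₂ j) (hM₁ _)) (sub_nonneg.mpr (hαγ j).le)
  have h1 := Finset.sum_le_sum hle
  have h2 : α 0 < M₂ := by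
    rcases r with _ | r
    · have := sum_sub_eq hsum
      simp at this
      linarith
    · exact (hα (Fin.zero_le _)).trans_lt ((hαγ 0).trans_le (hM₂ 0))
  have h3 : ∑ j, (γ j - α j.succ) * (M₂ + M₁) = α 0 * (M₂ + M₁) := by
    rw [← Finset.sum_mul, sum_sub_eq hsum]
  have h4 : 0 ≤ (M₁ - α 0) * (M₂ - α 0) :=
    mul_nonneg (sub_nonneg.mpr (hM₁ 0)) (sub_nonneg.mpr h2.le)
  have h5 : α 0 = M₁ := by
    have : (M₁ - α 0) * (M₂ - α 0) = 0 := by nlinarith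
    rcases mul_eq_zero.mp this with h | h <;> linarith
  have h6 : ∑ j, (γ j - α j.succ) * (γ j + α j.succ) = ∑ j, (γ j - α j.succ) * (M₂ + M₁) := by
    nlinarith
  have h7 := (Finset.sum_eq_sum_iff_of_le hle).mp h6
  refine ⟨fun i => le_antisymm (hM₁ i) (h5 ▸ hα (Fin.zero_le i)), fun j => ?_⟩
  have := mul_left_cancel₀ (sub_pos.mpr (hαγ j)).ne' (h7 j (Finset.mem_univ j))
  linarith [hM₂ j, hM₁ j.succ]

/-- Under the weights, `γ j + α j.succ` is at least `m₂ + α 0`; the resulting $\alpha_0^2$ cancels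
exactly, so no second loss occurs. -/
lemma le_sum_sq_sub_sum_sq {m₂ : ℚ} (hα : Monotone α) (hαγ : ∀ j, α j.succ ≤ γ j)
    (hsum : ∑ j, γ j = ∑ i, α i) (hm₂ : ∀ j, m₂ ≤ γ j) :
    α 0 * m₂ ≤ ∑ j, γ j ^ 2 - ∑ i, α i ^ 2 := by
  rw [sum_sq_sub_sum_sq_eq]
  have h1 : ∑ j, (γ j - α j.succ) * (m₂ + α 0) ≤ ∑ j, (γ j - α j.succ) * (γ j + α j.succ) := by
    refine Finset.sum_le_sum fun j _ => mul_le_mul_of_nonneg_left ?_ (sub_nonneg.mpr (hαγ j))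
    exact add_le_add (hm₂ j) (hα (Fin.zero_le _))
  rw [← Finset.sum_mul, sum_sub_eq hsum] at h1
  nlinarith

lemma eq_of_sum_sq_sub_sum_sq_eq_lower {m₂ : ℚ} (hα : Monotone α) (hαγ : ∀ j, α j.succ < γ j)
    (hsum : ∑ j, γ j = ∑ i, α i) (hm₂ : ∀ j, m₂ ≤ γ j)
    (heq : ∑ j, γ j ^ 2 - ∑ i, α i ^ 2 = α 0 * m₂) :
    (∀ i, α i = α 0) ∧ ∀ j, γ j = m₂ := by
  rw [sum_sq_sub_sum_sq_eq] at heq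
  have hle : ∀ j ∈ Finset.univ, (γ j - α j.succ) * (m₂ + α 0) ≤
      (γ j - α j.succ) * (γ j + α j.succ) := fun j _ =>
    mul_le_mul_of_nonneg_left (add_le_add (hm₂ j) (hα (Fin.zero_le _)))
      (sub_nonneg.mpr (hαγ j).le)
  have h6 : ∑ j, (γ j - α j.succ) * (m₂ + α 0) = ∑ j, (γ j - α j.succ) * (γ j + α j.succ) := by
    rw [← Finset.sum_mul, sum_sub_eq hsum]
    nlinarith
  have h7 := (Finset.sum_eq_sum_iff_of_le hle).mp h6
  have h8 : ∀ j, γ j = m₂ ∧ α j.succ = α 0 := fun j => by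
    have := mul_left_cancel₀ (sub_pos.mpr (hαγ j)).ne' (h7 j (Finset.mem_univ j))
    have h9 : α 0 ≤ α j.succ := hα (Fin.zero_le _)
    constructor <;> linarith [hm₂ j]
  exact ⟨fun i => Fin.cases rfl (fun j => (h8 j).2) i, fun j => (h8 j).1⟩

end Bounds

end Numerics

/-! ### Filter-regular linear forms and elimination of a variable -/

section Elimination

variable {K : Type*} [Field K] {n m : ℕ}

lemma mem_maxIdeal_iff {p : MvPolynomial (Fin n) K} :
    p ∈ maxIdeal K n ↔ constantCoeff p = 0 := by
  constructor
  · intro h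
    have : maxIdeal K n ≤ RingHom.ker (constantCoeff (σ := Fin n) (R := K)) := by
      rw [maxIdeal, Ideal.span_le]
      rintro _ ⟨i, rfl⟩
      simp
    exact this h
  · intro h
    have h1 : ∀ q : MvPolynomial (Fin n) K, q - C (constantCoeff q) ∈ maxIdeal K n := by
      intro q
      induction q using MvPolynomial.induction_on with
      | C a => simp
      | add p q hp hq =>
        rw [map_add, map_add, add_sub_add_comm]
        exact add_mem hp hq
      | mul_X p i _ =>
        rw [map_mul, constantCoeff_X, mul_zero, map_zero, sub_zero]
        exact Ideal.mul_mem_left _ _ (Ideal.subset_span ⟨i, rfl⟩)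
    simpa [h] using h1 p

instance isMaximal_maxIdeal : (maxIdeal K n).IsMaximal := by
  have : maxIdeal K n = RingHom.ker (constantCoeff (σ := Fin n) (R := K)) := by
    ext p; rw [mem_maxIdeal_iff, RingHom.mem_ker]
  rw [this]
  exact RingHom.ker_isMaximal_of_surjective _ fun a => ⟨C a, by simp⟩

lemma _root_.MvPolynomial.IsHomogeneous.mem_maxIdeal_pow {p : MvPolynomial (Fin n) K} {N : ℕ}
    (hp : p.IsHomogeneous N) : p ∈ maxIdeal K n ^ N := by
  rw [maxIdeal, Ideal.mem_span_pow_iff_exists_isHomogeneous]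
  refine ⟨map C p, hp.map _, ?_⟩
  rw [eval_map]
  exact eval₂_eta p

lemma _root_.MvPolynomial.IsHomogeneous.mem_maxIdeal {p : MvPolynomial (Fin n) K} {N : ℕ}
    (hp : p.IsHomogeneous N) (hN : N ≠ 0) : p ∈ maxIdeal K n :=
  Ideal.pow_le_self hN hp.mem_maxIdeal_pow

/-- An ideal that contains the homogeneous components of its elements. -/
def IsGradedIdeal (I : Ideal (MvPolynomial (Fin n) K)) : Prop :=
  ∀ p ∈ I, ∀ k, homogeneousComponent k p ∈ I

lemma IsGradedIdeal.le_of_forall {I J : Ideal (MvPolynomial (Fin n) K)} (hI : IsGradedIdeal I)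
    (h : ∀ k, ∀ p ∈ I, p.IsHomogeneous k → p ∈ J) : I ≤ J := by
  intro p hp
  rw [← sum_homogeneousComponent p]
  exact sum_mem fun k _ => h k _ (hI p hp k) (homogeneousComponent_isHomogeneous k p)

/-- The linear form with the given coefficients. -/
def linForm (c : Fin n → K) : MvPolynomial (Fin n) K := ∑ i, C (c i) * X i

lemma linForm_isHomogeneous (c : Fin n → K) : (linForm c).IsHomogeneous 1 :=
  IsHomogeneous.sum _ _ _ fun i _ => isHomogeneous_C_mul_X (c i) i

/-- `a` is annihilated modulo `I` by a power of the maximal ideal. -/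
def InSaturation (I : Ideal (MvPolynomial (Fin n) K)) (a : MvPolynomial (Fin n) K) : Prop :=
  ∃ N, ∀ c ∈ maxIdeal K n ^ N, c * a ∈ I

/-- The power of the maximal ideal is generated by the monomials of degree `N`. -/
lemma inSaturation_of_forall_isHomogeneous {I : Ideal (MvPolynomial (Fin n) K)}
    {a : MvPolynomial (Fin n) K} {N : ℕ}
    (h : ∀ c : MvPolynomial (Fin n) K, c.IsHomogeneous N → c * a ∈ I) : InSaturation I a := by
  refine ⟨N, fun c hc => ?_⟩
  rw [maxIdeal, Ideal.mem_span_pow_iff_exists_isHomogeneous] at hc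
  obtain ⟨P, hP, rfl⟩ := hc
  rw [eval_eq, Finset.sum_mul]
  refine sum_mem fun d hd => ?_
  rw [mul_assoc]
  refine Ideal.mul_mem_left _ _ (h _ ?_)
  have hd' : d.degree = N := hP.degree_eq_sum_deg_support hd ▸ rfl
  rw [← hd', Finsupp.degree_eq_sum]
  have := IsHomogeneous.prod Finset.univ (fun i => (X i : MvPolynomial (Fin n) K) ^ d i) d
    (fun i _ => by simpa using isHomogeneous_X_pow (R := K) i (d i))
  refine (congrArg (fun q => IsHomogeneous q _) ?_).mp this
  exact (Finset.prod_subset (Finset.subset_univ _) (fun i _ hi => by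
    simp [Finsupp.notMem_support_iff.mp hi])).symm

/-- The saturation is itself saturated: exponents that work for finitely many generators of the
`N`-th power can be added to `N`. -/
lemma inSaturation_of_forall_mem {I : Ideal (MvPolynomial (Fin n) K)}
    {b : MvPolynomial (Fin n) K} {N : ℕ}
    (h : ∀ e ∈ maxIdeal K n ^ N, InSaturation I (e * b)) : InSaturation I b := by
  obtain ⟨T, hT⟩ := IsNoetherian.noetherian (maxIdeal K n ^ N)
  choose! D hD using h
  refine ⟨N + ∑ e ∈ T, D e, fun c hc => ?_⟩
  rw [pow_add] at hc
  refine Submodule.mul_induction_on hc (fun e he f hf => ?_) (fun x y hx hy => ?_)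
  · rw [← hT] at he
    refine Submodule.span_induction (fun e he => ?_) (by simp) (fun x y _ _ hx hy => ?_)
      (fun a x _ hx => ?_) he
    · rw [mul_comm e, mul_assoc]
      exact hD e (hT ▸ Submodule.subset_span he) f
        (Ideal.pow_le_pow_right (Finset.single_le_sum (fun _ _ => Nat.zero_le _) he) hf)
    · rw [add_mul, add_mul]; exact add_mem hx hy
    · rw [smul_eq_mul, mul_assoc, mul_assoc, ← mul_assoc x]; exact Ideal.mul_mem_left _ _ hx
  · rw [add_mul]; exact add_mem hx hy

/-- `y` is a filter-regular element for `S/I`. -/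
def FilterRegular (I : Ideal (MvPolynomial (Fin n) K)) (y : MvPolynomial (Fin n) K) : Prop :=
  ∀ a, y * a ∈ I → InSaturation I a

/-- If $ya\in I$, then `y` annihilates the class of `a`. The minimal primes over that annihilator
are associated primes of $S/I$ and contain `y`, so each is the maximal ideal, and a power of it
kills the class. -/
lemma filterRegular_of_notMem (I : Ideal (MvPolynomial (Fin n) K)) (y : MvPolynomial (Fin n) K)
    (hy : ∀ p ∈ associatedPrimes (MvPolynomial (Fin n) K) (MvPolynomial (Fin n) K ⧸ I),
      p ≠ maxIdeal K n → y ∉ p) : FilterRegular I y := by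
  intro a ha
  let x : MvPolynomial (Fin n) K ⧸ I := Ideal.Quotient.mk I a
  let M := Submodule.span (MvPolynomial (Fin n) K) {x}
  have hmem : ∀ b, b ∈ Module.annihilator (MvPolynomial (Fin n) K) M ↔ b * a ∈ I := by
    intro b
    rw [Submodule.mem_annihilator_span_singleton, ← Ideal.Quotient.eq_zero_iff_mem, map_mul]
    rfl
  have hle : maxIdeal K n ≤ (Module.annihilator (MvPolynomial (Fin n) K) M).radical := by
    rw [← Ideal.sInf_minimalPrimes]
    refine le_sInf fun p hp => ?_
    have h1 := Module.associatedPrimes.minimalPrimes_annihilator_subset_associatedPrimes _ _ hp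
    have h2 := associatedPrimes.subset_of_injective M.injective_subtype h1
    by_contra h
    refine hy p h2 (fun h3 => h h3.ge) (hp.1.2 ((hmem y).mpr ha))
  obtain ⟨N, hN⟩ := Ideal.exists_pow_le_of_le_radical_of_fg hle (IsNoetherian.noetherian _)
  exact ⟨N, fun c hc => (hmem c).mp (hN hc)⟩

/-- Over an infinite field there are filter-regular linear forms. -/
lemma exists_filterRegular_linForm [Infinite K] (I : Ideal (MvPolynomial (Fin n) K))
    (i₀ : Fin n) : ∃ c : Fin n → K, c i₀ ≠ 0 ∧ FilterRegular I (linForm c) := by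
  classical
  let L : (Fin n → K) →ₗ[K] MvPolynomial (Fin n) K :=
    ∑ i, (LinearMap.toSpanSingleton K (MvPolynomial (Fin n) K) (X i)).comp (LinearMap.proj i)
  have hL : ∀ c, L c = linForm c := fun c => by
    simp [L, linForm, smul_eq_C_mul]
  have hfin := associatedPrimes.finite (MvPolynomial (Fin n) K) (MvPolynomial (Fin n) K ⧸ I)
  -- A vector space over an infinite field is not a finite union of proper subspaces. One subspace
  -- is taken for each associated prime to avoid, and one more for `c i₀ = 0`, so that the chosen
  -- form can be solved for the variable `i₀`.
  let T : Finset (Subspace K (Fin n → K)) :=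
    insert (LinearMap.ker (LinearMap.proj i₀)) ((hfin.toFinset.erase (maxIdeal K n)).image
      fun p => (p.restrictScalars K).comap L)
  have hT : ⊤ ∉ T := by
    intro h
    rw [Finset.mem_insert, Finset.mem_image] at h
    rcases h with h | ⟨p, hp, h⟩
    · have : (Pi.single i₀ 1 : Fin n → K) ∈ LinearMap.ker (LinearMap.proj (R := K)
        (φ := fun _ : Fin n => K) i₀) := by rw [← h]; trivial
      simp at this
    · rw [Finset.mem_erase, Set.Finite.mem_toFinset] at hp
      -- A prime containing every linear form contains all variables.
      refine hp.1 (isMaximal_maxIdeal.eq_of_le hp.2.isPrime.ne_top ?_).symm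
      rw [maxIdeal, Ideal.span_le]
      rintro _ ⟨i, rfl⟩
      have : (Pi.single i 1 : Fin n → K) ∈ (p.restrictScalars K).comap L := by rw [h]; trivial
      rw [Submodule.mem_comap, hL, linForm] at this
      simpa [Pi.single_apply, apply_ite C, ite_mul] using this
  obtain ⟨c, hc⟩ := (Set.ne_univ_iff_exists_notMem _).mp (Subspace.biUnion_ne_univ_of_top_notMem hT)
  simp only [Set.mem_iUnion, not_exists] at hc
  refine ⟨c, fun h => hc _ (Finset.mem_insert_self _ _) h,
    filterRegular_of_notMem _ _ fun p hp hne h => ?_⟩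
  refine hc _ (Finset.mem_insert_of_mem (Finset.mem_image_of_mem _
    (Finset.mem_erase.mpr ⟨hne, hfin.mem_toFinset.mpr hp⟩))) ?_
  change L c ∈ p
  rwa [hL]

/-- The images of the variables when the linear form with coefficients `c` is set to zero by
solving for the first variable. -/
def elimVars (c : Fin (m + 1) → K) : Fin (m + 1) → MvPolynomial (Fin m) K :=
  Fin.cons (∑ j, C (-(c 0)⁻¹ * c j.succ) * X j) fun j => X j

/-- Elimination of the first variable by means of a linear form. -/
def elim (c : Fin (m + 1) → K) : MvPolynomial (Fin (m + 1)) K →ₐ[K] MvPolynomial (Fin m) K :=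
  aeval (elimVars c)

lemma elimVars_isHomogeneous (c : Fin (m + 1) → K) (i : Fin (m + 1)) :
    (elimVars c i).IsHomogeneous 1 := by
  refine Fin.cases ?_ (fun j => ?_) i
  · exact IsHomogeneous.sum Finset.univ (fun j : Fin m => C (-(c 0)⁻¹ * c j.succ) * X j) 1
      fun j _ => isHomogeneous_C_mul_X _ j
  · exact isHomogeneous_X K j

lemma elim_X_succ (c : Fin (m + 1) → K) (j : Fin m) : elim c (X j.succ) = X j := by
  simp [elim, elimVars]

lemma elim_rename (c : Fin (m + 1) → K) (p : MvPolynomial (Fin m) K) :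
    elim c (rename Fin.succ p) = p := by
  have : (elim c).comp (rename Fin.succ) = AlgHom.id K _ := by
    ext j
    simp [elim_X_succ]
  exact DFunLike.congr_fun this p

lemma elim_surjective (c : Fin (m + 1) → K) : Function.Surjective (elim c) :=
  fun p => ⟨_, elim_rename c p⟩

lemma elim_linForm {c : Fin (m + 1) → K} (hc : c 0 ≠ 0) : elim c (linForm c) = 0 := by
  rw [linForm, map_sum, Fin.sum_univ_succ]
  simp only [map_mul, elim_X_succ]
  have h : elim c (X 0) = ∑ j, C (-(c 0)⁻¹ * c j.succ) * X j := by simp [elim, elimVars]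
  have hC : ∀ a : K, elim c (C a) = C a := fun a => by simp [elim]
  rw [h, hC, Finset.mul_sum, ← Finset.sum_add_distrib]
  refine Finset.sum_eq_zero fun j _ => ?_
  rw [hC, ← mul_assoc, ← map_mul, ← add_mul, ← map_add]
  rw [show c 0 * (-(c 0)⁻¹ * c j.succ) + c j.succ = 0 by field_simp; ring]
  simp

/-- Every variable agrees, modulo the linear form, with its image under elimination followed by the
section `rename Fin.succ`. This identifies the kernel of `elim c`. -/
lemma sub_rename_elim_mem {c : Fin (m + 1) → K} (hc : c 0 ≠ 0)
    (p : MvPolynomial (Fin (m + 1)) K) :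
    p - rename Fin.succ (elim c p) ∈ Ideal.span {linForm c} := by
  induction p using MvPolynomial.induction_on with
  | C a => simp [elim]
  | add p q hp hq =>
    rw [map_add, map_add, add_sub_add_comm]
    exact add_mem hp hq
  | mul_X p i hp =>
    have hX : X i - rename Fin.succ (elim c (X i)) ∈ Ideal.span {linForm c} := by
      refine Fin.cases ?_ (fun j => ?_) i
      · rw [Ideal.mem_span_singleton]
        refine ⟨C (c 0)⁻¹, ?_⟩
        have h : elim c (X 0) = ∑ j, C (-(c 0)⁻¹ * c j.succ) * X j := by simp [elim, elimVars]
        rw [h, linForm, Fin.sum_univ_succ, add_mul, Finset.sum_mul, map_sum, sub_eq_add_neg,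
          ← Finset.sum_neg_distrib]
        congr 1
        · rw [mul_comm, ← mul_assoc, ← map_mul, inv_mul_cancel₀ hc, map_one, one_mul]
        · refine Finset.sum_congr rfl fun j _ => ?_
          simp only [map_mul, map_neg, rename_C, rename_X]
          ring
      · rw [elim_X_succ, rename_X, sub_self]
        exact zero_mem _
    have : p * X i - rename Fin.succ (elim c (p * X i)) =
        (p - rename Fin.succ (elim c p)) * X i +
          rename Fin.succ (elim c p) * (X i - rename Fin.succ (elim c (X i))) := by
      rw [map_mul, map_mul]; ring
    rw [this]
    exact add_mem (Ideal.mul_mem_right _ _ hp) (Ideal.mul_mem_left _ _ hX)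

lemma elim_eq_zero_iff {c : Fin (m + 1) → K} (hc : c 0 ≠ 0)
    {p : MvPolynomial (Fin (m + 1)) K} : elim c p = 0 ↔ linForm c ∣ p := by
  constructor
  · intro h
    have := sub_rename_elim_mem hc p
    rwa [h, map_zero, sub_zero, Ideal.mem_span_singleton] at this
  · rintro ⟨q, rfl⟩
    rw [map_mul, elim_linForm hc, zero_mul]

/-- A `K`-algebra homomorphism sending the variables to linear forms. -/
def IsLinearSubst (ψ : MvPolynomial (Fin n) K →ₐ[K] MvPolynomial (Fin m) K) : Prop :=
  ∀ i, (ψ (X i)).IsHomogeneous 1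

lemma isLinearSubst_elim (c : Fin (m + 1) → K) : IsLinearSubst (elim c) := fun i => by
  rw [elim, aeval_X]
  exact elimVars_isHomogeneous c i

namespace IsLinearSubst

variable {ψ : MvPolynomial (Fin n) K →ₐ[K] MvPolynomial (Fin m) K}

lemma isHomogeneous (hψ : IsLinearSubst ψ) {p : MvPolynomial (Fin n) K} {k : ℕ}
    (hp : p.IsHomogeneous k) : (ψ p).IsHomogeneous k := by
  have h := hp.aeval (fun i => ψ (X i)) hψ
  rw [one_mul] at h
  rwa [show (fun i => ψ (X i)) = ψ ∘ X from rfl, ← aeval_unique ψ] at h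

lemma homogeneousComponent (hψ : IsLinearSubst ψ) (p : MvPolynomial (Fin n) K) (k : ℕ) :
    homogeneousComponent k (ψ p) = ψ (MvPolynomial.homogeneousComponent k p) := by
  conv_lhs => rw [← sum_homogeneousComponent p, map_sum, map_sum]
  have h : ∀ i, MvPolynomial.homogeneousComponent k (ψ (MvPolynomial.homogeneousComponent i p)) =
      if k = i then ψ (MvPolynomial.homogeneousComponent k p) else 0 := by
    intro i
    rw [homogeneousComponent_of_mem (hψ.isHomogeneous (homogeneousComponent_isHomogeneous i p))]
    split_ifs with h
    · rw [h]
    · rfl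
  simp only [h, Finset.sum_ite_eq, Finset.mem_range]
  split_ifs with h
  · rfl
  · rw [homogeneousComponent_eq_zero _ _ (by omega), map_zero]

lemma isGradedIdeal_map (hψ : IsLinearSubst ψ) (hs : Function.Surjective ψ)
    {I : Ideal (MvPolynomial (Fin n) K)} (hI : IsGradedIdeal I) : IsGradedIdeal (I.map ψ) := by
  intro p hp k
  obtain ⟨a, ha, rfl⟩ := (Ideal.mem_map_iff_of_surjective ψ hs).mp hp
  rw [hψ.homogeneousComponent]
  exact Ideal.mem_map_of_mem ψ (hI a ha k)

lemma map_idealPiece (hψ : IsLinearSubst ψ) (hs : Function.Surjective ψ)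
    {I : Ideal (MvPolynomial (Fin n) K)} (hI : IsGradedIdeal I) (k : ℕ) :
    (idealPiece I k).map ψ.toLinearMap = idealPiece (I.map ψ) k := by
  ext p
  constructor
  · rintro ⟨a, ⟨h1, h2⟩, rfl⟩
    exact ⟨hψ.isHomogeneous h1, Ideal.mem_map_of_mem ψ h2⟩
  · rintro ⟨h1, h2⟩
    obtain ⟨a, ha, rfl⟩ := (Ideal.mem_map_iff_of_surjective ψ hs).mp h2
    refine ⟨MvPolynomial.homogeneousComponent k a,
      ⟨homogeneousComponent_isHomogeneous _ _, hI a ha k⟩, ?_⟩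
    rw [AlgHom.toLinearMap_apply, ← hψ.homogeneousComponent]
    exact homogeneousComponent_eq_self h1

lemma map_le_maxIdeal (hψ : IsLinearSubst ψ) {I : Ideal (MvPolynomial (Fin n) K)}
    (hI : I ≤ maxIdeal K n) : I.map ψ ≤ maxIdeal K m := by
  refine (Ideal.map_mono hI).trans ?_
  rw [maxIdeal, Ideal.map_span, Ideal.span_le]
  rintro _ ⟨_, ⟨i, rfl⟩, rfl⟩
  exact (hψ i).mem_maxIdeal one_ne_zero

end IsLinearSubst

/-- The ideal `I : y`. -/
def colonElem (I : Ideal (MvPolynomial (Fin n) K)) (y : MvPolynomial (Fin n) K) :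
    Ideal (MvPolynomial (Fin n) K) :=
  Submodule.comap (LinearMap.mulLeft (MvPolynomial (Fin n) K) y) I

lemma mem_colonElem {I : Ideal (MvPolynomial (Fin n) K)} {y a : MvPolynomial (Fin n) K} :
    a ∈ colonElem I y ↔ y * a ∈ I := Iff.rfl

lemma le_colonElem (I : Ideal (MvPolynomial (Fin n) K)) (y : MvPolynomial (Fin n) K) :
    I ≤ colonElem I y := fun _ ha => Ideal.mul_mem_left _ _ ha

lemma isGradedIdeal_colonElem {I : Ideal (MvPolynomial (Fin n) K)} (hI : IsGradedIdeal I)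
    {y : MvPolynomial (Fin n) K} {t : ℕ} (hy : y.IsHomogeneous t) :
    IsGradedIdeal (colonElem I y) := by
  intro p hp k
  have := hI _ (mem_colonElem.mp hp) (k + t)
  rw [mul_comm, homogeneousComponent_mul_of_isHomogeneous hy, if_pos (Nat.le_add_left _ _),
    Nat.add_sub_cancel] at this
  rwa [mem_colonElem, mul_comm]

lemma idealPiece_mono {I J : Ideal (MvPolynomial (Fin n) K)} (h : I ≤ J) (k : ℕ) :
    idealPiece I k ≤ idealPiece J k := fun _ hp => ⟨hp.1, h hp.2⟩

lemma hilbertFunction_anti {I J : Ideal (MvPolynomial (Fin n) K)} (h : I ≤ J) (k : ℕ) :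
    hilbertFunction J k ≤ hilbertFunction I k := by
  have h1 := hilbertFunction_add_finrank_idealPiece I k
  have h2 := hilbertFunction_add_finrank_idealPiece J k
  have h3 := Submodule.finrank_mono (idealPiece_mono h k)
  omega

lemma eq_of_hilbertFunction_eq {I J : Ideal (MvPolynomial (Fin n) K)} (hJ : IsGradedIdeal J)
    (h : I ≤ J) (hH : ∀ k, hilbertFunction J k = hilbertFunction I k) : I = J := by
  refine le_antisymm h (hJ.le_of_forall fun k p hp hk => ?_)
  have h1 := hilbertFunction_add_finrank_idealPiece I k
  have h2 := hilbertFunction_add_finrank_idealPiece J k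
  have h3 : idealPiece I k = idealPiece J k :=
    Submodule.eq_of_le_of_finrank_eq (idealPiece_mono h k) (by have := hH k; omega)
  have : p ∈ idealPiece I k := h3 ▸ (⟨hk, hp⟩ : p ∈ idealPiece J k)
  exact this.2

lemma linForm_ne_zero {c : Fin (m + 1) → K} (hc : c 0 ≠ 0) : linForm c ≠ 0 := by
  intro h
  have := congrArg (coeff (Finsupp.single 0 1)) h
  rw [linForm, coeff_sum, coeff_zero] at this
  simp only [coeff_C_mul, coeff_X, Finsupp.single_left_inj one_ne_zero] at this
  simp at this
  exact hc this

/-- The Hilbert function of the section of `S/I` by a linear form. -/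
lemma hilbertFunction_map_elim_succ {c : Fin (m + 1) → K} (hc : c 0 ≠ 0)
    {I : Ideal (MvPolynomial (Fin (m + 1)) K)} (hI : IsGradedIdeal I) (k : ℕ) :
    hilbertFunction (I.map (elim c)) (k + 1) + hilbertFunction (colonElem I (linForm c)) k =
      hilbertFunction I (k + 1) := by
  have h1 := hilbertFunction_add_finrank_idealPiece I (k + 1)
  have h2 := hilbertFunction_add_finrank_idealPiece (I.map (elim c)) (k + 1)
  have h3 := hilbertFunction_add_finrank_idealPiece (colonElem I (linForm c)) k
  have h4 := finrank_map_add_finrank_inf_ker (elim c).toLinearMap (idealPiece I (k + 1))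
  rw [(isLinearSubst_elim c).map_idealPiece (elim_surjective c) hI] at h4
  -- What elimination kills in $I_{k+1}$ is $y\cdot(I:y)_k$, and multiplication by $y$ is injective.
  have h5 : idealPiece I (k + 1) ⊓ LinearMap.ker (elim c).toLinearMap =
      (idealPiece (colonElem I (linForm c)) k).map (LinearMap.mulLeft K (linForm c)) := by
    ext p
    constructor
    · rintro ⟨⟨hp1, hp2⟩, hp3⟩
      obtain ⟨q, rfl⟩ := (elim_eq_zero_iff hc).mp hp3
      have : linForm c * q = linForm c * homogeneousComponent k q := by
        rw [← homogeneousComponent_eq_self hp1, mul_comm,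
          homogeneousComponent_mul_of_isHomogeneous (linForm_isHomogeneous c),
          if_pos (Nat.le_add_left _ _), Nat.add_sub_cancel, mul_comm]
      refine ⟨homogeneousComponent k q, ⟨homogeneousComponent_isHomogeneous _ _, ?_⟩, this.symm⟩
      change linForm c * homogeneousComponent k q ∈ I
      rw [← this]
      exact hp2
    · rintro ⟨q, ⟨hq1, hq2⟩, rfl⟩
      refine ⟨⟨?_, hq2⟩, (elim_eq_zero_iff hc).mpr (dvd_mul_right _ _)⟩
      have := (linForm_isHomogeneous c).mul hq1
      rwa [add_comm 1 k] at this
  have h6 := (Submodule.equivMapOfInjective (LinearMap.mulLeft K (linForm c))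
    (mul_right_injective₀ (linForm_ne_zero hc))
    (idealPiece (colonElem I (linForm c)) k)).finrank_eq
  rw [h5, ← h6] at h4
  -- Pascal's rule matches the dimensions of the polynomial rings in `m + 1` and `m` variables.
  have h7 := Nat.multichoose_succ_succ m k
  omega

lemma hilbertFunction_map_elim_zero (c : Fin (m + 1) → K)
    {I : Ideal (MvPolynomial (Fin (m + 1)) K)} (hI : IsGradedIdeal I) :
    hilbertFunction (I.map (elim c)) 0 = hilbertFunction I 0 := by
  have h1 := hilbertFunction_add_finrank_idealPiece I 0
  have h2 := hilbertFunction_add_finrank_idealPiece (I.map (elim c)) 0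
  have h4 := finrank_map_add_finrank_inf_ker (elim c).toLinearMap (idealPiece I 0)
  rw [(isLinearSubst_elim c).map_idealPiece (elim_surjective c) hI] at h4
  have h5 : idealPiece I 0 ⊓ LinearMap.ker (elim c).toLinearMap = ⊥ := by
    rw [eq_bot_iff]
    rintro p ⟨⟨hp1, hp2⟩, hp3⟩
    have h : p = C (coeff 0 p) := by
      rw [← homogeneousComponent_zero, homogeneousComponent_eq_self hp1]
    replace hp3 : elim c p = 0 := hp3
    rw [h] at hp3
    rw [Submodule.mem_bot, h]
    simpa [elim] using hp3
  rw [h5, finrank_bot] at h4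
  simp only [Nat.multichoose_zero_right] at h1 h2
  omega

/-- For a filter-regular element `y`, the ideals `I` and `I : y` agree in large degrees. -/
lemma exists_idealPiece_colonElem_le {I : Ideal (MvPolynomial (Fin n) K)} (hI : IsGradedIdeal I)
    {y : MvPolynomial (Fin n) K} {t : ℕ} (hy : y.IsHomogeneous t) (hreg : FilterRegular I y) :
    ∃ D, ∀ k ≥ D, idealPiece (colonElem I y) k ≤ idealPiece I k := by
  obtain ⟨T, hT⟩ := IsNoetherian.noetherian (colonElem I y)
  have hmem : ∀ h ∈ T, h ∈ colonElem I y := fun h hh => hT ▸ Submodule.subset_span hh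
  have hN : ∀ h : T, ∀ i, ∃ N, ∀ c ∈ maxIdeal K n ^ N,
      c * homogeneousComponent i h.1 ∈ I := fun h i =>
    hreg _ (isGradedIdeal_colonElem hI hy _ (hmem _ h.2) i)
  choose N hN using hN
  -- Large enough that in degree `k ≥ D` the coefficient of each component of degree `i` of a
  -- generator has degree `k - i` at least the exponent killing that component.
  let D := ∑ h : T, (h.1.totalDegree + ∑ i ∈ Finset.range (h.1.totalDegree + 1), N h i)
  refine ⟨D, fun k hk p hp => ⟨hp.1, ?_⟩⟩
  have hpT : p ∈ Submodule.span (MvPolynomial (Fin n) K) (T : Set (MvPolynomial (Fin n) K)) :=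
    hT ▸ hp.2
  rw [Submodule.mem_span_finset'] at hpT
  obtain ⟨f, rfl⟩ := hpT
  rw [← homogeneousComponent_eq_self hp.1, map_sum]
  refine sum_mem fun h _ => ?_
  rw [smul_eq_mul, ← sum_homogeneousComponent h.1, Finset.mul_sum, map_sum]
  refine sum_mem fun i hi => ?_
  rw [homogeneousComponent_mul_of_isHomogeneous (homogeneousComponent_isHomogeneous i h.1)]
  have h1 : h.1.totalDegree + ∑ i ∈ Finset.range (h.1.totalDegree + 1), N h i ≤ D :=
    Finset.single_le_sum (f := fun h : T => h.1.totalDegree +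
      ∑ i ∈ Finset.range (h.1.totalDegree + 1), N h i) (fun _ _ => Nat.zero_le _)
      (Finset.mem_univ h)
  have h2 : N h i ≤ ∑ i ∈ Finset.range (h.1.totalDegree + 1), N h i :=
    Finset.single_le_sum (f := fun i => N h i) (fun _ _ => Nat.zero_le _) hi
  have h3 := Finset.mem_range.mp hi
  rw [if_pos (by omega)]
  refine hN h i _ (Ideal.pow_le_pow_right ?_
    (homogeneousComponent_isHomogeneous (k - i) (f h)).mem_maxIdeal_pow)
  omega

end Elimination

/-! ### Cutting down to two variables -/

section Reduction

variable {K : Type*} [Field K] {n m : ℕ}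

/-- `S/I` has a regular sequence of length `k` in the graded maximal ideal of `S`. -/
def HasRegularSequence (I : Ideal (MvPolynomial (Fin n) K)) (k : ℕ) : Prop :=
  ∃ rs : List (MvPolynomial (Fin n) K), rs.length = k ∧ (∀ r ∈ rs, r ∈ maxIdeal K n) ∧
    RingTheory.Sequence.IsRegular (MvPolynomial (Fin n) K ⧸ I) rs

lemma hasRegularSequence_zero {I : Ideal (MvPolynomial (Fin n) K)} (hI : I ≠ ⊤) :
    HasRegularSequence I 0 := by
  have : Nontrivial (MvPolynomial (Fin n) K ⧸ I) := Ideal.Quotient.nontrivial_iff.mpr hI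
  exact ⟨[], rfl, by simp, RingTheory.Sequence.IsRegular.nil _ _⟩

/-- If `S/I` has a regular element in the maximal ideal, then `I` is saturated. -/
lemma HasRegularSequence.mem_of_inSaturation {I : Ideal (MvPolynomial (Fin n) K)} {k : ℕ}
    (h : HasRegularSequence I (k + 1)) {a : MvPolynomial (Fin n) K} (ha : InSaturation I a) :
    a ∈ I := by
  obtain ⟨rs, hlen, hmem, hreg⟩ := h
  rcases rs with _ | ⟨x, rs⟩
  · simp at hlen
  have hx := ((RingTheory.Sequence.isRegular_cons_iff _ _ _).mp hreg).1
  have hxm := hmem x List.mem_cons_self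
  obtain ⟨N, hN⟩ := ha
  have h1 := hx.pow N
  rw [← Ideal.Quotient.eq_zero_iff_mem]
  refine h1.right_eq_zero_of_smul ?_
  change Ideal.Quotient.mk I (x ^ N * a) = 0
  rw [Ideal.Quotient.eq_zero_iff_mem]
  exact hN _ (Ideal.pow_mem_pow hxm N)

/-- The map from the quotient of `S/I` by a linear form to a quotient of a polynomial ring in
fewer variables. -/
def quotSMulTopHom {c : Fin (m + 1) → K} (hc : c 0 ≠ 0)
    (I : Ideal (MvPolynomial (Fin (m + 1)) K)) :
    QuotSMulTop (linForm c) (MvPolynomial (Fin (m + 1)) K ⧸ I) →+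
      (MvPolynomial (Fin m) K ⧸ I.map (elim c)) :=
  QuotientAddGroup.lift _ (Ideal.quotientMap (I.map (elim c)) (elim c).toRingHom
    Ideal.le_comap_map).toAddMonoidHom <| by
    intro x hx
    obtain ⟨y, -, rfl⟩ := (Submodule.mem_smul_pointwise_iff_exists _ _ _).mp hx
    obtain ⟨y, rfl⟩ := Ideal.Quotient.mk_surjective y
    change Ideal.Quotient.mk (I.map (elim c)) (elim c (linForm c * y)) = 0
    rw [map_mul, elim_linForm hc, zero_mul, map_zero]

/-- The quotient of `S/I` by a linear form, as a quotient of a polynomial ring in fewer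
variables. -/
def quotSMulTopEquiv {c : Fin (m + 1) → K} (hc : c 0 ≠ 0)
    (I : Ideal (MvPolynomial (Fin (m + 1)) K)) :
    QuotSMulTop (linForm c) (MvPolynomial (Fin (m + 1)) K ⧸ I) ≃+
      (MvPolynomial (Fin m) K ⧸ I.map (elim c)) := by
  refine AddEquiv.ofBijective (quotSMulTopHom hc I)
    ⟨(injective_iff_map_eq_zero (quotSMulTopHom hc I)).mpr ?_, ?_⟩
  · intro x hx
    obtain ⟨x, rfl⟩ := QuotientAddGroup.mk_surjective x
    obtain ⟨x, rfl⟩ := Ideal.Quotient.mk_surjective x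
    replace hx : Ideal.Quotient.mk (I.map (elim c)) (elim c x) = 0 := hx
    rw [Ideal.Quotient.eq_zero_iff_mem,
      Ideal.mem_map_iff_of_surjective _ (elim_surjective c)] at hx
    obtain ⟨a, ha, hax⟩ := hx
    have h0 : elim c (x - a) = 0 := by rw [map_sub, hax, sub_self]
    obtain ⟨q, hq⟩ := (elim_eq_zero_iff hc).mp h0
    refine (Submodule.Quotient.mk_eq_zero _).mpr ?_
    refine (Submodule.mem_smul_pointwise_iff_exists _ _ _).mpr
      ⟨Ideal.Quotient.mk I q, trivial, ?_⟩
    change Ideal.Quotient.mk I (linForm c * q) = _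
    rw [← hq, map_sub, Ideal.Quotient.eq_zero_iff_mem.mpr ha, sub_zero]
  · intro y
    obtain ⟨y, rfl⟩ := Ideal.Quotient.mk_surjective y
    refine ⟨QuotientAddGroup.mk (Ideal.Quotient.mk I (rename Fin.succ y)), ?_⟩
    change Ideal.Quotient.mk (I.map (elim c)) (elim c (rename Fin.succ y)) = _
    rw [elim_rename]

/-- The two sides are modules over different polynomial rings; compatibility along the section
`rename Fin.succ` suffices to transport regular sequences through an additive equivalence. -/
lemma quotSMulTopEquiv_smul {c : Fin (m + 1) → K} (hc : c 0 ≠ 0)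
    (I : Ideal (MvPolynomial (Fin (m + 1)) K)) (s : MvPolynomial (Fin m) K)
    (x : QuotSMulTop (linForm c) (MvPolynomial (Fin (m + 1)) K ⧸ I)) :
    quotSMulTopEquiv hc I ((rename Fin.succ s : MvPolynomial (Fin (m + 1)) K) • x) =
      s • quotSMulTopEquiv hc I x := by
  obtain ⟨x, rfl⟩ := QuotientAddGroup.mk_surjective x
  obtain ⟨x, rfl⟩ := Ideal.Quotient.mk_surjective x
  change Ideal.Quotient.mk (I.map (elim c)) (elim c (rename Fin.succ s * x)) =
    Ideal.Quotient.mk (I.map (elim c)) (s * elim c x)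
  rw [map_mul, elim_rename]

lemma HasRegularSequence.of_map_elim {c : Fin (m + 1) → K} (hc : c 0 ≠ 0)
    {I : Ideal (MvPolynomial (Fin (m + 1)) K)} (hreg : colonElem I (linForm c) ≤ I) {k : ℕ}
    (h : HasRegularSequence (I.map (elim c)) k) : HasRegularSequence I (k + 1) := by
  obtain ⟨rs, hlen, hmem, hr⟩ := h
  refine ⟨linForm c :: rs.map (rename Fin.succ), by simp [hlen], ?_, ?_⟩
  · intro r hr
    rcases List.mem_cons.mp hr with rfl | hr
    · exact (linForm_isHomogeneous c).mem_maxIdeal one_ne_zero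
    · obtain ⟨s, hs, rfl⟩ := List.mem_map.mp hr
      rw [mem_maxIdeal_iff, constantCoeff_rename]
      exact mem_maxIdeal_iff.mp (hmem s hs)
  · rw [RingTheory.Sequence.isRegular_cons_iff]
    constructor
    · rw [isSMulRegular_iff_right_eq_zero_of_smul]
      intro x hx
      obtain ⟨x, rfl⟩ := Ideal.Quotient.mk_surjective x
      replace hx : Ideal.Quotient.mk I (linForm c * x) = 0 := hx
      rw [Ideal.Quotient.eq_zero_iff_mem] at hx ⊢
      exact hreg hx
    · refine (AddEquiv.isRegular_congr (e := quotSMulTopEquiv hc I) ?_).mpr hr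
      rw [List.forall₂_map_left_iff, List.forall₂_same]
      exact fun s _ x => quotSMulTopEquiv_smul hc I s x

/-- If `y` is filter-regular for `S/I` and `I + (y)` is saturated, then `y` is regular. -/
lemma colonElem_le_of_saturated {c : Fin (m + 1) → K} (hc : c 0 ≠ 0)
    {I : Ideal (MvPolynomial (Fin (m + 1)) K)} (hI : IsGradedIdeal I)
    (hreg : FilterRegular I (linForm c))
    (hsat : ∀ a, InSaturation (I.map (elim c)) a → a ∈ I.map (elim c)) :
    colonElem I (linForm c) ≤ I := by
  have hcomp : ∀ a, InSaturation I a → ∀ k, InSaturation I (homogeneousComponent k a) := by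
    rintro a ⟨N, hN⟩ k
    refine inSaturation_of_forall_isHomogeneous (N := N) fun b hb => ?_
    have := hI _ (hN b hb.mem_maxIdeal_pow) (k + N)
    rwa [mul_comm, homogeneousComponent_mul_of_isHomogeneous hb, if_pos (Nat.le_add_left _ _),
      Nat.add_sub_cancel, mul_comm] at this
  -- An element of the saturation of `I` maps into the saturated section, so $a=i+yb$ with $i\in I$.
  -- For $e$ in a power of the maximal ideal, $y(eb)=ea-ei\in I$; filter-regularity puts $eb$, and
  -- then $b$, into the saturation of `I`.
  have hdecomp : ∀ a, InSaturation I a →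
      ∃ i ∈ I, ∃ b, InSaturation I b ∧ a = i + linForm c * b := by
    rintro a ⟨N, hN⟩
    have h1 : InSaturation (I.map (elim c)) (elim c a) := by
      refine inSaturation_of_forall_isHomogeneous (N := N) fun b hb => ?_
      have := Ideal.mem_map_of_mem (elim c)
        (hN _ (hb.rename_isHomogeneous (f := Fin.succ)).mem_maxIdeal_pow)
      rwa [map_mul, elim_rename] at this
    obtain ⟨i, hi, hia⟩ :=
      (Ideal.mem_map_iff_of_surjective _ (elim_surjective c)).mp (hsat _ h1)
    obtain ⟨b, hb⟩ := (elim_eq_zero_iff hc).mp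
      (show elim c (a - i) = 0 by rw [map_sub, hia, sub_self])
    refine ⟨i, hi, b, inSaturation_of_forall_mem (N := N) fun e he => hreg _ ?_,
      by rw [← hb]; ring⟩
    have : linForm c * (e * b) = e * a - e * i := by rw [← mul_sub, hb]; ring
    rw [this]
    exact sub_mem (hN e he) (Ideal.mul_mem_left _ _ hi)
  -- A graded Nakayama argument: the part of `b` that matters has degree one less than `a`.
  have hmem : ∀ k, ∀ a : MvPolynomial (Fin (m + 1)) K, a.IsHomogeneous k →
      InSaturation I a → a ∈ I := by
    intro k
    induction k with
    | zero =>
      intro a ha has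
      obtain ⟨i, hi, b, -, rfl⟩ := hdecomp a has
      have h := hI i hi 0
      rw [← homogeneousComponent_eq_self ha, map_add, mul_comm,
        homogeneousComponent_mul_of_isHomogeneous (linForm_isHomogeneous c), if_neg (by omega),
        add_zero]
      exact h
    | succ k ih =>
      intro a ha has
      obtain ⟨i, hi, b, hb, rfl⟩ := hdecomp a has
      rw [← homogeneousComponent_eq_self ha, map_add, mul_comm,
        homogeneousComponent_mul_of_isHomogeneous (linForm_isHomogeneous c), if_pos (by omega),
        Nat.add_sub_cancel]
      exact add_mem (hI i hi _) (Ideal.mul_mem_right _ _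
        (ih _ (homogeneousComponent_isHomogeneous _ _) (hcomp b hb k)))
  exact (isGradedIdeal_colonElem hI (linForm_isHomogeneous c)).le_of_forall
    fun k p hp hk => hmem k p hk (hreg p hp)

/-- The Hilbert series of the section of `S/I` by a filter-regular linear form. -/
lemma exists_hilbertSeries_map_elim {c : Fin (m + 1) → K} (hc : c 0 ≠ 0)
    {I : Ideal (MvPolynomial (Fin (m + 1)) K)} (hI : IsGradedIdeal I)
    (hreg : FilterRegular I (linForm c)) :
    ∃ E : Polynomial ℚ, hilbertSeries (I.map (elim c)) =
        hilbertSeries I * (1 - PowerSeries.X) + (E : PowerSeries ℚ) ∧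
      0 ≤ E.eval 1 ∧ (E.eval 1 = 0 → colonElem I (linForm c) ≤ I) := by
  obtain ⟨D, hD⟩ := exists_idealPiece_colonElem_le hI (linForm_isHomogeneous c) hreg
  have hle := le_colonElem I (linForm c)
  have hH : ∀ k ≥ D, hilbertFunction (colonElem I (linForm c)) k = hilbertFunction I k := by
    intro k hk
    have h1 := hilbertFunction_add_finrank_idealPiece I k
    have h2 := hilbertFunction_add_finrank_idealPiece (colonElem I (linForm c)) k
    rw [le_antisymm (hD k hk) (idealPiece_mono hle k)] at h2
    omega
  -- The Hilbert series of $(I:y)/I$, shifted by the degree of $y$. It is a polynomial by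
  -- filter-regularity, and `E.eval 1` is the length of that module.
  let E : Polynomial ℚ := ∑ k ∈ Finset.range D, Polynomial.monomial (k + 1)
    ((hilbertFunction I k : ℚ) - hilbertFunction (colonElem I (linForm c)) k)
  have hnn : ∀ k, (0 : ℚ) ≤ (hilbertFunction I k : ℚ) -
      hilbertFunction (colonElem I (linForm c)) k := fun k => by
    rw [sub_nonneg]
    exact_mod_cast hilbertFunction_anti hle k
  have hE : E.eval 1 = ∑ k ∈ Finset.range D, ((hilbertFunction I k : ℚ) -
      hilbertFunction (colonElem I (linForm c)) k) := by
    simp [E, Polynomial.eval_finsetSum]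
  refine ⟨E, ?_, ?_, ?_⟩
  · ext k
    rw [map_add, mul_sub, mul_one, map_sub, coeff_hilbertSeries, coeff_hilbertSeries,
      Polynomial.coeff_coe]
    rcases k with _ | k
    · rw [hilbertFunction_map_elim_zero c hI]
      simp [E, Polynomial.coeff_monomial]
    · rw [PowerSeries.coeff_succ_mul_X, coeff_hilbertSeries, ← hilbertFunction_map_elim_succ hc hI]
      have : E.coeff (k + 1) = (hilbertFunction I k : ℚ) -
          hilbertFunction (colonElem I (linForm c)) k := by
        simp only [E, Polynomial.finsetSum_coeff, Polynomial.coeff_monomial, add_left_inj,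
          Finset.sum_ite_eq', Finset.mem_range]
        split_ifs with h
        · rfl
        · rw [hH k (by omega), sub_self]
      rw [this]
      push_cast
      ring
  · rw [hE]
    exact Finset.sum_nonneg fun k _ => hnn k
  · intro h
    rw [hE, Finset.sum_eq_zero_iff_of_nonneg fun k _ => hnn k] at h
    refine (eq_of_hilbertFunction_eq (isGradedIdeal_colonElem hI (linForm_isHomogeneous c)) hle
      fun k => ?_).ge
    by_cases hk : k < D
    · have := h k (Finset.mem_range.mpr hk)
      rw [sub_eq_zero] at this
      exact_mod_cast this.symm
    · exact hH k (by omega)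

/-- Over an infinite field, a graded quotient of dimension at most `d` of a polynomial ring in
`d + 2` variables has a section by linear forms that is a quotient of finite length of a polynomial
ring in two variables; its length is at least the multiplicity, with equality only if there is a
regular sequence of length `d`. -/
lemma exists_linear_section [Infinite K] (d : ℕ) :
    ∀ (I : Ideal (MvPolynomial (Fin (d + 2)) K)) (Q : Polynomial ℚ), IsGradedIdeal I →
      I ≤ maxIdeal K (d + 2) → hilbertSeries I * (1 - PowerSeries.X) ^ d = (Q : PowerSeries ℚ) →
      ∃ ψ : MvPolynomial (Fin (d + 2)) K →ₐ[K] MvPolynomial (Fin 2) K,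
        IsLinearSubst ψ ∧ Function.Surjective ψ ∧ ∃ Q' : Polynomial ℚ,
          hilbertSeries (I.map ψ) = (Q' : PowerSeries ℚ) ∧ Q.eval 1 ≤ Q'.eval 1 ∧
          (Q.eval 1 = Q'.eval 1 → HasRegularSequence I d) := by
  induction d with
  | zero =>
    intro I Q hI hm hQ
    refine ⟨AlgHom.id K _, fun i => isHomogeneous_X K i, Function.surjective_id, Q, ?_, le_rfl,
      fun _ => hasRegularSequence_zero fun h => ?_⟩
    · rw [pow_zero, mul_one] at hQ
      rw [← hQ]
      congr 1
      exact Ideal.map_id I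
    · rw [h, top_le_iff] at hm
      exact isMaximal_maxIdeal.ne_top hm
  | succ d ih =>
    intro I Q hI hm hQ
    obtain ⟨c, hc, hreg⟩ := exists_filterRegular_linForm I 0
    obtain ⟨E, hE, hE0, hE1⟩ := exists_hilbertSeries_map_elim hc hI hreg
    have hJ := (isLinearSubst_elim c).isGradedIdeal_map (elim_surjective c) hI
    -- The correction $(1-t)^dE$ vanishes at $1$ unless $d=0$, so only the last cut can raise the
    -- multiplicity.
    obtain ⟨ψ, hψ, hs, Q', hQ', hle, heq⟩ := ih (I.map (elim c)) (Q + (1 - Polynomial.X) ^ d * E)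
      hJ ((isLinearSubst_elim c).map_le_maxIdeal hm) (by
        rw [hE, add_mul, mul_assoc, ← pow_succ', hQ]
        push_cast
        ring)
    refine ⟨ψ.comp (elim c), fun i => hψ.isHomogeneous (isLinearSubst_elim c i),
      hs.comp (elim_surjective c), Q', ?_, ?_, ?_⟩
    · rw [← hQ', Ideal.map_mapₐ]
    · refine le_trans ?_ hle
      rw [Polynomial.eval_add, Polynomial.eval_mul, Polynomial.eval_pow, Polynomial.eval_sub,
        Polynomial.eval_one, Polynomial.eval_X, sub_self]
      exact le_add_of_nonneg_right (mul_nonneg (pow_nonneg le_rfl _) hE0)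
    · intro h
      rw [Polynomial.eval_add, Polynomial.eval_mul, Polynomial.eval_pow, Polynomial.eval_sub,
        Polynomial.eval_one, Polynomial.eval_X, sub_self] at hle heq
      have h1 : (0 : ℚ) ^ d * E.eval 1 = 0 :=
        le_antisymm (by linarith) (mul_nonneg (pow_nonneg le_rfl _) hE0)
      have hseq := heq (by rw [h1, add_zero, h])
      refine hseq.of_map_elim hc ?_
      -- At the last cut, equality says that $(I:y)/I$ has length zero. At earlier cuts the section
      -- has a regular sequence of positive length, so it is saturated, and regularity lifts.
      rcases d with _ | d
      · exact hE1 (by simpa using h1)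
      · exact colonElem_le_of_saturated hc hI hreg fun a ha => hseq.mem_of_inSaturation ha

end Reduction

/-! ### Homogeneous bases of saturated submodules in two variables -/

section HomogeneousGenerators

variable {K : Type*} [Field K] {n : ℕ} {ι κ : Type*}

lemma isGradedMap_linearCombination [Fintype κ] [DecidableEq κ] {a : ι → ℕ} {c : κ → ℕ}
    {z : κ → ι → MvPolynomial (Fin n) K} (hz : ∀ j, z j ∈ gradedPiece a (c j)) :
    IsGradedMap (Fintype.linearCombination (MvPolynomial (Fin n) K) z) c a := by
  intro j i
  rw [Fintype.linearCombination_apply_single, one_smul]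
  exact mem_shiftedDegree.mp (mem_gradedPiece.mp (hz j) i)

lemma sum_shiftedComponent_smul [Fintype κ] {a : ι → ℕ} {c : κ → ℕ}
    {z : κ → ι → MvPolynomial (Fin n) K} (hz : ∀ j, z j ∈ gradedPiece a (c j))
    (x : κ → MvPolynomial (Fin n) K) (k : ℕ) :
    ∑ j, shiftedComponent (c j) k (x j) • z j = pieceProj a k (∑ j, x j • z j) := by
  classical
  have := (isGradedMap_linearCombination hz).map_pieceProj k x
  rwa [Fintype.linearCombination_apply, Fintype.linearCombination_apply] at this

lemma eq_zero_of_forall_shiftedComponent {s : ℕ} {p : MvPolynomial (Fin n) K}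
    (h : ∀ k, shiftedComponent s k p = 0) : p = 0 := by
  rw [← sum_homogeneousComponent p]
  refine Finset.sum_eq_zero fun m _ => ?_
  have := h (s + m)
  rwa [shiftedComponent, if_pos (Nat.le_add_right _ _), Nat.add_sub_cancel_left] at this

lemma exists_sum_pieceProj_eq [Fintype ι] (a : ι → ℕ) (v : ι → MvPolynomial (Fin n) K) :
    ∃ D, ∑ k ∈ Finset.range D, pieceProj a k v = v := by
  refine ⟨∑ i, (a i + (v i).totalDegree + 1), funext fun i => ?_⟩
  rw [Finset.sum_apply]
  simp only [pieceProj_apply]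
  have hD : a i + (v i).totalDegree + 1 ≤ ∑ i, (a i + (v i).totalDegree + 1) :=
    Finset.single_le_sum (f := fun i => a i + (v i).totalDegree + 1)
      (fun _ _ => Nat.zero_le _) (Finset.mem_univ i)
  generalize ∑ i, (a i + (v i).totalDegree + 1) = D at hD
  obtain ⟨E, rfl⟩ := Nat.exists_eq_add_of_le hD
  rw [add_assoc, add_assoc, Finset.sum_range_add]
  have h1 : ∑ k ∈ Finset.range (a i), shiftedComponent (a i) k (v i) = 0 := by
    refine Finset.sum_eq_zero fun k hk => ?_
    rw [shiftedComponent, if_neg (by simpa using hk), LinearMap.zero_apply]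
  have h2 : ∀ k, shiftedComponent (a i) (a i + k) (v i) = homogeneousComponent k (v i) := by
    intro k
    rw [shiftedComponent, if_pos (Nat.le_add_right _ _), Nat.add_sub_cancel_left]
  simp only [h1, h2, zero_add]
  rw [← add_assoc, Finset.sum_range_add, sum_homogeneousComponent]
  have h3 : ∀ k, homogeneousComponent ((v i).totalDegree + 1 + k) (v i) = 0 := fun k =>
    homogeneousComponent_eq_zero _ _ (by omega)
  simp [h3]

/-- A graded submodule of a graded free module has a finite family of homogeneous generators. -/
lemma exists_homogeneous_generators [Fintype ι] (a : ι → ℕ)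
    (Z : Submodule (MvPolynomial (Fin n) K) (ι → MvPolynomial (Fin n) K))
    (hZ : ∀ v ∈ Z, ∀ k, pieceProj a k v ∈ Z) :
    ∃ (r : ℕ) (z : Fin r → ι → MvPolynomial (Fin n) K) (c : Fin r → ℕ),
      (∀ j, z j ∈ gradedPiece a (c j)) ∧
        Submodule.span (MvPolynomial (Fin n) K) (Set.range z) = Z := by
  classical
  obtain ⟨T, hT⟩ := IsNoetherian.noetherian Z
  choose D hD using exists_sum_pieceProj_eq (K := K) (n := n) a
  let β := (t : T) × Fin (D t.1)
  let e := Fintype.equivFin β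
  let w : β → ι → MvPolynomial (Fin n) K := fun b => pieceProj a b.2 b.1.1
  refine ⟨Fintype.card β, w ∘ e.symm, fun j => (e.symm j).2, fun j => pieceProj_mem _ _ _, ?_⟩
  rw [e.symm.surjective.range_comp]
  apply le_antisymm
  · rw [Submodule.span_le]
    rintro _ ⟨b, rfl⟩
    exact hZ _ (hT ▸ Submodule.subset_span b.1.2) _
  · rw [← hT, Submodule.span_le]
    intro t ht
    rw [SetLike.mem_coe, ← hD t]
    exact sum_mem fun k hk => Submodule.subset_span
      ⟨⟨⟨t, ht⟩, ⟨k, Finset.mem_range.mp hk⟩⟩, rfl⟩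

lemma shiftedComponent_mul_X (s k : ℕ) (p : MvPolynomial (Fin n) K) (i : Fin n) :
    shiftedComponent s (k + 1) (p * X i) = shiftedComponent s k p * X i := by
  rw [shiftedComponent_mul (s' := s + 1) (Or.inr ⟨1, rfl, isHomogeneous_X K i⟩)]
  congr 1
  simp only [shiftedComponent, Nat.add_le_add_iff_right, Nat.add_sub_add_right]

/-- Minimal homogeneous generators have no relations with unit coefficients. -/
lemma mem_maxIdeal_of_minimal {a : ι → ℕ} {r : ℕ} {z : Fin r → ι → MvPolynomial (Fin n) K}
    {c : Fin r → ℕ} (hz : ∀ j, z j ∈ gradedPiece a (c j))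
    (hmin : ∀ r' (z' : Fin r' → ι → MvPolynomial (Fin n) K) (c' : Fin r' → ℕ),
      (∀ j, z' j ∈ gradedPiece a (c' j)) →
      Submodule.span (MvPolynomial (Fin n) K) (Set.range z') =
        Submodule.span (MvPolynomial (Fin n) K) (Set.range z) → r ≤ r')
    {x : Fin r → MvPolynomial (Fin n) K} {k : ℕ} (hx : ∀ j, x j ∈ shiftedDegree (c j) k)
    (hrel : ∑ j, x j • z j = 0) (j : Fin r) : x j ∈ maxIdeal K n := by
  rcases r with _ | r
  · exact j.elim0
  rcases mem_shiftedDegree.mp (hx j) with h0 | ⟨t, ht, hxt⟩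
  · rw [h0]; exact zero_mem _
  by_contra hj
  have ht0 : t = 0 := by
    by_contra h
    exact hj (hxt.mem_maxIdeal h)
  rw [ht0] at hxt
  have hxC : x j = C (coeff 0 (x j)) := by
    rw [← homogeneousComponent_zero, homogeneousComponent_eq_self hxt]
  have hne : coeff 0 (x j) ≠ 0 := fun h => hj (by rw [hxC, h, map_zero]; exact zero_mem _)
  -- A nonzero constant coefficient makes the `j`-th generator redundant.
  have hle := hmin r (z ∘ j.succAbove) (c ∘ j.succAbove) (fun i => hz _) ?_
  · omega
  apply le_antisymm
  · exact Submodule.span_mono (Set.range_comp_subset_range _ _)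
  · rw [Submodule.span_le]
    rintro _ ⟨i, rfl⟩
    rcases Fin.eq_self_or_eq_succAbove j i with rfl | ⟨i, rfl⟩
    · rw [Fin.sum_univ_succAbove _ i, hxC] at hrel
      have : z i = -(C (coeff 0 (x i))⁻¹ : MvPolynomial (Fin n) K) •
          ∑ l, x (i.succAbove l) • z (i.succAbove l) := by
        rw [neg_smul, ← smul_neg, ← eq_neg_of_add_eq_zero_left hrel, smul_smul, ← map_mul,
          inv_mul_cancel₀ hne, map_one, one_smul]
      rw [this]
      exact Submodule.smul_mem _ _ (sum_mem fun l _ => Submodule.smul_mem _ _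
        (Submodule.subset_span ⟨l, rfl⟩))
    · exact Submodule.subset_span ⟨i, rfl⟩

lemma exists_eq_X_mul_add_X_mul {s k : ℕ} {p : MvPolynomial (Fin 2) K}
    (hp : p ∈ shiftedDegree s (k + 1)) (hm : p ∈ maxIdeal K 2) :
    ∃ q ∈ shiftedDegree s k, ∃ q' ∈ shiftedDegree s k, p = q * X 0 + q' * X 1 := by
  rw [maxIdeal, Ideal.mem_span_range_iff_exists_fun] at hm
  obtain ⟨f, hf⟩ := hm
  refine ⟨_, shiftedComponent_mem s k (f 0), _, shiftedComponent_mem s k (f 1), ?_⟩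
  rw [← shiftedComponent_mul_X, ← shiftedComponent_mul_X, ← map_add,
    ← Fin.sum_univ_two (f := fun i => f i * X i), hf, shiftedComponent_of_mem hp]

/-- In two variables, minimal homogeneous generators of a graded saturated submodule of a graded
free module are linearly independent in each degree. -/
lemma eq_zero_of_relation {a : ι → ℕ} {r : ℕ} {z : Fin r → ι → MvPolynomial (Fin 2) K}
    {c : Fin r → ℕ} (hz : ∀ j, z j ∈ gradedPiece a (c j))
    (hmin : ∀ r' (z' : Fin r' → ι → MvPolynomial (Fin 2) K) (c' : Fin r' → ℕ),
      (∀ j, z' j ∈ gradedPiece a (c' j)) →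
      Submodule.span (MvPolynomial (Fin 2) K) (Set.range z') =
        Submodule.span (MvPolynomial (Fin 2) K) (Set.range z) → r ≤ r')
    (hsat : ∀ w : ι → MvPolynomial (Fin 2) K,
      (X 1 : MvPolynomial (Fin 2) K) • w ∈ Submodule.span (MvPolynomial (Fin 2) K) (Set.range z) →
        w ∈ Submodule.span (MvPolynomial (Fin 2) K) (Set.range z)) (k : ℕ) :
    ∀ x : Fin r → MvPolynomial (Fin 2) K, (∀ j, x j ∈ shiftedDegree (c j) k) →
      ∑ j, x j • z j = 0 → x = 0 := by
  induction k with
  | zero =>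
    intro x hx hrel
    funext j
    have hm := mem_maxIdeal_of_minimal hz hmin hx hrel j
    rcases mem_shiftedDegree.mp (hx j) with h0 | ⟨t, ht, hxt⟩
    · exact h0
    · obtain rfl : t = 0 := by omega
      rw [mem_maxIdeal_iff] at hm
      rw [← homogeneousComponent_eq_self hxt, homogeneousComponent_zero]
      change C (constantCoeff (x j)) = 0
      rw [hm, map_zero]
  | succ k ih =>
    intro x hx hrel
    have hm := mem_maxIdeal_of_minimal hz hmin hx hrel
    -- With $A=\sum q_jz_j$ and $B=\sum q'_jz_j$ the relation reads $X_0A+X_1B=0$. As $X_0,X_1$ are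
    -- coprime, $A=X_1w$ and $B=-X_0w$, and saturation places $w$ in the span.
    choose q hq q' hq' hxq using fun j => exists_eq_X_mul_add_X_mul (hx j) (hm j)
    have hrel' : (X 0 : MvPolynomial (Fin 2) K) • ∑ j, q j • z j +
        (X 1 : MvPolynomial (Fin 2) K) • ∑ j, q' j • z j = 0 := by
      rw [← hrel, Finset.smul_sum, Finset.smul_sum, ← Finset.sum_add_distrib]
      refine Finset.sum_congr rfl fun j _ => ?_
      rw [hxq, add_smul, mul_comm (q j), mul_comm (q' j), mul_smul, mul_smul]
    have hdvd : ∀ i, X 1 ∣ (∑ j, q j • z j) i := by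
      intro i
      have h := congrFun hrel' i
      rw [Pi.add_apply, Pi.smul_apply, Pi.smul_apply, smul_eq_mul, smul_eq_mul, Pi.zero_apply] at h
      have h2 : X 1 ∣ (X 0 : MvPolynomial (Fin 2) K) * (∑ j, q j • z j) i :=
        ⟨-(∑ j, q' j • z j) i, by linear_combination h⟩
      rcases X_dvd_mul_iff.mp h2 with h3 | h3
      · rw [X_dvd_X] at h3
        exact absurd h3 (by decide)
      · exact h3
    choose w hw using hdvd
    have hw1 : ∑ j, q j • z j = (X 1 : MvPolynomial (Fin 2) K) • w := funext hw
    have hw2 : ∑ j, q' j • z j = -((X 0 : MvPolynomial (Fin 2) K) • w) := by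
      rw [hw1] at hrel'
      refine smul_right_injective _ (X_ne_zero (R := K) (1 : Fin 2)) ?_
      change (X 1 : MvPolynomial (Fin 2) K) • _ = (X 1 : MvPolynomial (Fin 2) K) • _
      rw [smul_neg, smul_comm, ← eq_neg_of_add_eq_zero_right hrel']
    have hwZ : w ∈ Submodule.span (MvPolynomial (Fin 2) K) (Set.range z) := by
      refine hsat w ?_
      rw [← hw1]
      exact sum_mem fun j _ => Submodule.smul_mem _ _ (Submodule.subset_span ⟨j, rfl⟩)
    obtain ⟨e, he⟩ := (Submodule.mem_span_range_iff_exists_fun _).mp hwZ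
    -- By induction, coefficients in degree `k` are unique. So `q` and `q'` are components of `X 1 *
    -- e` and `-(X 0 * e)`, and $qX_0+q'X_1$ cancels.
    have key : ∀ (y g : Fin r → MvPolynomial (Fin 2) K), (∀ j, y j ∈ shiftedDegree (c j) k) →
        ∑ j, y j • z j = ∑ j, g j • z j → ∀ j, y j = shiftedComponent (c j) k (g j) := by
      intro y g hy h j
      have h1 := ih (fun j => y j - shiftedComponent (c j) k (g j))
        (fun j => sub_mem (hy j) (shiftedComponent_mem _ _ _)) (by
          simp only [sub_smul, Finset.sum_sub_distrib]
          rw [sum_shiftedComponent_smul hz, ← h, ← sum_shiftedComponent_smul hz]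
          rw [sub_eq_zero]
          exact Finset.sum_congr rfl fun j _ => by rw [shiftedComponent_of_mem (hy j)])
      exact sub_eq_zero.mp (congrFun h1 j)
    have h1 := key q (fun j => X 1 * e j) hq (by
      simp only [mul_smul]
      rw [hw1, ← he, Finset.smul_sum])
    have h2 := key q' (fun j => -(X 0 * e j)) hq' (by
      simp only [neg_smul, mul_smul]
      rw [hw2, ← he, Finset.smul_sum, Finset.sum_neg_distrib])
    funext j
    rw [hxq, h1, h2, ← shiftedComponent_mul_X, ← shiftedComponent_mul_X, ← map_add]
    rw [show X 1 * e j * X 0 + -(X 0 * e j) * X 1 = 0 by ring, map_zero]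
    rfl

/-- In two variables, a graded saturated submodule of a graded free module is free with a
homogeneous basis. -/
lemma exists_homogeneous_basis [Fintype ι] (a : ι → ℕ)
    (Z : Submodule (MvPolynomial (Fin 2) K) (ι → MvPolynomial (Fin 2) K))
    (hZ : ∀ v ∈ Z, ∀ k, pieceProj a k v ∈ Z)
    (hsat : ∀ w : ι → MvPolynomial (Fin 2) K, (X 1 : MvPolynomial (Fin 2) K) • w ∈ Z → w ∈ Z) :
    ∃ (r : ℕ) (z : Fin r → ι → MvPolynomial (Fin 2) K) (c : Fin r → ℕ),
      (∀ j, z j ∈ gradedPiece a (c j)) ∧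
        Submodule.span (MvPolynomial (Fin 2) K) (Set.range z) = Z ∧
        LinearIndependent (MvPolynomial (Fin 2) K) z := by
  classical
  have hex := exists_homogeneous_generators a Z hZ
  obtain ⟨z, c, hz, hspan⟩ := Nat.find_spec hex
  refine ⟨_, z, c, hz, hspan, ?_⟩
  rw [Fintype.linearIndependent_iff]
  intro x hx j
  refine eq_zero_of_forall_shiftedComponent (s := c j) fun k => ?_
  refine congrFun (eq_zero_of_relation hz (fun r' z' c' hz' hs' => ?_) (by rw [hspan]; exact hsat) k
    (fun j => shiftedComponent (c j) k (x j)) (fun j => shiftedComponent_mem _ _ _) ?_) j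
  · exact Nat.find_min' hex ⟨z', c', hz', hs'.trans hspan⟩
  · rw [sum_shiftedComponent_smul hz, hx, map_zero]

end HomogeneousGenerators

/-! ### The estimate for ideals in two variables -/

section TwoVariables

/-- The left side vanishes to order two at $1$, with second derivative $2Q(1)$ there. The three
conclusions are the value and the first two derivatives of the right side. -/
lemma moments_of_eq_mul_one_sub_sq {ι κ : Type*} [Fintype ι] [Fintype κ] {a : ι → ℕ} {c : κ → ℕ}
    {Q : Polynomial ℚ} (h : Q * (1 - Polynomial.X) ^ 2 =
      1 - ∑ i, Polynomial.X ^ a i + ∑ j, Polynomial.X ^ c j) :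
    Fintype.card ι = Fintype.card κ + 1 ∧ ∑ j, (c j : ℚ) = ∑ i, (a i : ℚ) ∧
      2 * Q.eval 1 = ∑ j, (c j : ℚ) ^ 2 - ∑ i, (a i : ℚ) ^ 2 := by
  have h0 := congrArg (Polynomial.eval 1) h
  have h1 := congrArg (fun p => Polynomial.eval 1 (Polynomial.derivative p)) h
  have h2 := congrArg (fun p => Polynomial.eval 1
    (Polynomial.derivative (Polynomial.derivative p))) h
  -- The truncated subtraction from differentiating twice is harmless: for `k = 0` the first factor
  -- vanishes.
  have hk : ∀ k : ℕ, (k : ℚ) * ((k - 1 : ℕ) : ℚ) = (k : ℚ) ^ 2 - k := by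
    intro k
    rcases k with _ | k
    · simp
    · push_cast [Nat.add_sub_cancel]; ring
  have e0 : (Fintype.card ι : ℚ) = Fintype.card κ + 1 := by
    simp [Polynomial.eval_finsetSum] at h0
    linarith
  have e1 : ∑ j, (c j : ℚ) = ∑ i, (a i : ℚ) := by
    simp [Polynomial.eval_finsetSum, Polynomial.derivative_pow] at h1
    linarith
  refine ⟨by exact_mod_cast e0, e1, ?_⟩
  simp [Polynomial.eval_finsetSum, Polynomial.derivative_pow] at h2
  simp only [hk, Finset.sum_sub_distrib] at h2
  linarith

lemma card_le_of_linearIndependent_of_mem_span {R M α β : Type*} [CommRing R] [Nontrivial R]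
    [AddCommGroup M] [Module R M] [Fintype α] [Fintype β] {v : α → M} {w : β → M}
    (hv : LinearIndependent R v) (h : ∀ i, v i ∈ Submodule.span R (Set.range w)) :
    Fintype.card α ≤ Fintype.card β := by
  classical
  let _ : Fintype (Set.range w) := Set.fintypeRange w
  have h1 := linearIndependent_le_span' v hv (Set.range w) (by rintro _ ⟨i, rfl⟩; exact h i)
  rw [Cardinal.mk_fintype, Nat.cast_le] at h1
  exact h1.trans (Fintype.card_range_le w)

variable {K : Type*} [Field K] {ι β : Type*} [Fintype ι] [DecidableEq ι]

/-- Coordinate `i` sees only the `i`-th of these relations, with coefficient `f i₀`. They show that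
the Koszul relations have the full rank of the syzygy module. -/
lemma linearIndependent_koszul {R : Type*} [CommRing R] [IsDomain R] {f : ι → R} {i₀ : ι}
    (h0 : f i₀ ≠ 0) : LinearIndependent R fun i : {i // i ≠ i₀} =>
      f i₀ • (Pi.single i.1 1 : ι → R) - f i.1 • (Pi.single i₀ 1 : ι → R) := by
  rw [Fintype.linearIndependent_iff]
  intro g hg i
  have h := congrFun hg i.1
  rw [Finset.sum_apply, Finset.sum_eq_single i] at h
  · simpa [Pi.single_apply, i.2, h0] using h
  · intro j _ hj
    have : i.1 ≠ j.1 := fun h => hj (Subtype.ext h.symm)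
    simp [i.2, this]
  · simp

/-- The syzygies of homogeneous polynomials in two variables, and the resulting formula for the
Hilbert series. -/
lemma exists_syzygy_basis {f : ι → MvPolynomial (Fin 2) K} {a : ι → ℕ}
    (hf : ∀ i, (f i).IsHomogeneous (a i)) :
    ∃ (r : ℕ) (z : Fin r → ι → MvPolynomial (Fin 2) K) (c : Fin r → ℕ),
      (∀ j, z j ∈ gradedPiece a (c j)) ∧ (∀ j, ∑ i, z j i * f i = 0) ∧
      (∀ v : ι → MvPolynomial (Fin 2) K, ∑ i, v i * f i = 0 →
        v ∈ Submodule.span (MvPolynomial (Fin 2) K) (Set.range z)) ∧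
      LinearIndependent (MvPolynomial (Fin 2) K) z ∧
      hilbertSeries (Ideal.span (Set.range f)) * (1 - PowerSeries.X) ^ 2 =
        1 - ∑ i, PowerSeries.X ^ a i + ∑ j, PowerSeries.X ^ c j := by
  let d : (ι → MvPolynomial (Fin 2) K) →ₗ[MvPolynomial (Fin 2) K]
    (Unit → MvPolynomial (Fin 2) K) :=
    LinearMap.pi fun _ => Fintype.linearCombination (MvPolynomial (Fin 2) K) f
  have hd_apply : ∀ v u, d v u = ∑ i, v i * f i := fun v u => by
    simp [d, Fintype.linearCombination_apply]
  have hd : IsGradedMap d a (fun _ => 0) := by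
    intro j k
    rw [hd_apply]
    refine Or.inr ⟨a j, zero_add _, ?_⟩
    simpa [Pi.single_apply] using hf j
  have hker : ∀ v, v ∈ LinearMap.ker d ↔ ∑ i, v i * f i = 0 := by
    intro v
    rw [LinearMap.mem_ker]
    exact ⟨fun h => by rw [← hd_apply v (), h]; rfl, fun h => funext fun u => by
      rw [hd_apply, h]; rfl⟩
  obtain ⟨r, z, c, hz, hspan, hli⟩ := exists_homogeneous_basis a (LinearMap.ker d)
    (fun v hv k => by
      rw [LinearMap.mem_ker] at hv ⊢
      rw [hd.map_pieceProj, hv, map_zero])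
    (fun w hw => by
      rw [LinearMap.mem_ker, map_smul] at hw
      rw [LinearMap.mem_ker]
      -- Syzygies are a kernel into a torsion-free module, hence saturated.
      exact (smul_eq_zero.mp hw).resolve_left (X_ne_zero _))
  refine ⟨r, z, c, hz, fun j => ?_, fun v hv => ?_, hli, ?_⟩
  · rw [← hker, ← hspan]
    exact Submodule.subset_span ⟨j, rfl⟩
  · rw [hspan, hker]
    exact hv
  have hH := fun k => hilbertFunction_add_of_gradedMap (I := Ideal.span (Set.range f))
    (fun _ => rfl) hd (fun v => by
      constructor
      · rintro ⟨w, rfl⟩ u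
        rw [hd_apply, Ideal.mem_span_range_iff_exists_fun]
        exact ⟨w, rfl⟩
      · intro h
        obtain ⟨w, hw⟩ := Ideal.mem_span_range_iff_exists_fun.mp (h ())
        exact ⟨w, funext fun u => by rw [hd_apply, hw]⟩) k
  have hz' : ∀ k, Module.finrank K ((LinearMap.ker d).restrictScalars K ⊓ gradedPiece a k :
      Submodule K _) = Module.finrank K (gradedPiece (K := K) (n := 2) c k) := by
    intro k
    have h := (isGradedMap_linearCombination hz).finrank_range_add_finrank_ker k
    rw [Fintype.range_linearCombination, hspan, LinearMap.ker_eq_bot'.mpr fun x hx =>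
      funext (Fintype.linearIndependent_iff.mp hli x (by
        rwa [Fintype.linearCombination_apply] at hx))] at h
    rw [← h, Submodule.restrictScalars_bot, bot_inf_eq, finrank_bot, add_zero]
  have hser : hilbertSeries (Ideal.span (Set.range f)) + PowerSeries.mk
      (fun k => (Module.finrank K (gradedPiece (K := K) (n := 2) a k) : ℚ)) =
      PowerSeries.mk (fun k => ((Nat.multichoose 2 k : ℕ) : ℚ)) + PowerSeries.mk
      (fun k => (Module.finrank K (gradedPiece (K := K) (n := 2) c k) : ℚ)) := by
    ext k
    rw [map_add, map_add, coeff_hilbertSeries, PowerSeries.coeff_mk, PowerSeries.coeff_mk,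
      PowerSeries.coeff_mk, ← hz']
    exact_mod_cast hH k
  have := congrArg (· * (1 - PowerSeries.X) ^ 2) hser
  simp only [add_mul, mk_finrank_gradedPiece_mul, mk_multichoose_mul_one_sub_pow] at this
  rw [← eq_sub_iff_add_eq] at this
  rw [this]
  ring

/-- The length of a quotient of a polynomial ring in two variables by homogeneous polynomials of
degrees at most `M₁` is at most `M₁ M₂ / 2`, if the relations of degrees at most `M₂` generate a
module containing the Koszul relations. -/
lemma two_mul_eval_one_le {f : ι → MvPolynomial (Fin 2) K} {a : ι → ℕ}
    (hf : ∀ i, (f i).IsHomogeneous (a i)) (hf0 : ∀ i, f i ≠ 0) {Q : Polynomial ℚ}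
    (hQ : hilbertSeries (Ideal.span (Set.range f)) = (Q : PowerSeries ℚ))
    {B : β → ι → MvPolynomial (Fin 2) K} {D : β → ℕ} (hB : ∀ b, B b ∈ gradedPiece a (D b))
    (hBf : ∀ b, ∑ i, B b i * f i = 0)
    (hkos : ∀ i i₀, f i₀ • (Pi.single i 1 : ι → MvPolynomial (Fin 2) K) -
      f i • (Pi.single i₀ 1 : ι → MvPolynomial (Fin 2) K) ∈
        Submodule.span (MvPolynomial (Fin 2) K) (Set.range B))
    {M₁ M₂ : ℕ} (hM₁ : ∀ i, a i ≤ M₁) (hM₂ : ∀ b, D b ≤ M₂) :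
    2 * Q.eval 1 ≤ (M₁ : ℚ) * M₂ := by
  obtain ⟨r, z, c, hz, hzf, hspan, hli, hser⟩ := exists_syzygy_basis hf
  have hpoly : Q * (1 - Polynomial.X) ^ 2 =
      1 - ∑ i, Polynomial.X ^ a i + ∑ j, Polynomial.X ^ c j := by
    rw [hQ] at hser
    apply Polynomial.coe_injective ℚ
    rw [← Polynomial.coeToPowerSeries.ringHom_apply, ← Polynomial.coeToPowerSeries.ringHom_apply]
    simp only [map_mul, map_pow, map_sub, map_add, map_sum, map_one]
    simpa [Polynomial.coeToPowerSeries.ringHom_apply] using hser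
  obtain ⟨hcard, hsum, hQ1⟩ := moments_of_eq_mul_one_sub_sq hpoly
  rw [Fintype.card_fin] at hcard
  -- A basis element of degree above `M₂` cannot occur in any `B b`, for degree reasons. Then all
  -- Koszul relations would lie in the span of `r - 1` elements, although `r` of them are
  -- independent.
  have hcM : ∀ j, c j ≤ M₂ := by
    intro j₀
    by_contra! hlt
    have hBz : ∀ b, B b ∈ Submodule.span (MvPolynomial (Fin 2) K)
        (Set.range fun j : {j // j ≠ j₀} => z j.1) := by
      intro b
      obtain ⟨e, he⟩ := (Submodule.mem_span_range_iff_exists_fun _).mp (hspan _ (hBf b))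
      have h1 : ∑ j, shiftedComponent (c j) (D b) (e j) • z j = B b := by
        rw [sum_shiftedComponent_smul hz, he, pieceProj_of_mem (hB b)]
      rw [← h1]
      refine sum_mem fun j _ => ?_
      by_cases hj : j = j₀
      · have := hM₂ b
        rw [hj, shiftedComponent, if_neg (by omega), LinearMap.zero_apply, zero_smul]
        exact zero_mem _
      · exact Submodule.smul_mem _ _ (Submodule.subset_span ⟨⟨j, hj⟩, rfl⟩)
    obtain ⟨i₀⟩ : Nonempty ι := Fintype.card_pos_iff.mp (by omega)
    have h2 := card_le_of_linearIndependent_of_mem_span (linearIndependent_koszul (hf0 i₀))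
      (w := fun j : {j // j ≠ j₀} => z j.1) fun i =>
        (Submodule.span_le.mpr (by rintro _ ⟨b, rfl⟩; exact hBz b)) (hkos i.1 i₀)
    rw [Fintype.card_subtype_compl, Fintype.card_subtype_compl, Fintype.card_subtype_eq,
      Fintype.card_subtype_eq, Fintype.card_fin] at h2
    have := j₀.2
    omega
  let g : Fin (r + 1) ≃ ι := (Fintype.equivFinOfCardEq hcard).symm
  let σ := Tuple.sort (a ∘ g)
  let τ := Tuple.sort c
  have hσ : Monotone ((a ∘ g) ∘ σ) := Tuple.monotone_sort _
  have hτ : Monotone (c ∘ τ) := Tuple.monotone_sort _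
  have hle := fun j => shift_succ_le_of_relations
    (z := fun j i => z j (g i)) (f := f ∘ g) (a := a ∘ g) (c := c)
    (hli.map' (LinearEquiv.funCongrLeft (MvPolynomial (Fin 2) K) (MvPolynomial (Fin 2) K)
      g).toLinearMap (LinearEquiv.ker _)) (fun i => hf0 _)
    (fun j => by
      rw [← hzf j]
      exact Equiv.sum_comp g (fun i => z j i * f i))
    (fun j i h => by
      rcases mem_shiftedDegree.mp (mem_gradedPiece.mp (hz j) (g i)) with h0 | ⟨t, ht, -⟩
      · exact absurd h0 h
      · simp only [Function.comp_apply]; omega) hσ hτ j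
  rw [hQ1]
  have hs1 : ∑ j, (c j : ℚ) ^ 2 = ∑ j, (c (τ j) : ℚ) ^ 2 :=
    (Equiv.sum_comp τ fun j => (c j : ℚ) ^ 2).symm
  have hs2 : ∑ j, (c j : ℚ) = ∑ j, (c (τ j) : ℚ) := (Equiv.sum_comp τ fun j => (c j : ℚ)).symm
  have hs3 : ∑ i, (a i : ℚ) ^ 2 = ∑ i, (a (g (σ i)) : ℚ) ^ 2 :=
    (Equiv.sum_comp (σ.trans g) fun i => (a i : ℚ) ^ 2).symm
  have hs4 : ∑ i, (a i : ℚ) = ∑ i, (a (g (σ i)) : ℚ) :=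
    (Equiv.sum_comp (σ.trans g) fun i => (a i : ℚ)).symm
  rw [hs1, hs3]
  rw [hs2, hs4] at hsum
  refine sum_sq_sub_sum_sq_le (fun i j hij => ?_) (fun j => ?_) hsum (fun i => ?_) (fun j => ?_)
    (Nat.cast_nonneg _) (Nat.cast_nonneg _)
  · exact_mod_cast hσ hij
  · exact_mod_cast hle j
  · exact_mod_cast hM₁ _
  · exact_mod_cast hcM _

end TwoVariables

/-! ### The upper bound over an infinite field -/

section UpperBound

namespace MinimalGradedFreeResolution

variable {K : Type*} [Field K] {n : ℕ} {I : Ideal (MvPolynomial (Fin n) K)}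
  (F : MinimalGradedFreeResolution I)

/-- The index of the generator of the free module in homological degree zero. -/
def zeroIndex : Fin (F.rank 0) := ⟨0, by rw [F.rank_zero]; exact one_pos⟩

lemma eq_zeroIndex (j : Fin (F.rank 0)) : j = F.zeroIndex := by
  have h1 := j.2
  have h2 := F.rank_zero
  ext
  change j.1 = 0
  omega

/-- The generators of `I` given by the resolution. -/
def gen (i : Fin (F.rank 1)) : MvPolynomial (Fin n) K := F.diff 0 (Pi.single i 1) F.zeroIndex

lemma gen_isHomogeneous (i : Fin (F.rank 1)) : (F.gen i).IsHomogeneous (F.shift 1 i) := by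
  rcases F.homogeneous 0 i F.zeroIndex with h | ⟨t, ht, h⟩
  · rw [gen, h]; exact isHomogeneous_zero _ _ _
  · rw [F.shift_zero, zero_add] at ht
    rw [← ht]
    exact h

lemma diff_zero_apply (v : Fin (F.rank 1) → MvPolynomial (Fin n) K) :
    F.diff 0 v F.zeroIndex = ∑ i, v i * F.gen i := apply_eq_sum_mul_single _ _ _

lemma diff_zero_eq_zero_iff (v : Fin (F.rank 1) → MvPolynomial (Fin n) K) :
    F.diff 0 v = 0 ↔ ∑ i, v i * F.gen i = 0 := by
  rw [← F.diff_zero_apply]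
  exact ⟨fun h => by rw [h]; rfl, fun h => funext fun j => by rw [F.eq_zeroIndex j, h]; rfl⟩

lemma span_range_gen : Ideal.span (Set.range F.gen) = I := by
  ext p
  rw [Ideal.mem_span_range_iff_exists_fun]
  constructor
  · rintro ⟨v, rfl⟩
    rw [← F.diff_zero_apply]
    exact (F.range_diff_zero _).mp ⟨v, rfl⟩ _
  · intro hp
    obtain ⟨v, hv⟩ := (F.range_diff_zero fun _ => p).mpr fun _ => hp
    exact ⟨v, by rw [← F.diff_zero_apply, hv]⟩

lemma gen_mem_maxIdeal (i : Fin (F.rank 1)) : F.gen i ∈ maxIdeal K n := F.minimal 0 i _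

lemma le_maxIdeal (F : MinimalGradedFreeResolution I) : I ≤ maxIdeal K n := by
  conv_lhs => rw [← F.span_range_gen]
  rw [Ideal.span_le]
  rintro _ ⟨i, rfl⟩
  exact F.gen_mem_maxIdeal i

lemma isGradedIdeal (F : MinimalGradedFreeResolution I) : IsGradedIdeal I := by
  intro p hp k
  replace hp := F.span_range_gen.ge hp
  rw [Ideal.mem_span_range_iff_exists_fun] at hp
  obtain ⟨v, rfl⟩ := hp
  rw [map_sum]
  refine sum_mem fun i _ => ?_
  rw [homogeneousComponent_mul_of_isHomogeneous (F.gen_isHomogeneous i)]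
  split_ifs
  · refine Ideal.mul_mem_left _ _ ?_
    exact F.span_range_gen.le (Ideal.subset_span ⟨i, rfl⟩)
  · exact zero_mem _

lemma shift_le_maxShift (i : ℕ) (j : Fin (F.rank i)) : F.shift i j ≤ F.maxShift i :=
  Finset.le_sup (f := F.shift i) (Finset.mem_univ j)

end MinimalGradedFreeResolution

variable {K : Type*} [Field K]

lemma one_sub_X_ne_zero : (1 - PowerSeries.X : PowerSeries ℚ) ≠ 0 := by
  intro h
  have := congrArg (PowerSeries.coeff 0) h
  simp at this

/-- The upper bound for the multiplicity in codimension two over an infinite field. -/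
theorem two_mul_eval_one_le_maxShift [Infinite K] {d : ℕ}
    {I : Ideal (MvPolynomial (Fin (d + 2)) K)} (F : MinimalGradedFreeResolution I)
    {Q : Polynomial ℚ} (hQ : F.numerator = Q * (1 - Polynomial.X) ^ 2) :
    2 * Q.eval 1 ≤ (F.maxShift 1 : ℚ) * F.maxShift 2 ∧
      (2 * Q.eval 1 = (F.maxShift 1 : ℚ) * F.maxShift 2 → HasRegularSequence I d) := by
  classical
  have hser : hilbertSeries I * (1 - PowerSeries.X) ^ d = (Q : PowerSeries ℚ) := by
    have h := F.hilbertSeries_mul_one_sub_pow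
    rw [hQ, pow_add, ← mul_assoc] at h
    refine mul_right_cancel₀ (pow_ne_zero 2 one_sub_X_ne_zero) (h.trans ?_)
    push_cast
    rfl
  obtain ⟨ψ, hψ, hs, Q', hQ', hle, heq⟩ :=
    exists_linear_section d I Q F.isGradedIdeal F.le_maxIdeal hser
  -- Generators killed by `ψ` are dropped, since the determinant argument needs nonzero elements;
  -- the others still generate the image of `I`.
  let ι := {i : Fin (F.rank 1) // ψ (F.gen i) ≠ 0}
  let f : ι → MvPolynomial (Fin 2) K := fun i => ψ (F.gen i.1)
  have hsum : ∀ v : Fin (F.rank 1) → MvPolynomial (Fin 2) K,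
      ∑ i : ι, v i.1 * f i = ∑ i, v i * ψ (F.gen i) := by
    intro v
    refine (Finset.sum_subtype (Finset.univ.filter fun i => ψ (F.gen i) ≠ 0) (by simp)
      fun i => v i * ψ (F.gen i)).symm.trans ?_
    rw [Finset.sum_filter_of_ne]
    intro i _ h h0
    exact h (by rw [h0, mul_zero])
  have hJ : I.map ψ = Ideal.span (Set.range f) := by
    conv_lhs => rw [← F.span_range_gen, Ideal.map_span]
    apply le_antisymm
    · rw [Ideal.span_le]
      rintro _ ⟨_, ⟨i, rfl⟩, rfl⟩
      by_cases h : ψ (F.gen i) = 0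
      · rw [h]; exact zero_mem _
      · exact Ideal.subset_span ⟨⟨i, h⟩, rfl⟩
    · refine Ideal.span_mono ?_
      rintro _ ⟨i, rfl⟩
      exact ⟨_, ⟨i.1, rfl⟩, rfl⟩
  rw [hJ] at hQ'
  have hexp : ∀ w i, F.diff 1 w i = ∑ k, w k * F.diff 1 (Pi.single k 1) i :=
    fun w i => apply_eq_sum_mul_single _ _ _
  have hdd : ∀ w, ∑ i, F.diff 1 w i * F.gen i = 0 := fun w => by
    rw [← F.diff_zero_eq_zero_iff]
    exact (F.exact 0).apply_apply_eq_zero w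
  have hbound : 2 * Q'.eval 1 ≤ (F.maxShift 1 : ℚ) * F.maxShift 2 := by
    refine two_mul_eval_one_le (f := f) (a := fun i => F.shift 1 i.1)
      (fun i => hψ.isHomogeneous (F.gen_isHomogeneous _)) (fun i => i.2) hQ'
      (B := fun k i => ψ (F.diff 1 (Pi.single k 1) i.1)) (D := F.shift 2) (fun k => ?_)
      (fun k => ?_) (fun i i₀ => ?_) (fun i => F.shift_le_maxShift 1 _)
      (fun k => F.shift_le_maxShift 2 k)
    · rw [mem_gradedPiece]
      intro i
      rw [mem_shiftedDegree]
      rcases F.homogeneous 1 k i.1 with h | ⟨t, ht, h⟩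
      · exact Or.inl (by rw [h, map_zero])
      · exact Or.inr ⟨t, ht, hψ.isHomogeneous h⟩
    · rw [hsum fun i => ψ (F.diff 1 (Pi.single k 1) i)]
      simp only [← map_mul, ← map_sum]
      rw [hdd, map_zero]
    · let v : Fin (F.rank 1) → MvPolynomial (Fin (d + 2)) K :=
        F.gen i₀.1 • Pi.single i.1 1 - F.gen i.1 • Pi.single i₀.1 1
      have hv : F.diff 0 v = 0 := by
        rw [F.diff_zero_eq_zero_iff]
        simp [v, sub_mul, Pi.single_apply, mul_comm (F.gen i.1)]
      obtain ⟨w, hw⟩ := ((F.exact 0) v).mp hv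
      rw [Submodule.mem_span_range_iff_exists_fun]
      refine ⟨fun k => ψ (w k), funext fun l => ?_⟩
      have h := congrArg ψ (congrFun hw l.1)
      rw [hexp, map_sum] at h
      rw [Finset.sum_apply]
      simp only [Pi.smul_apply, smul_eq_mul, ← map_mul]
      rw [h]
      simp only [v, f, Pi.sub_apply, Pi.smul_apply, smul_eq_mul, Pi.single_apply, map_sub, map_mul]
      simp only [apply_ite ψ, map_one, map_zero, Subtype.coe_inj]
  refine ⟨by linarith, fun h => heq (by linarith)⟩

end UpperBound

/-! ### Resolutions of length two -/

section LengthTwo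

variable {K : Type*} [Field K] {n : ℕ}

lemma eq_zero_of_isHomogeneous_zero {p : MvPolynomial (Fin n) K} (h : p.IsHomogeneous 0)
    (hp : p ∈ maxIdeal K n) : p = 0 := by
  have h1 := totalDegree_eq_zero_iff_eq_C.mp (Nat.le_zero.mp h.totalDegree_le)
  rw [mem_maxIdeal_iff] at hp
  rw [h1, ← constantCoeff_eq, hp, map_zero]

namespace MinimalGradedFreeResolution

variable {I : Ideal (MvPolynomial (Fin n) K)} (F : MinimalGradedFreeResolution I)

lemma diff_apply_mem_maxIdeal (i : ℕ) (w : Fin (F.rank (i + 1)) → MvPolynomial (Fin n) K)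
    (k : Fin (F.rank i)) : F.diff i w k ∈ maxIdeal K n := by
  rw [apply_eq_sum_mul_single]
  exact sum_mem fun j _ => Ideal.mul_mem_left _ _ (F.minimal i j k)

/-- A zero generator would make a basis vector a syzygy, hence a value of `F.diff 1`. By minimality
such values have coordinates in the maximal ideal, which does not contain `1`. -/
lemma gen_ne_zero (i : Fin (F.rank 1)) : F.gen i ≠ 0 := by
  intro h
  have h1 : F.diff 0 (Pi.single i 1) = 0 := funext fun j => by rw [F.eq_zeroIndex j]; exact h
  obtain ⟨w, hw⟩ := ((F.exact 0) _).mp h1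
  have h2 := F.diff_apply_mem_maxIdeal 1 w i
  rw [hw, Pi.single_eq_same] at h2
  exact (isMaximal_maxIdeal (K := K) (n := n)).ne_top ((Ideal.eq_top_iff_one _).mpr h2)

/-- An entry of degree zero is a constant, and minimality makes it zero. This is the source of all
strict inequalities between shifts. -/
lemma shift_lt_shift_of_ne_zero {i : ℕ} {j : Fin (F.rank (i + 1))} {k : Fin (F.rank i)}
    (h : F.diff i (Pi.single j 1) k ≠ 0) : F.shift i k < F.shift (i + 1) j := by
  rcases F.homogeneous i j k with h0 | ⟨t, ht, hh⟩
  · exact absurd h0 h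
  · rcases Nat.eq_zero_or_pos t with rfl | hpos
    · exact absurd (eq_zero_of_isHomogeneous_zero hh (F.minimal i j k)) h
    · omega

lemma shift_one_pos (i : Fin (F.rank 1)) : 0 < F.shift 1 i := by
  exact (Nat.zero_le _).trans_lt (F.shift_lt_shift_of_ne_zero (F.gen_ne_zero i))

lemma isEmpty_of_length_lt {i : ℕ} (h : F.length < i) : IsEmpty (Fin (F.rank i)) := by
  rw [F.rank_eq_zero i h]
  infer_instance

lemma numerator_eq_sum_range {N : ℕ} (hN : F.length + 1 ≤ N) :
    F.numerator = ∑ i ∈ Finset.range N, (-1) ^ i * ∑ j, Polynomial.X ^ F.shift i j := by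
  refine Finset.sum_subset (Finset.range_subset_range.mpr hN) fun i _ hi => ?_
  have := F.isEmpty_of_length_lt (i := i) (by simpa using hi)
  rw [Finset.univ_eq_empty, Finset.sum_empty, mul_zero]

lemma numerator_of_length_le_two (h : F.length ≤ 2) : F.numerator =
    1 - ∑ j, Polynomial.X ^ F.shift 1 j + ∑ j, Polynomial.X ^ F.shift 2 j := by
  rw [F.numerator_eq_sum_range (N := 3) (by omega)]
  have h0 : ∑ j, (Polynomial.X : Polynomial ℚ) ^ F.shift 0 j = 1 := by
    simp [F.shift_zero, F.rank_zero]
  simp only [Finset.sum_range_succ, Finset.sum_range_zero, h0]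
  ring

lemma minShift_le (i : ℕ) (j : Fin (F.rank i)) : F.minShift i ≤ F.shift i j :=
  Nat.sInf_le ⟨j, rfl⟩

/-- The free module at index `i + 2` is zero, so exactness makes `F.diff i` injective. -/
lemma linearIndependent_diff_single {i : ℕ} (h : F.length < i + 2) :
    LinearIndependent (MvPolynomial (Fin n) K)
      fun j : Fin (F.rank (i + 1)) => F.diff i (Pi.single j 1) := by
  rw [Fintype.linearIndependent_iff]
  intro g hg
  have h1 : F.diff i g = 0 := by
    rw [← hg]
    funext k
    rw [apply_eq_sum_mul_single, Finset.sum_apply]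
    rfl
  obtain ⟨w, rfl⟩ := ((F.exact i) _).mp h1
  have := F.isEmpty_of_length_lt h
  rw [Subsingleton.elim w 0, map_zero]
  exact fun _ => rfl

/-- The bounds for the multiplicity if the resolution has length two. -/
theorem bounds_of_length_le_two (hlen : F.length ≤ 2) {Q : Polynomial ℚ}
    (hQ : F.numerator = Q * (1 - Polynomial.X) ^ 2) :
    F.length = 2 ∧ F.lowerBound 2 ≤ Q.eval 1 ∧ Q.eval 1 ≤ F.upperBound 2 ∧
      (Q.eval 1 = F.lowerBound 2 ∨ Q.eval 1 = F.upperBound 2 → F.IsPure) := by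
  rw [F.numerator_of_length_le_two hlen] at hQ
  obtain ⟨hcard, hsum, hQ1⟩ := moments_of_eq_mul_one_sub_sq hQ.symm
  rw [Fintype.card_fin, Fintype.card_fin] at hcard
  have hlow : F.lowerBound 2 = F.minShift 1 * F.minShift 2 / 2 := by
    simp [lowerBound, Finset.prod_Icc_succ_top, Nat.factorial]
  have hup : F.upperBound 2 = F.maxShift 1 * F.maxShift 2 / 2 := by
    simp [upperBound, Finset.prod_Icc_succ_top, Nat.factorial]
  let g : Fin (F.rank 2 + 1) ≃ Fin (F.rank 1) := finCongr hcard.symm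
  let σ := Tuple.sort (F.shift 1 ∘ g)
  let τ := Tuple.sort (F.shift 2)
  have hσ : Monotone ((F.shift 1 ∘ g) ∘ σ) := Tuple.monotone_sort _
  have hτ : Monotone (F.shift 2 ∘ τ) := Tuple.monotone_sort _
  -- The first shifts are raised by one before applying the weak inequality, which turns it into a
  -- strict one.
  have hlt : ∀ j, F.shift 1 (g (σ (Fin.succ j))) < F.shift 2 (τ j) := fun j =>
    shift_succ_le_of_relations
      (z := fun j i => F.diff 1 (Pi.single j 1) (g i)) (f := F.gen ∘ g)
      (a := fun i => F.shift 1 (g i) + 1) (c := F.shift 2)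
      ((F.linearIndependent_diff_single (by omega)).map'
        (LinearEquiv.funCongrLeft (MvPolynomial (Fin n) K) (MvPolynomial (Fin n) K)
          g).toLinearMap (LinearEquiv.ker _)) (fun i => F.gen_ne_zero _)
      (fun j => by
        have h := (F.diff_zero_eq_zero_iff _).mp
          ((F.exact 0).apply_apply_eq_zero (Pi.single j 1))
        rw [← h]
        exact Equiv.sum_comp g (fun i => F.diff 1 (Pi.single j 1) i * F.gen i))
      (fun j i h => F.shift_lt_shift_of_ne_zero h) (fun i j hij => Nat.succ_le_succ (hσ hij)) hτ j
  have hs1 : ∑ j, (F.shift 2 j : ℚ) ^ 2 = ∑ j, (F.shift 2 (τ j) : ℚ) ^ 2 :=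
    (Equiv.sum_comp τ fun j => (F.shift 2 j : ℚ) ^ 2).symm
  have hs2 : ∑ j, (F.shift 2 j : ℚ) = ∑ j, (F.shift 2 (τ j) : ℚ) :=
    (Equiv.sum_comp τ fun j => (F.shift 2 j : ℚ)).symm
  have hs3 : ∑ i, (F.shift 1 i : ℚ) ^ 2 = ∑ i, (F.shift 1 (g (σ i)) : ℚ) ^ 2 :=
    (Equiv.sum_comp (σ.trans g) fun i => (F.shift 1 i : ℚ) ^ 2).symm
  have hs4 : ∑ i, (F.shift 1 i : ℚ) = ∑ i, (F.shift 1 (g (σ i)) : ℚ) :=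
    (Equiv.sum_comp (σ.trans g) fun i => (F.shift 1 i : ℚ)).symm
  rw [hs1, hs3] at hQ1
  rw [hs2, hs4] at hsum
  have hα : Monotone fun i => (F.shift 1 (g (σ i)) : ℚ) := fun i j hij =>
    Nat.cast_le.mpr (hσ hij)
  have hαγ : ∀ j, (F.shift 1 (g (σ (Fin.succ j))) : ℚ) < F.shift 2 (τ j) := fun j => by
    exact_mod_cast hlt j
  have hM₁ : ∀ i, (F.shift 1 (g (σ i)) : ℚ) ≤ F.maxShift 1 := fun i => by
    exact_mod_cast F.shift_le_maxShift 1 _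
  have hM₂ : ∀ j, (F.shift 2 (τ j) : ℚ) ≤ F.maxShift 2 := fun i => by
    exact_mod_cast F.shift_le_maxShift 2 _
  have hm₂ : ∀ j, (F.minShift 2 : ℚ) ≤ F.shift 2 (τ j) := fun i => by
    exact_mod_cast F.minShift_le 2 _
  have h0 : (0 : ℚ) < F.shift 1 (g (σ 0)) := by exact_mod_cast F.shift_one_pos _
  have hm₁ : F.minShift 1 = F.shift 1 (g (σ 0)) := by
    refine le_antisymm (F.minShift_le 1 _) (le_csInf ⟨_, g 0, rfl⟩ ?_)
    rintro _ ⟨i, rfl⟩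
    obtain ⟨i, rfl⟩ := (σ.trans g).surjective i
    exact hσ (Fin.zero_le i)
  have hpure : ∀ b c : ℚ, (∀ i, (F.shift 1 (g (σ i)) : ℚ) = b) →
      (∀ j, (F.shift 2 (τ j) : ℚ) = c) → F.IsPure := by
    intro b c hb hc i j k
    rcases i with _ | _ | _ | i
    · rw [F.shift_zero, F.shift_zero]
    · obtain ⟨j, rfl⟩ := (σ.trans g).surjective j
      obtain ⟨k, rfl⟩ := (σ.trans g).surjective k
      exact_mod_cast (hb j).trans (hb k).symm
    · obtain ⟨j, rfl⟩ := τ.surjective j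
      obtain ⟨k, rfl⟩ := τ.surjective k
      exact_mod_cast (hc j).trans (hc k).symm
    · exact (F.isEmpty_of_length_lt (by omega)).elim j
  refine ⟨?_, ?_, ?_, ?_⟩
  -- With no second shifts the equality of first moments would contradict the positivity of the
  -- first shifts.
  · by_contra hne
    have := F.isEmpty_of_length_lt (i := 2) (by omega)
    rw [Finset.univ_eq_empty, Finset.sum_empty] at hsum
    have h2 := Finset.single_le_sum (f := fun i => (F.shift 1 (g (σ i)) : ℚ))
      (fun i _ => Nat.cast_nonneg _) (Finset.mem_univ 0)
    rw [← hsum] at h2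
    exact absurd h2 (not_le.mpr h0)
  · have := le_sum_sq_sub_sum_sq hα (fun j => (hαγ j).le) hsum hm₂
    rw [hlow, hm₁]
    linarith
  · have := sum_sq_sub_sum_sq_le hα (fun j => (hαγ j).le) hsum hM₁ hM₂ (Nat.cast_nonneg _)
      (Nat.cast_nonneg _)
    rw [hup]
    linarith
  · rintro (h | h)
    · rw [hlow, hm₁] at h
      obtain ⟨h1, h2⟩ := eq_of_sum_sq_sub_sum_sq_eq_lower hα hαγ hsum hm₂ (by linarith)
      exact hpure _ _ h1 h2
    · rw [hup] at h
      obtain ⟨h1, h2⟩ := eq_of_sum_sq_sub_sum_sq_eq hα hαγ hsum hM₁ hM₂ h0 (by linarith)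
      exact hpure _ _ h1 h2

end MinimalGradedFreeResolution

end LengthTwo

/-! ### Ext into free modules and along short exact sequences -/

section ExtVanishing

open CategoryTheory Abelian

universe u

variable {R : Type u} [CommRing R] {N : ModuleCat.{u} R}

/-- An element of `Ext N R^b i` vanishes if all its coordinates do. -/
lemma ext_eq_zero_of_proj {b i : ℕ} (x : Ext N (ModuleCat.of R (Fin b → R)) i)
    (h : ∀ k, x.comp (Ext.mk₀ (ModuleCat.ofHom (LinearMap.proj (R := R) (φ := fun _ : Fin b => R)
      k))) (add_zero i) = 0) : x = 0 := by
  have hid : 𝟙 (ModuleCat.of R (Fin b → R)) = ∑ k, ModuleCat.ofHom (LinearMap.proj k) ≫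
      ModuleCat.ofHom (LinearMap.single R (fun _ : Fin b => R) k) := by
    apply ModuleCat.hom_ext
    simp only [ModuleCat.hom_sum, ModuleCat.hom_comp, ModuleCat.hom_ofHom, ModuleCat.hom_id]
    refine LinearMap.ext fun w => ?_
    rw [LinearMap.sum_apply]
    simp [Finset.univ_sum_single]
  rw [← Ext.comp_mk₀_id x, hid, Ext.mk₀_sum, Ext.comp_sum]
  refine Finset.sum_eq_zero fun k _ => ?_
  rw [← Ext.mk₀_comp_mk₀, ← Ext.comp_assoc_of_second_deg_zero, h, Ext.zero_comp]

lemma subsingleton_ext_pi {i : ℕ} (h : Subsingleton (Ext N (ModuleCat.of R R) i)) (b : ℕ) :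
    Subsingleton (Ext N (ModuleCat.of R (Fin b → R)) i) :=
  subsingleton_of_forall_eq 0 fun x => ext_eq_zero_of_proj x fun _ => h.elim _ _

lemma subsingleton_ext_of_pi {b i : ℕ} (hb : b ≠ 0)
    (h : Subsingleton (Ext N (ModuleCat.of R (Fin b → R)) i)) :
    Subsingleton (Ext N (ModuleCat.of R R) i) := by
  refine subsingleton_of_forall_eq 0 fun x => ?_
  let k : Fin b := ⟨0, Nat.pos_of_ne_zero hb⟩
  have hid : 𝟙 (ModuleCat.of R R) = ModuleCat.ofHom (LinearMap.single R (fun _ : Fin b => R) k) ≫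
      ModuleCat.ofHom (LinearMap.proj (R := R) (φ := fun _ : Fin b => R) k) := by
    ext : 2
    simp
  rw [← Ext.comp_mk₀_id x, hid, ← Ext.mk₀_comp_mk₀, ← Ext.comp_assoc_of_second_deg_zero,
    h.elim (x.comp _ _) 0, Ext.zero_comp]

/-- Scalars act on Ext equally through either argument, and `r` is zero on `N`. -/
lemma ext_comp_smul_eq_zero {M M' : ModuleCat.{u} R} {i : ℕ} (x : Ext N M i) (f : M ⟶ M') {r : R}
    (hr : r ∈ Module.annihilator R N) : x.comp (Ext.mk₀ (r • f)) (add_zero i) = 0 := by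
  have h : r • 𝟙 N = 0 := by
    simp [← ModuleCat.lsmul_eq_smul_id, Module.mem_annihilator_iff_lsmul_eq_zero.mp hr]
  rw [Ext.mk₀_smul, Ext.comp_smul, ← Ext.mk₀_id_comp (x.comp _ _), ← Ext.smul_comp,
    ← Ext.mk₀_smul, h, Ext.mk₀_zero, Ext.zero_comp]

/-- A matrix with entries in the annihilator of `N` acts by zero on `Ext N _ i`. -/
lemma ext_comp_matrix_eq_zero {b c i : ℕ} (x : Ext N (ModuleCat.of R (Fin b → R)) i)
    (φ : (Fin b → R) →ₗ[R] (Fin c → R))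
    (h : ∀ j k, φ (Pi.single j 1) k ∈ Module.annihilator R N) :
    x.comp (Ext.mk₀ (ModuleCat.ofHom φ)) (add_zero i) = 0 := by
  refine ext_eq_zero_of_proj _ fun k => ?_
  have hφ : ModuleCat.ofHom φ ≫ ModuleCat.ofHom (LinearMap.proj k) =
      ∑ j, φ (Pi.single j 1) k • ModuleCat.ofHom
        (LinearMap.proj (R := R) (φ := fun _ : Fin b => R) j) := by
    apply ModuleCat.hom_ext
    simp only [ModuleCat.hom_sum, ModuleCat.hom_comp, ModuleCat.hom_ofHom, ModuleCat.hom_smul]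
    refine LinearMap.ext fun w => ?_
    rw [LinearMap.sum_apply]
    simp only [LinearMap.comp_apply, LinearMap.proj_apply, LinearMap.smul_apply, smul_eq_mul]
    conv_lhs => rw [← Finset.univ_sum_single w]
    rw [map_sum, Finset.sum_apply]
    refine Finset.sum_congr rfl fun j _ => ?_
    have : (Pi.single j (w j) : Fin b → R) = w j • Pi.single j 1 := by
      rw [← Pi.single_smul, smul_eq_mul, mul_one]
    rw [this, map_smul, Pi.smul_apply, smul_eq_mul, mul_comm]
  rw [Ext.comp_assoc_of_second_deg_zero, Ext.mk₀_comp_mk₀, hφ, Ext.mk₀_sum, Ext.comp_sum]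
  exact Finset.sum_eq_zero fun j _ => ext_comp_smul_eq_zero _ _ (h j k)

variable {C : ShortComplex (ModuleCat.{u} R)}

lemma subsingleton_ext_right (hC : C.ShortExact) {i : ℕ} (h₂ : Subsingleton (Ext N C.X₂ i))
    (h₁ : Subsingleton (Ext N C.X₁ (i + 1))) : Subsingleton (Ext N C.X₃ i) := by
  refine subsingleton_of_forall_eq 0 fun x => ?_
  obtain ⟨y, rfl⟩ := Ext.covariant_sequence_exact₃ N hC x rfl (h₁.elim _ _)
  rw [h₂.elim y 0, Ext.zero_comp]

lemma ext_left_injective (hC : C.ShortExact) {i : ℕ} (h₃ : Subsingleton (Ext N C.X₃ i))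
    (x : Ext N C.X₁ (i + 1)) (hx : x.comp (Ext.mk₀ C.f) (add_zero _) = 0) : x = 0 := by
  obtain ⟨y, rfl⟩ := Ext.covariant_sequence_exact₁ N hC x hx rfl
  rw [h₃.elim y 0, Ext.zero_comp]

lemma subsingleton_ext_left (hC : C.ShortExact) {k : ℕ}
    (h₃ : ∀ i, i + 1 < k → Subsingleton (Ext N C.X₃ i))
    (h₂ : ∀ i < k, Subsingleton (Ext N C.X₂ i)) : ∀ i < k, Subsingleton (Ext N C.X₁ i) := by
  intro i hi
  refine subsingleton_of_forall_eq 0 fun x => ?_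
  rcases i with _ | i
  · have := hC.mono_f
    exact Ext.postcomp_mk₀_injective_of_mono N C.f ((h₂ 0 hi).elim _ _)
  · exact ext_left_injective hC (h₃ i hi) x ((h₂ _ hi).elim _ _)

lemma subsingleton_ext_of_subsingleton {M : Type u} [AddCommGroup M] [Module R M]
    (h : Subsingleton M) (i : ℕ) : Subsingleton (Ext N (ModuleCat.of R M) i) := by
  refine subsingleton_of_forall_eq 0 fun x => ?_
  have hid : 𝟙 (ModuleCat.of R M) = 0 := by
    ext m
    exact h.elim _ _
  rw [← Ext.comp_mk₀_id x, hid, Ext.mk₀_zero, Ext.comp_zero]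

end ExtVanishing

/-! ### Depth, Ext and the length of the resolution -/

section Depth

open CategoryTheory Abelian

/-- A regular element avoids the minimal primes over the annihilator, so each quotient lowers the
dimension by at least one. -/
lemma length_le_supportDim {R : Type*} [CommRing R] [IsNoetherianRing R] (rs : List R) :
    ∀ {M : Type*} [AddCommGroup M] [Module R M] [Module.Finite R M],
      RingTheory.Sequence.IsRegular M rs → (rs.length : WithBot ℕ∞) ≤ Module.supportDim R M := by
  induction rs with
  | nil =>
    intro M _ _ _ h
    have := h.nontrivial
    have : Nonempty (Module.support R M) := Module.nonempty_support_of_nontrivial.to_subtype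
    rw [List.length_nil, Nat.cast_zero]
    exact Order.krullDim_nonneg (α := Module.support R M)
  | cons r rs ih =>
    intro M _ _ _ h
    rw [RingTheory.Sequence.isRegular_cons_iff] at h
    have h1 := Module.supportDim_quotSMulTop_succ_le_of_notMem_minimalPrimes (M := M) (x := r)
      fun _ => h.1.notMem_of_mem_minimalPrimes
    refine le_trans ?_ h1
    rw [List.length_cons, Nat.cast_add, Nat.cast_one]
    exact add_le_add_left (ih h.2) _

universe u

variable {K : Type u} [Field K] {n : ℕ}

lemma HasRegularSequence.le_ringKrullDim {I : Ideal (MvPolynomial (Fin n) K)} {k : ℕ}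
    (h : HasRegularSequence I k) :
    (k : WithBot ℕ∞) ≤ ringKrullDim (MvPolynomial (Fin n) K ⧸ I) := by
  obtain ⟨rs, rfl, -, hrs⟩ := h
  rw [← Module.supportDim_quotient_eq_ringKrullDim]
  exact length_le_supportDim rs hrs

lemma hasRegularSequence_bot (n : ℕ) :
    HasRegularSequence (⊥ : Ideal (MvPolynomial (Fin n) K)) n := by
  induction n with
  | zero => exact hasRegularSequence_zero bot_ne_top
  | succ m ih =>
    have hc : (1 : Fin (m + 1) → K) 0 ≠ 0 := one_ne_zero
    refine HasRegularSequence.of_map_elim hc (fun a ha => ?_) (by rwa [Ideal.map_bot])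
    refine (mul_eq_zero.mp (mem_colonElem.mp ha)).resolve_left fun h => ?_
    have h1 := congrArg (eval (Pi.single 0 1)) h
    simp [linForm, Pi.single_apply] at h1

/-- The residue field of the graded maximal ideal as a module. -/
abbrev residueModule (K : Type u) [Field K] (n : ℕ) : ModuleCat.{u} (MvPolynomial (Fin n) K) :=
  ModuleCat.of _ (MvPolynomial (Fin n) K ⧸ maxIdeal K n)

lemma annihilator_residueModule :
    Module.annihilator (MvPolynomial (Fin n) K) (residueModule K n) = maxIdeal K n :=
  Ideal.annihilator_quotient

/-- Rees' description of depth by Ext from the residue field. The hypothesis on `I` provides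
$\mathfrak m(S/I)\neq S/I$. -/
lemma hasRegularSequence_iff {I : Ideal (MvPolynomial (Fin n) K)} (hI : I ≤ maxIdeal K n) {k : ℕ} :
    HasRegularSequence I k ↔ ∀ i < k, Subsingleton
      (Ext (residueModule K n) (ModuleCat.of _ (MvPolynomial (Fin n) K ⧸ I)) i) := by
  have hlt : maxIdeal K n • (⊤ : Submodule (MvPolynomial (Fin n) K)
      (MvPolynomial (Fin n) K ⧸ I)) < ⊤ := by
    rw [lt_top_iff_ne_top]
    intro htop
    have h1 : (1 : MvPolynomial (Fin n) K ⧸ I) ∈ maxIdeal K n •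
      (⊤ : Submodule (MvPolynomial (Fin n) K) (MvPolynomial (Fin n) K ⧸ I)) := by
      rw [htop]; trivial
    rw [Ideal.smul_top_eq_map, Submodule.restrictScalars_mem] at h1
    obtain ⟨x, hx, hx1⟩ :=
      (Ideal.mem_map_iff_of_surjective _ Ideal.Quotient.mk_surjective).mp h1
    rw [← map_one (Ideal.Quotient.mk I)] at hx1
    have h2 := Ideal.sub_mem _ hx (hI (Ideal.Quotient.eq.mp hx1))
    rw [sub_sub_cancel] at h2
    exact (isMaximal_maxIdeal (K := K) (n := n)).ne_top ((Ideal.eq_top_iff_one _).mpr h2)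
  have hsupp : Module.support (MvPolynomial (Fin n) K) (residueModule K n) =
      PrimeSpectrum.zeroLocus (maxIdeal K n) := by
    rw [Module.support_eq_zeroLocus, annihilator_residueModule]
  constructor
  · rintro ⟨rs, rfl, hmem, hreg⟩
    exact ModuleCat.subsingleton_ext_of_exists_isRegular _ _ hsupp.subset _ hlt rs hmem hreg
  · intro h
    exact ModuleCat.exists_isRegular_of_exists_subsingleton_ext _ k _ hlt _ hsupp h

lemma subsingleton_ext_iff_bot (i : ℕ) :
    Subsingleton (Ext (residueModule K n)
      (ModuleCat.of _ (MvPolynomial (Fin n) K ⧸ (⊥ : Ideal (MvPolynomial (Fin n) K)))) i) ↔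
    Subsingleton (Ext (residueModule K n)
      (ModuleCat.of _ (MvPolynomial (Fin n) K)) i) := by
  let e := (Submodule.quotEquivOfEqBot (⊥ : Ideal (MvPolynomial (Fin n) K)) rfl).toModuleIso
  constructor
  · refine fun h => subsingleton_of_forall_eq 0 fun x => ?_
    rw [← Ext.comp_mk₀_id x, ← e.inv_hom_id, ← Ext.mk₀_comp_mk₀,
      ← Ext.comp_assoc_of_second_deg_zero, h.elim (x.comp _ _) 0, Ext.zero_comp]
  · refine fun h => subsingleton_of_forall_eq 0 fun x => ?_
    rw [← Ext.comp_mk₀_id x, ← e.hom_inv_id, ← Ext.mk₀_comp_mk₀,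
      ← Ext.comp_assoc_of_second_deg_zero, h.elim (x.comp _ _) 0, Ext.zero_comp]

lemma subsingleton_ext_residueModule {i : ℕ} (hi : i < n) :
    Subsingleton (Ext (residueModule K n) (ModuleCat.of _ (MvPolynomial (Fin n) K)) i) :=
  (subsingleton_ext_iff_bot i).mp
    ((hasRegularSequence_iff bot_le).mp (hasRegularSequence_bot n) i hi)

/-- Vanishing would give a regular sequence of length $n+1$ in a ring of dimension $n$. -/
lemma not_subsingleton_ext_residueModule :
    ¬ Subsingleton (Ext (residueModule K n) (ModuleCat.of _ (MvPolynomial (Fin n) K)) n) := by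
  intro h
  have h1 : HasRegularSequence (⊥ : Ideal (MvPolynomial (Fin n) K)) (n + 1) := by
    rw [hasRegularSequence_iff bot_le]
    intro i hi
    rw [subsingleton_ext_iff_bot]
    rcases Nat.lt_succ_iff_lt_or_eq.mp hi with hi | rfl
    · exact subsingleton_ext_residueModule hi
    · exact h
  have h2 := h1.le_ringKrullDim
  rw [ringKrullDim_eq_of_ringEquiv (RingEquiv.quotientBot _),
    MvPolynomial.ringKrullDim_of_isNoetherianRing, ringKrullDim_eq_zero_of_field] at h2
  rw [zero_add] at h2
  have h3 : n + 1 ≤ Nat.card (Fin n) := by exact_mod_cast h2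
  rw [Nat.card_fin] at h3
  omega

namespace MinimalGradedFreeResolution

variable {I : Ideal (MvPolynomial (Fin n) K)} (F : MinimalGradedFreeResolution I)

/-- The short exact sequence `0 → Z_{j+1} → F_{j+1} → Z_j → 0` of syzygies. -/
abbrev syzygyComplex (j : ℕ) : ShortComplex (ModuleCat.{u} (MvPolynomial (Fin n) K)) :=
  ShortComplex.mk (ModuleCat.ofHom (LinearMap.range (F.diff (j + 1))).subtype)
    (ModuleCat.ofHom (F.diff j).rangeRestrict) <| by
      apply ModuleCat.hom_ext
      ext ⟨x, hx⟩ : 1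
      rw [F.range_diff_succ] at hx
      exact Subtype.ext hx

lemma exact_subtype_rangeRestrict (j : ℕ) :
    Function.Exact (LinearMap.range (F.diff (j + 1))).subtype (F.diff j).rangeRestrict := by
  rw [LinearMap.exact_iff, Submodule.range_subtype, LinearMap.ker_rangeRestrict,
    F.range_diff_succ]

lemma syzygyComplex_shortExact (j : ℕ) : (F.syzygyComplex j).ShortExact where
  exact := ModuleCat.shortComplex_exact _ (F.exact_subtype_rangeRestrict j)
  mono_f := (ModuleCat.mono_iff_injective _).mpr Subtype.val_injective
  epi_g := (ModuleCat.epi_iff_surjective _).mpr (F.diff j).surjective_rangeRestrict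

/-- The short exact sequence `0 → Z_0 → F_0 → S/I → 0`. -/
abbrev augmentationComplex : ShortComplex (ModuleCat.{u} (MvPolynomial (Fin n) K)) :=
  ShortComplex.mk (ModuleCat.ofHom (LinearMap.range (F.diff 0)).subtype)
    (ModuleCat.ofHom (I.mkQ ∘ₗ LinearMap.proj F.zeroIndex)) <| by
      apply ModuleCat.hom_ext
      ext ⟨x, hx⟩ : 1
      exact Ideal.Quotient.eq_zero_iff_mem.mpr ((F.range_diff_zero x).mp hx _)

lemma exact_subtype_mkQ : Function.Exact (LinearMap.range (F.diff 0)).subtype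
    (I.mkQ ∘ₗ LinearMap.proj F.zeroIndex) := by
  rw [LinearMap.exact_iff, Submodule.range_subtype]
  ext x
  rw [F.range_diff_zero, LinearMap.mem_ker, LinearMap.comp_apply, Submodule.mkQ_apply,
    Submodule.Quotient.mk_eq_zero]
  exact ⟨fun h j => by rwa [F.eq_zeroIndex j], fun h => h _⟩

lemma augmentationComplex_shortExact : F.augmentationComplex.ShortExact where
  exact := ModuleCat.shortComplex_exact _ F.exact_subtype_mkQ
  mono_f := (ModuleCat.mono_iff_injective _).mpr Subtype.val_injective
  epi_g := (ModuleCat.epi_iff_surjective _).mpr <| by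
    intro y
    obtain ⟨y, rfl⟩ := I.mkQ_surjective y
    exact ⟨fun _ => y, rfl⟩

lemma subsingleton_range_diff {j : ℕ} (h : F.length ≤ j) :
    Subsingleton (LinearMap.range (F.diff j)) := by
  have := F.isEmpty_of_length_lt (i := j + 1) (by omega)
  exact (F.diff j).surjective_rangeRestrict.subsingleton

/-- Ext into the free modules vanishes below $n$. Starting from the zero syzygy module, each of the
two later steps down to $S/I$ costs one degree, leaving vanishing below `d`. -/
lemma hasRegularSequence_of_length_le_two (h : F.length ≤ 2) {d : ℕ} (hd : d + 2 ≤ n) :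
    HasRegularSequence I d := by
  rw [hasRegularSequence_iff F.le_maxIdeal]
  have h2 : ∀ i, Subsingleton (Ext (residueModule K n) (F.syzygyComplex 1).X₁ i) :=
    subsingleton_ext_of_subsingleton (F.subsingleton_range_diff h)
  have h1 : ∀ i < d + 2, Subsingleton (Ext (residueModule K n) (F.syzygyComplex 1).X₃ i) :=
    fun i hi => subsingleton_ext_right (F.syzygyComplex_shortExact 1)
      (subsingleton_ext_pi (subsingleton_ext_residueModule (by omega)) _) (h2 _)
  have h0 : ∀ i < d + 1, Subsingleton (Ext (residueModule K n) (F.syzygyComplex 0).X₃ i) :=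
    fun i hi => subsingleton_ext_right (F.syzygyComplex_shortExact 0)
      (subsingleton_ext_pi (subsingleton_ext_residueModule (by omega)) _) (h1 _ (by omega))
  exact fun i hi => subsingleton_ext_right F.augmentationComplex_shortExact
      (subsingleton_ext_pi (subsingleton_ext_residueModule (by omega)) _) (h0 _ (by omega))

/-- If the length were `m + 3`, the last differential would act on $\mathrm{Ext}^n(k,-)$ by zero,
its entries lying in the maximal ideal. Depth makes $\mathrm{Ext}^{n-1}$ into the relevant syzygy
module vanish, so the same map is injective on $\mathrm{Ext}^n(k,F_{m+3})$, which is nonzero. -/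
lemma length_le_two_of_hasRegularSequence {d : ℕ} (hd : n = d + 2)
    (h : HasRegularSequence I d) : F.length ≤ 2 := by
  rw [hasRegularSequence_iff F.le_maxIdeal] at h
  have hF : ∀ b, ∀ i < n, Subsingleton (Ext (residueModule K n)
      (ModuleCat.of _ (Fin b → MvPolynomial (Fin n) K)) i) := fun b i hi =>
    subsingleton_ext_pi (subsingleton_ext_residueModule hi) b
  have h0 : ∀ i < d + 1, Subsingleton (Ext (residueModule K n) F.augmentationComplex.X₁ i) :=
    subsingleton_ext_left F.augmentationComplex_shortExact (fun i hi => h i (by omega))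
      fun i hi => hF _ i (by omega)
  have h1 : ∀ j, ∀ i < n, Subsingleton (Ext (residueModule K n) (F.syzygyComplex j).X₁ i) := by
    intro j
    induction j with
    | zero =>
      exact subsingleton_ext_left (F.syzygyComplex_shortExact 0) (fun i hi => h0 i (by omega))
        fun i hi => hF _ i hi
    | succ j ih =>
      exact subsingleton_ext_left (F.syzygyComplex_shortExact (j + 1))
        (fun i hi => ih i (by omega)) fun i hi => hF _ i hi
  by_contra! hlt
  obtain ⟨m, hm⟩ : ∃ m, F.length = m + 3 := ⟨F.length - 3, by omega⟩
  refine not_subsingleton_ext_residueModule (K := K) (n := n)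
    (subsingleton_ext_of_pi (b := F.rank (m + 3)) (hm ▸ F.rank_length)
      (subsingleton_of_forall_eq 0 fun x => ?_))
  let C := F.syzygyComplex (m + 2)
  -- The differential factors through its range; the inclusion of the range is injective on
  -- $\mathrm{Ext}^n$ because $\mathrm{Ext}^{n-1}$ of the next syzygy module vanishes.
  have hx : x.comp (Ext.mk₀ C.g) (add_zero n) = 0 := by
    subst hd
    refine ext_left_injective (F.syzygyComplex_shortExact (m + 1)) (h1 m (d + 1) (by omega)) _ ?_
    rw [Ext.comp_assoc_of_second_deg_zero, Ext.mk₀_comp_mk₀]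
    refine ext_comp_matrix_eq_zero x (F.diff (m + 2)) fun j k => ?_
    rw [annihilator_residueModule]
    exact F.minimal _ _ _
  obtain ⟨y, rfl⟩ := Ext.covariant_sequence_exact₂ _ (F.syzygyComplex_shortExact (m + 2)) x hx
  have hy : Subsingleton (Ext (residueModule K n) (F.syzygyComplex (m + 2)).X₁ n) :=
    subsingleton_ext_of_subsingleton (F.subsingleton_range_diff hm.le) n
  rw [hy.elim y 0, Ext.zero_comp]

end MinimalGradedFreeResolution

lemma isRegular_map_mk_iff {I : Ideal (MvPolynomial (Fin n) K)}
    (rs : List (MvPolynomial (Fin n) K)) :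
    RingTheory.Sequence.IsRegular (MvPolynomial (Fin n) K ⧸ I) (rs.map (Ideal.Quotient.mk I)) ↔
      RingTheory.Sequence.IsRegular (MvPolynomial (Fin n) K ⧸ I) rs :=
  (AddEquiv.refl _).isRegular_congr <| List.forall₂_map_left_iff.mpr <|
    List.forall₂_same.mpr fun _ _ _ => rfl

lemma hasRegularSequence_iff_quotient {I : Ideal (MvPolynomial (Fin n) K)} {k : ℕ} :
    HasRegularSequence I k ↔ ∃ rs : List (MvPolynomial (Fin n) K ⧸ I), rs.length = k ∧
      (∀ r ∈ rs, r ∈ (maxIdeal K n).map (Ideal.Quotient.mk I)) ∧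
      RingTheory.Sequence.IsRegular (MvPolynomial (Fin n) K ⧸ I) rs := by
  constructor
  · rintro ⟨rs, rfl, hmem, hreg⟩
    refine ⟨rs.map (Ideal.Quotient.mk I), List.length_map _, ?_, (isRegular_map_mk_iff rs).mpr hreg⟩
    intro r hr
    obtain ⟨s, hs, rfl⟩ := List.mem_map.mp hr
    exact Ideal.mem_map_of_mem _ (hmem s hs)
  · rintro ⟨rs, rfl, hmem, hreg⟩
    have hlift : ∃ ss : List (MvPolynomial (Fin n) K), ss.map (Ideal.Quotient.mk I) = rs ∧
        ∀ s ∈ ss, s ∈ maxIdeal K n := by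
      clear hreg
      induction rs with
      | nil => exact ⟨[], rfl, by simp⟩
      | cons r rs ih =>
        obtain ⟨ss, hss, hm⟩ := ih fun r hr => hmem r (List.mem_cons_of_mem _ hr)
        obtain ⟨s, hs, rfl⟩ := (Ideal.mem_map_iff_of_surjective _
          Ideal.Quotient.mk_surjective).mp (hmem r List.mem_cons_self)
        refine ⟨s :: ss, by rw [List.map_cons, hss], fun t ht => ?_⟩
        rcases List.mem_cons.mp ht with rfl | ht
        · exact hs
        · exact hm t ht
    obtain ⟨ss, rfl, hm⟩ := hlift
    exact ⟨ss, (List.length_map _).symm, hm, (isRegular_map_mk_iff ss).mp hreg⟩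

/-- Lengths of regular sequences are bounded by the dimension `d`, so their supremum equals `d` only
if it is attained. -/
lemma isCohenMacaulay_iff_hasRegularSequence {I : Ideal (MvPolynomial (Fin n) K)}
    (hI : I ≤ maxIdeal K n) {d : ℕ}
    (hd : ringKrullDim (MvPolynomial (Fin n) K ⧸ I) = d) :
    IsCohenMacaulay I ↔ HasRegularSequence I d := by
  have hle : ∀ k, HasRegularSequence I k → k ≤ d := fun k hk => by
    have := hk.le_ringKrullDim
    rw [hd] at this
    exact_mod_cast this
  have hdepth : depth I ≤ d := iSup_le fun rs => Nat.cast_le.mpr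
    (hle _ (hasRegularSequence_iff_quotient.mpr ⟨rs.1, rfl, rs.2.1, rs.2.2⟩))
  have hcm : IsCohenMacaulay I ↔ depth I = d := by
    rw [IsCohenMacaulay, hd]
    exact_mod_cast Iff.rfl
  rw [hcm]
  constructor
  · intro h
    by_contra hno
    rcases d with _ | d
    · exact hno (hasRegularSequence_zero fun h => (isMaximal_maxIdeal (K := K) (n := n)).ne_top
        (top_le_iff.mp (h ▸ hI)))
    · have h1 : depth I ≤ d := iSup_le fun rs => by
        have h2 := hasRegularSequence_iff_quotient.mpr ⟨rs.1, rfl, rs.2.1, rs.2.2⟩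
        have h3 := hle _ h2
        have h4 : rs.1.length ≠ d + 1 := fun h => hno (h ▸ h2)
        exact Nat.cast_le.mpr (by omega)
      rw [h] at h1
      have : d + 1 ≤ d := by exact_mod_cast h1
      omega
  · intro h
    obtain ⟨rs, hlen, h1, h2⟩ := hasRegularSequence_iff_quotient.mp h
    refine le_antisymm hdepth ?_
    rw [← hlen]
    exact le_iSup (fun rs : {rs : List (MvPolynomial (Fin n) K ⧸ I) //
      (∀ r ∈ rs, r ∈ (maxIdeal K n).map (Ideal.Quotient.mk I)) ∧
      RingTheory.Sequence.IsRegular (MvPolynomial (Fin n) K ⧸ I) rs} => (rs.1.length : ℕ∞))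
      ⟨rs, h1, h2⟩

end Depth

/-! ### Extension of the base field -/

section BaseChange

variable {K L : Type*} [Field K] [Field L] [Algebra K L] {n : ℕ}

/-- Apply a linear functional to the coefficients of a polynomial. -/
def mapCoeff (l : L →ₗ[K] K) (q : MvPolynomial (Fin n) L) : MvPolynomial (Fin n) K :=
  ∑ m ∈ q.support, monomial m (l (coeff m q))

lemma coeff_mapCoeff (l : L →ₗ[K] K) (q : MvPolynomial (Fin n) L) (m : Fin n →₀ ℕ) :
    coeff m (mapCoeff l q) = l (coeff m q) := by
  classical
  rw [mapCoeff, coeff_sum]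
  simp only [coeff_monomial]
  rw [Finset.sum_ite_eq' q.support m]
  split_ifs with h
  · rfl
  · rw [notMem_support_iff.mp h, map_zero]

lemma mapCoeff_zero (l : L →ₗ[K] K) : mapCoeff l (0 : MvPolynomial (Fin n) L) = 0 := by
  ext m
  rw [coeff_mapCoeff, coeff_zero, map_zero, coeff_zero]

lemma mapCoeff_sum (l : L →ₗ[K] K) {ι : Type*} (s : Finset ι) (q : ι → MvPolynomial (Fin n) L) :
    mapCoeff l (∑ i ∈ s, q i) = ∑ i ∈ s, mapCoeff l (q i) := by
  ext m
  simp only [coeff_mapCoeff, coeff_sum, map_sum]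

/-- Applying a `K`-linear functional to coefficients is linear over polynomials with coefficients in
`K`, so it commutes with matrices over `K`. -/
lemma mapCoeff_mul_map (l : L →ₗ[K] K) (p : MvPolynomial (Fin n) K) (q : MvPolynomial (Fin n) L) :
    mapCoeff l (q * map (algebraMap K L) p) = mapCoeff l q * p := by
  ext m
  simp only [coeff_mapCoeff, coeff_mul, map_sum, coeff_map]
  refine Finset.sum_congr rfl fun x _ => ?_
  rw [mul_comm, ← Algebra.smul_def, map_smul, smul_eq_mul, mul_comm]

/-- Finitely many polynomials over `L` are combinations of polynomials over `K`. -/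
lemma exists_eq_sum_C_mul_map {ι : Type*} [Fintype ι] {β : Type*} (B : Module.Basis β K L)
    (v : ι → MvPolynomial (Fin n) L) : ∃ T : Finset β, ∀ i,
      v i = ∑ b ∈ T, C (B b) * map (algebraMap K L) (mapCoeff (B.coord b) (v i)) := by
  classical
  refine ⟨Finset.univ.biUnion fun i => (v i).support.biUnion fun m =>
    (B.repr (coeff m (v i))).support, fun i => ?_⟩
  ext m
  simp only [coeff_sum, coeff_C_mul, coeff_map, coeff_mapCoeff, Module.Basis.coord_apply]
  by_cases hm : m ∈ (v i).support
  · conv_lhs => rw [← B.linearCombination_repr (coeff m (v i)), Finsupp.linearCombination_apply,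
      Finsupp.sum]
    refine (Finset.sum_subset (fun b hb => ?_) fun b _ hb => ?_).trans
      (Finset.sum_congr rfl fun b _ => ?_)
    · simp only [Finset.mem_biUnion, Finset.mem_univ, true_and]
      exact ⟨i, m, hm, hb⟩
    · rw [Finsupp.notMem_support_iff.mp hb, zero_smul]
    · rw [Algebra.smul_def, mul_comm]
  · rw [notMem_support_iff.mp hm]
    simp

/-- The matrix of a linear map with coefficients extended to `L`. -/
def extendMap {b c : ℕ} (L : Type*) [Field L] [Algebra K L]
    (φ : (Fin b → MvPolynomial (Fin n) K) →ₗ[MvPolynomial (Fin n) K]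
      (Fin c → MvPolynomial (Fin n) K)) :
    (Fin b → MvPolynomial (Fin n) L) →ₗ[MvPolynomial (Fin n) L] (Fin c → MvPolynomial (Fin n) L) :=
  Fintype.linearCombination (MvPolynomial (Fin n) L)
    fun j k => map (algebraMap K L) (φ (Pi.single j 1) k)

variable {a b c : ℕ}
  {φ : (Fin b → MvPolynomial (Fin n) K) →ₗ[MvPolynomial (Fin n) K] (Fin c → MvPolynomial (Fin n) K)}

lemma extendMap_apply (v : Fin b → MvPolynomial (Fin n) L) (k : Fin c) :
    extendMap L φ v k = ∑ j, v j * map (algebraMap K L) (φ (Pi.single j 1) k) := by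
  rw [extendMap, Fintype.linearCombination_apply, Finset.sum_apply]
  rfl

lemma extendMap_single (j : Fin b) (k : Fin c) :
    extendMap L φ (Pi.single j 1) k = map (algebraMap K L) (φ (Pi.single j 1) k) := by
  rw [extendMap, Fintype.linearCombination_apply_single, one_smul]

lemma extendMap_map (v : Fin b → MvPolynomial (Fin n) K) (k : Fin c) :
    extendMap L φ (fun j => map (algebraMap K L) (v j)) k = map (algebraMap K L) (φ v k) := by
  rw [extendMap_apply, apply_eq_sum_mul_single φ, map_sum]
  simp only [map_mul]

lemma mapCoeff_extendMap (l : L →ₗ[K] K) (v : Fin b → MvPolynomial (Fin n) L) (k : Fin c) :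
    mapCoeff l (extendMap L φ v k) = φ (fun j => mapCoeff l (v j)) k := by
  rw [extendMap_apply, apply_eq_sum_mul_single φ, mapCoeff_sum]
  simp only [mapCoeff_mul_map]

/-- Flatness made explicit: expand a cycle in a `K`-basis of `L`. Its coordinates are cycles over
`K`, and their preimages recombine. -/
lemma exact_extendMap
    {ψ : (Fin a → MvPolynomial (Fin n) K) →ₗ[MvPolynomial (Fin n) K]
      (Fin b → MvPolynomial (Fin n) K)} (h : Function.Exact ψ φ) :
    Function.Exact (extendMap L ψ) (extendMap L φ) := by
  intro v
  constructor
  · intro hv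
    let B := Module.Basis.ofVectorSpace K L
    obtain ⟨T, hT⟩ := exists_eq_sum_C_mul_map B v
    have h1 : ∀ b, ∃ w, ψ w = fun j => mapCoeff (B.coord b) (v j) := fun b => by
      refine (h _).mp (funext fun k => ?_)
      rw [← mapCoeff_extendMap, hv]
      exact mapCoeff_zero _
    choose w hw using h1
    refine ⟨∑ b ∈ T, (C (B b) : MvPolynomial (Fin n) L) •
      fun j => map (algebraMap K L) (w b j), funext fun j => ?_⟩
    rw [map_sum, Finset.sum_apply, hT j]
    refine Finset.sum_congr rfl fun b _ => ?_
    rw [map_smul, Pi.smul_apply, extendMap_map, hw, smul_eq_mul]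
  · rintro ⟨w, rfl⟩
    have h0 : extendMap L φ ∘ₗ extendMap L ψ = 0 := by
      refine LinearMap.pi_ext' fun j => LinearMap.ext_ring (funext fun k => ?_)
      have h1 : extendMap L ψ (Pi.single j 1) =
          fun i => map (algebraMap K L) (ψ (Pi.single j 1) i) := funext fun i => extendMap_single j i
      change extendMap L φ (extendMap L ψ (Pi.single j 1)) k = 0
      rw [h1, extendMap_map, h.apply_apply_eq_zero, Pi.zero_apply, map_zero]
    exact LinearMap.congr_fun h0 w

/-- Extension of the base field preserves graded minimal free resolutions. -/
def MinimalGradedFreeResolution.baseChange (L : Type*) [Field L] [Algebra K L]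
    {I : Ideal (MvPolynomial (Fin n) K)} (F : MinimalGradedFreeResolution I) :
    MinimalGradedFreeResolution (I.map (map (algebraMap K L))) where
  length := F.length
  rank := F.rank
  shift := F.shift
  diff i := extendMap L (F.diff i)
  rank_length := F.rank_length
  rank_eq_zero := F.rank_eq_zero
  rank_zero := F.rank_zero
  shift_zero := F.shift_zero
  homogeneous i j k := by
    rw [extendMap_single]
    rcases F.homogeneous i j k with h | ⟨t, ht, h⟩
    · exact Or.inl (by rw [h, map_zero])
    · exact Or.inr ⟨t, ht, h.map _⟩
  range_diff_zero v := by
    have hspan : I.map (map (algebraMap K L)) =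
        Ideal.span (Set.range fun i => map (algebraMap K L) (F.gen i)) := by
      conv_lhs => rw [← F.span_range_gen, Ideal.map_span, ← Set.range_comp]
      rfl
    have happ : ∀ w, extendMap L (F.diff 0) w F.zeroIndex =
        ∑ i, w i * map (algebraMap K L) (F.gen i) := fun w => extendMap_apply w _
    rw [hspan]
    constructor
    · rintro ⟨w, rfl⟩ j
      rw [F.eq_zeroIndex j, happ]
      exact Ideal.mem_span_range_iff_exists_fun.mpr ⟨w, rfl⟩
    · intro h
      obtain ⟨w, hw⟩ := Ideal.mem_span_range_iff_exists_fun.mp (h F.zeroIndex)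
      exact ⟨w, funext fun j => by rw [F.eq_zeroIndex j, happ, hw]⟩
  exact i := exact_extendMap (F.exact i)
  minimal i j k := by
    rw [extendMap_single, mem_maxIdeal_iff, constantCoeff_map,
      mem_maxIdeal_iff.mp (F.minimal i j k), map_zero]

end BaseChange

/-! ### Heights, independent variables and Krull dimension -/

section Dimension

variable {K : Type*} [Field K]

lemma finSuccEquiv_rename_succ {n : ℕ} (f : MvPolynomial (Fin n) K) :
    finSuccEquiv K n (rename Fin.succ f) = Polynomial.C f := by
  induction f using MvPolynomial.induction_on with
  | C a => rw [rename_C, finSuccEquiv_apply, eval₂Hom_C]; rfl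
  | add p q hp hq => rw [map_add, map_add, hp, hq, map_add]
  | mul_X p i hp => rw [map_mul, map_mul, hp, rename_X, finSuccEquiv_X_succ, map_mul]

/-- Modulo a prime ideal `p` of height `h` in `n` variables, some `s ≥ n - h` of the variables are
algebraically independent. -/
lemma exists_independent_variables (n : ℕ) : ∀ (p : Ideal (MvPolynomial (Fin n) K)) [p.IsPrime],
    ∃ (s : ℕ) (τ : Fin s → Fin n), (n : ℕ∞) ≤ s + p.height ∧
      ∀ f : MvPolynomial (Fin s) K, rename τ f ∈ p → f = 0 := by
  induction n with
  | zero =>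
    intro p hp
    refine ⟨0, id, by simp, fun f hf => ?_⟩
    by_contra hne
    rw [eq_C_of_isEmpty f, rename_C] at hf
    rw [eq_C_of_isEmpty f] at hne
    refine hp.ne_top (Ideal.eq_top_of_isUnit_mem _ hf ?_)
    exact (isUnit_iff_ne_zero.mpr fun h => hne (by rw [h, map_zero])).map C
  | succ n ih =>
    intro p hp
    let e := (finSuccEquiv K n).toRingEquiv
    let P : Ideal (Polynomial (MvPolynomial (Fin n) K)) := p.map e
    have hP : P.IsPrime := Ideal.map_isPrime_of_equiv e
    have hPh : P.height = p.height := RingEquiv.height_map e p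
    have hmem : ∀ f, f ∈ p ↔ finSuccEquiv K n f ∈ P := fun f =>
      (Ideal.apply_mem_of_equiv_iff (f := e)).symm
    let q := P.under (MvPolynomial (Fin n) K)
    have hq : q.IsPrime := inferInstance
    obtain ⟨s, τ, hs, hτ⟩ := ih q
    let P' : Ideal (Polynomial (MvPolynomial (Fin n) K)) := q.map Polynomial.C
    have hP' : P'.IsPrime := Ideal.isPrime_map_C_of_isPrime
    have hle : P' ≤ P := Ideal.map_comap_le
    have hlies : P'.LiesOver q := ⟨by
      ext x
      change x ∈ q ↔ Polynomial.C x ∈ P'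
      rw [Ideal.mem_map_C_iff]
      refine ⟨fun h i => ?_, fun h => by simpa using h 0⟩
      rw [Polynomial.coeff_C]
      split_ifs
      · exact h
      · exact zero_mem _⟩
    -- Going down for the extension to the polynomial ring.
    have hh : q.height ≤ P'.height := by
      rw [Ideal.height_eq_height_add_of_liesOver_of_hasGoingDown q P']
      exact le_self_add
    -- If `P` is extended from `q`, the new variable is independent as well. Otherwise the strict
    -- inclusion adds one to the height. Either way `s + height` grows by one.
    rcases hle.eq_or_lt with heq | hlt
    · refine ⟨s + 1, Fin.cons 0 (Fin.succ ∘ τ), ?_, fun f hf => ?_⟩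
      · rw [← hPh, ← heq]
        push_cast
        calc ((n : ℕ∞) + 1) ≤ s + q.height + 1 := by gcongr
          _ ≤ s + P'.height + 1 := by gcongr
          _ = s + 1 + P'.height := by ring
      · have hcomm : ((finSuccEquiv K n).toAlgHom.comp (rename (Fin.cons 0 (Fin.succ ∘ τ)))) =
            (Polynomial.mapAlgHom (rename τ)).comp (finSuccEquiv K s).toAlgHom := by
          ext i : 1
          refine Fin.cases ?_ (fun i => ?_) i <;> simp [finSuccEquiv_X_zero, finSuccEquiv_X_succ]
        rw [hmem, ← heq, Ideal.mem_map_C_iff] at hf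
        have h0 : finSuccEquiv K s f = 0 := by
          ext1 i
          rw [Polynomial.coeff_zero]
          apply hτ
          have h1 := hf i
          have h2 := AlgHom.congr_fun hcomm f
          simp only [AlgHom.comp_apply] at h2
          change finSuccEquiv K n _ = Polynomial.map _ (finSuccEquiv K s f) at h2
          rw [h2, Polynomial.coeff_map] at h1
          exact h1
        exact (map_eq_zero_iff _ (finSuccEquiv K s).injective).mp h0
    · refine ⟨s, Fin.succ ∘ τ, ?_, fun f hf => hτ f ?_⟩
      · rw [← hPh]
        push_cast
        calc ((n : ℕ∞) + 1) ≤ s + q.height + 1 := by gcongr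
          _ ≤ s + (P'.height + 1) := by rw [add_assoc]; gcongr
          _ ≤ s + P.height := by
            gcongr
            exact Ideal.height_add_one_le_of_lt_of_isPrime hlt
      · rw [hmem, ← rename_rename, finSuccEquiv_rename_succ] at hf
        exact hf

/-- The first prime of a chain in the quotient contains `I`, so its height is at least that of `I`;
add its coheight. -/
lemma ringKrullDim_quotient_add_height_le {R : Type*} [CommRing R] [Nontrivial R] (I : Ideal R)
    {d h : ℕ} (hd : (d : WithBot ℕ∞) ≤ ringKrullDim (R ⧸ I)) (hh : (h : ℕ∞) ≤ I.height) :
    ((d + h : ℕ) : WithBot ℕ∞) ≤ ringKrullDim R := by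
  rw [ringKrullDim_quotient, Order.le_krullDim_iff] at hd
  obtain ⟨l, hl⟩ := hd
  let l' : LTSeries (PrimeSpectrum R) := l.map Subtype.val fun _ _ h => h
  have h1 : (d : ℕ∞) ≤ Order.coheight l'.head := by
    rw [← hl]
    exact Order.length_le_coheight_head (p := l')
  have h2 : (h : ℕ∞) ≤ Order.height l'.head := by
    rw [← PrimeSpectrum.height_eq_orderHeight]
    refine hh.trans (Ideal.height_mono ?_)
    exact l.head.2
  rw [ringKrullDim, Order.krullDim_eq_iSup_height_add_coheight_of_nonempty]
  have h3 : ((d + h : ℕ) : ℕ∞) ≤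
      ⨆ a : PrimeSpectrum R, Order.height a + Order.coheight a := by
    refine le_trans ?_ (le_iSup _ l'.head)
    rw [add_comm d h]
    push_cast
    exact add_le_add h2 h1
  exact_mod_cast h3

/-- Lying over for the first prime of a chain, then going up along the rest. -/
lemma ringKrullDim_le_of_finite {R S : Type*} [CommRing R] [CommRing S] (g : R →+* S)
    (h : Function.Injective g) (hg : g.Finite) : ringKrullDim R ≤ ringKrullDim S := by
  let _ := g.toAlgebra
  have : Module.Finite R S := hg
  refine iSup_le fun l => ?_
  obtain ⟨Q, -, hQ, hover⟩ := Ideal.exists_ideal_over_prime_of_isIntegral l.head.asIdeal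
    (⊥ : Ideal S) (by
    rw [Ideal.comap_bot_of_injective (algebraMap R S) h]
    exact bot_le)
  have : Q.LiesOver (RelSeries.head l).asIdeal := ⟨hover.symm⟩
  obtain ⟨l', hl', -⟩ := Ideal.exists_ltSeries_of_hasGoingUp l Q
  rw [← hl']
  exact le_iSup (fun l : LTSeries (PrimeSpectrum S) => (l.length : WithBot ℕ∞)) l'

end Dimension

/-! ### Growth of the partial sums of the Hilbert function -/

section Growth

variable {K : Type*} [Field K]

lemma sum_multichoose (s M : ℕ) :
    ∑ i ∈ Finset.range (M + 1), s.multichoose i = (M + s).choose s := by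
  have h : ∑ i ∈ Finset.range (M + 1), s.multichoose i = (s + 1).multichoose M := by
    induction M with
    | zero => simp
    | succ M ih => rw [Finset.sum_range_succ, ih, Nat.multichoose_succ_succ]; ring
  rw [h, Nat.multichoose_eq, show s + 1 + M - 1 = s + M by omega, add_comm, Nat.choose_symm_add]

lemma finrank_finset_sup_le {V : Type*} [AddCommGroup V] [Module K V] (W : ℕ → Submodule K V)
    [∀ i, FiniteDimensional K (W i)] (k : ℕ) :
    Module.finrank K ((Finset.range k).sup W : Submodule K V) ≤
      ∑ i ∈ Finset.range k, Module.finrank K (W i) := by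
  induction k with
  | zero => rw [Finset.range_zero, Finset.sup_empty, finrank_bot]; exact Nat.zero_le _
  | succ k ih =>
    rw [Finset.range_add_one, Finset.sup_insert, Finset.sum_insert Finset.notMem_range_self]
    have : FiniteDimensional K ((Finset.range k).sup W : Submodule K V) :=
      Submodule.finiteDimensional_finset_sup _ _
    exact (Submodule.finrank_add_le_finrank_add_finrank _ _).trans (Nat.add_le_add_left ih _)

lemma finrank_restrictTotalDegree_le (s M : ℕ) :
    Module.finrank K (restrictTotalDegree (Fin s) K M) ≤ (M + s).choose s := by
  have hle : restrictTotalDegree (Fin s) K M ≤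
      (Finset.range (M + 1)).sup (homogeneousSubmodule (Fin s) K) := by
    intro p hp
    rw [mem_restrictTotalDegree] at hp
    rw [← sum_homogeneousComponent p]
    refine sum_mem fun i hi => ?_
    have hi' : i ∈ Finset.range (M + 1) := by
      rw [Finset.mem_range] at hi ⊢
      omega
    exact (Finset.le_sup (f := homogeneousSubmodule (Fin s) K) hi')
      (homogeneousComponent_mem i p)
  have : FiniteDimensional K
      ((Finset.range (M + 1)).sup (homogeneousSubmodule (Fin s) K) : Submodule K _) :=
    Submodule.finiteDimensional_finset_sup _ _
  refine (Submodule.finrank_mono hle).trans ((finrank_finset_sup_le _ _).trans ?_)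
  simp only [finrank_homogeneousSubmodule]
  exact (sum_multichoose s M).le

/-- In an algebra that is finite over the image of a polynomial ring in `s` variables, the monomials
of degree at most `k` in given elements span a space of dimension `O(k^s)`. -/
lemma exists_growth_bound {A : Type*} [CommRing A] [Algebra K A] {s n : ℕ} (x : Fin n → A)
    (g : MvPolynomial (Fin s) K →ₐ[K] A) (hg : g.Finite) :
    ∃ J D : ℕ, ∀ k, ∃ V : Submodule K A, FiniteDimensional K V ∧
      Module.finrank K V ≤ J * (D * (k + 1) + s).choose s ∧
      ∀ m : Fin n →₀ ℕ, m.degree ≤ k → aeval x (monomial m (1 : K)) ∈ V := by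
  obtain ⟨J, y, hy⟩ : ∃ (J : ℕ) (y : Fin J → A), ∀ a, ∃ c : Fin J → MvPolynomial (Fin s) K,
      ∑ j, g (c j) * y j = a := by
    let _ := g.toRingHom.toAlgebra
    have : Module.Finite (MvPolynomial (Fin s) K) A := hg
    obtain ⟨J, y, hy⟩ := Module.Finite.exists_fin (R := MvPolynomial (Fin s) K) (M := A)
    refine ⟨J, y, fun a => ?_⟩
    have ha : a ∈ Submodule.span (MvPolynomial (Fin s) K) (Set.range y) := by rw [hy]; trivial
    exact (Submodule.mem_span_range_iff_exists_fun _).mp ha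
  obtain ⟨u, hu⟩ := hy 1
  choose c hc using fun (i : Fin n) (j : Fin J) => hy (x i * y j)
  -- Bounds the degrees of the coefficients expressing `1` and all products `x i * y j` in the
  -- module generators, so each further variable raises coefficient degrees by at most `D`.
  let D := (Finset.univ.sup fun l => (u l).totalDegree) +
    Finset.univ.sup fun i => Finset.univ.sup fun j => Finset.univ.sup fun l =>
      (c i j l).totalDegree
  have hu' : ∀ l, (u l).totalDegree ≤ D := fun l =>
    (Finset.le_sup (f := fun l => (u l).totalDegree) (Finset.mem_univ l)).trans
      (Nat.le_add_right _ _)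
  have hc' : ∀ i j l, (c i j l).totalDegree ≤ D := fun i j l => by
    refine le_trans ?_ (Nat.le_add_left _ _)
    exact (Finset.le_sup (f := fun l => (c i j l).totalDegree) (Finset.mem_univ l)).trans
      ((Finset.le_sup (f := fun j => Finset.univ.sup fun l => (c i j l).totalDegree)
        (Finset.mem_univ j)).trans (Finset.le_sup (f := fun i => Finset.univ.sup fun j =>
          Finset.univ.sup fun l => (c i j l).totalDegree) (Finset.mem_univ i)))
  have hmon : ∀ k (m : Fin n →₀ ℕ), m.degree = k → ∃ a : Fin J → MvPolynomial (Fin s) K,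
      (∀ j, (a j).totalDegree ≤ D * (k + 1)) ∧
      ∑ j, g (a j) * y j = aeval x (monomial m (1 : K)) := by
    intro k
    induction k with
    | zero =>
      intro m hm
      rw [Finsupp.degree_eq_zero_iff] at hm
      refine ⟨u, fun j => by simpa using hu' j, ?_⟩
      rw [hu, hm]
      simp
    | succ k ih =>
      intro m hm
      obtain ⟨i, hi⟩ : ∃ i, m i ≠ 0 := by
        by_contra! h
        rw [show m = 0 from Finsupp.ext h] at hm
        simp at hm
      have hle : Finsupp.single i 1 ≤ m := by
        rw [Finsupp.single_le_iff]
        omega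
      obtain ⟨m', rfl⟩ := exists_add_of_le hle
      rw [map_add, Finsupp.degree_single] at hm
      obtain ⟨a, ha, hsum⟩ := ih m' (by omega)
      refine ⟨fun l => ∑ j, a j * c i j l, fun l => ?_, ?_⟩
      · refine totalDegree_finsetSum_le fun j _ => (totalDegree_mul _ _).trans ?_
        have h1 := ha j
        have h2 := hc' i j l
        linarith
      · have hm' : monomial (Finsupp.single i 1 + m') (1 : K) = X i * monomial m' 1 := by
          rw [X, monomial_mul, one_mul]
        rw [hm', map_mul, aeval_X, ← hsum, Finset.mul_sum]
        simp only [map_sum, map_mul, Finset.sum_mul]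
        rw [Finset.sum_comm]
        refine Finset.sum_congr rfl fun j _ => ?_
        rw [mul_left_comm, ← hc, Finset.mul_sum]
        exact Finset.sum_congr rfl fun l _ => mul_assoc _ _ _
  refine ⟨J, D, fun k => ?_⟩
  let Φ : (Fin J → restrictTotalDegree (Fin s) K (D * (k + 1))) →ₗ[K] A :=
    ∑ j, (LinearMap.mulRight K (y j)) ∘ₗ g.toLinearMap ∘ₗ
      (restrictTotalDegree (Fin s) K (D * (k + 1))).subtype ∘ₗ LinearMap.proj j
  refine ⟨LinearMap.range Φ, inferInstance, ?_, fun m hm => ?_⟩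
  · refine (LinearMap.finrank_range_le Φ).trans ?_
    rw [Module.finrank_pi_fintype, Finset.sum_const, Finset.card_univ, Fintype.card_fin,
      smul_eq_mul]
    exact Nat.mul_le_mul_left _ (finrank_restrictTotalDegree_le _ _)
  · obtain ⟨a, ha, hsum⟩ := hmon _ m rfl
    refine ⟨fun j => ⟨a j, (mem_restrictTotalDegree _ _ _).mpr ((ha j).trans
      (Nat.mul_le_mul_left _ (by omega)))⟩, ?_⟩
    rw [← hsum, LinearMap.sum_apply]
    rfl

variable {n : ℕ}

/-- The image of the polynomials of degree less than `k` in `S/I`. -/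
def lowPart (I : Ideal (MvPolynomial (Fin n) K)) (k : ℕ) :
    Submodule K (MvPolynomial (Fin n) K ⧸ I) :=
  (Finset.range k).sup (component I)

instance (I : Ideal (MvPolynomial (Fin n) K)) (k : ℕ) : FiniteDimensional K (component I k) :=
  Module.Finite.map (homogeneousSubmodule (Fin n) K k) (Ideal.Quotient.mkₐ K I).toLinearMap

instance (I : Ideal (MvPolynomial (Fin n) K)) (k : ℕ) : FiniteDimensional K (lowPart I k) :=
  Submodule.finiteDimensional_finset_sup _ _

lemma lowPart_succ (I : Ideal (MvPolynomial (Fin n) K)) (k : ℕ) :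
    lowPart I (k + 1) = component I k ⊔ lowPart I k := by
  rw [lowPart, Finset.range_add_one, Finset.sup_insert]
  rfl

lemma exists_of_mem_lowPart {I : Ideal (MvPolynomial (Fin n) K)} {k : ℕ} :
    ∀ x ∈ lowPart I k, ∃ p, Ideal.Quotient.mk I p = x ∧
      ∀ j, k ≤ j → homogeneousComponent j p = 0 := by
  induction k with
  | zero =>
    intro x hx
    rw [lowPart, Finset.range_zero, Finset.sup_empty, Submodule.mem_bot] at hx
    exact ⟨0, by rw [hx, map_zero], fun j _ => map_zero _⟩
  | succ k ih =>
    intro x hx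
    rw [lowPart_succ, Submodule.mem_sup] at hx
    obtain ⟨_, ⟨q, hq, rfl⟩, z, hz, rfl⟩ := hx
    obtain ⟨p, rfl, hp⟩ := ih z hz
    refine ⟨q + p, map_add _ _ _, fun j hj => ?_⟩
    rw [map_add, hp j (by omega), add_zero, homogeneousComponent_of_mem hq, if_neg (by omega)]

/-- Gradedness of `I` makes the components of $S/I$ independent. -/
lemma finrank_lowPart {I : Ideal (MvPolynomial (Fin n) K)} (hI : IsGradedIdeal I) (k : ℕ) :
    Module.finrank K (lowPart I k) = ∑ i ∈ Finset.range k, hilbertFunction I i := by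
  induction k with
  | zero => rw [lowPart, Finset.range_zero, Finset.sup_empty, finrank_bot, Finset.sum_empty]
  | succ k ih =>
    have hdisj : component I k ⊓ lowPart I k = ⊥ := by
      rw [eq_bot_iff]
      rintro _ ⟨⟨q, hq, rfl⟩, hx⟩
      obtain ⟨p, hp, hp0⟩ := exists_of_mem_lowPart _ hx
      have h1 : q - p ∈ I := Ideal.Quotient.eq.mp hp.symm
      have h2 := hI _ h1 k
      rw [map_sub, hp0 k le_rfl, sub_zero, homogeneousComponent_of_mem hq, if_pos rfl] at h2
      exact Ideal.Quotient.eq_zero_iff_mem.mpr h2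
    have h := Submodule.finrank_sup_add_finrank_inf_eq (component I k) (lowPart I k)
    rw [hdisj, finrank_bot, add_zero, ← lowPart_succ, ih] at h
    rw [h, Finset.sum_range_succ, add_comm]
    rfl

lemma mk_mem_lowPart {I : Ideal (MvPolynomial (Fin n) K)} {k : ℕ} {p : MvPolynomial (Fin n) K}
    (h : ∀ j, k ≤ j → homogeneousComponent j p ∈ I) : Ideal.Quotient.mk I p ∈ lowPart I k := by
  rw [← sum_homogeneousComponent p, map_sum]
  refine sum_mem fun j _ => ?_
  by_cases hj : k ≤ j
  · rw [Ideal.Quotient.eq_zero_iff_mem.mpr (h j hj)]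
    exact zero_mem _
  · exact (Finset.le_sup (f := component I) (Finset.mem_range.mpr (not_le.mp hj)))
      ⟨_, homogeneousComponent_mem j p, rfl⟩

lemma exists_sum_hilbertFunction_le {I : Ideal (MvPolynomial (Fin n) K)} (hI : IsGradedIdeal I)
    {s : ℕ} (g : MvPolynomial (Fin s) K →ₐ[K] MvPolynomial (Fin n) K ⧸ I) (hg : g.Finite) :
    ∃ J D : ℕ, ∀ k, ∑ i ∈ Finset.range (k + 1), hilbertFunction I i ≤
      J * (D * (k + 1) + s).choose s := by
  obtain ⟨J, D, h⟩ := exists_growth_bound (fun i => Ideal.Quotient.mk I (X i)) g hg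
  refine ⟨J, D, fun k => ?_⟩
  obtain ⟨V, hV, hle, hmem⟩ := h k
  rw [← finrank_lowPart hI]
  refine (Submodule.finrank_mono ?_).trans hle
  refine Finset.sup_le fun i hi => ?_
  rintro _ ⟨p, hp, rfl⟩
  have haeval : (Ideal.Quotient.mkₐ K I) = aeval fun i => Ideal.Quotient.mk I (X i) := by
    ext i
    simp
  change Ideal.Quotient.mkₐ K I p ∈ V
  rw [as_sum p, map_sum]
  refine sum_mem fun m hm => ?_
  have h1 : monomial m (coeff m p) = coeff m p • monomial m (1 : K) := by
    rw [smul_monomial, smul_eq_mul, mul_one]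
  rw [h1, map_smul, haeval]
  refine V.smul_mem _ (hmem m ?_)
  have h2 : m.degree = i := by
    rw [Finsupp.degree_eq_weight_one]
    exact hp (mem_support_iff.mp hm)
  rw [Finset.mem_range] at hi
  omega

lemma multichoose_le_hilbertFunction {I : Ideal (MvPolynomial (Fin n) K)} {s : ℕ}
    {τ : Fin s → Fin n} (h : ∀ f : MvPolynomial (Fin s) K, rename τ f ∈ I → f = 0) (k : ℕ) :
    s.multichoose k ≤ hilbertFunction I k := by
  let φ := (Ideal.Quotient.mkₐ K I).toLinearMap ∘ₗ (rename τ).toLinearMap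
  have hinj : Function.Injective φ := (injective_iff_map_eq_zero φ).mpr fun f hf =>
    h f (Ideal.Quotient.eq_zero_iff_mem.mp hf)
  rw [← finrank_homogeneousSubmodule (K := K), 
    (Submodule.equivMapOfInjective φ hinj _).finrank_eq]
  refine Submodule.finrank_mono ?_
  rintro _ ⟨f, hf, rfl⟩
  exact ⟨rename τ f, IsHomogeneous.rename_isHomogeneous hf, rfl⟩

end Growth

/-! ### Multiplicity and the order of the numerator at 1 -/

section Multiplicity

open Filter

lemma leadingCoeff_nonneg_of_eval_nonneg {P : Polynomial ℚ}
    (h : ∀ᶠ k : ℕ in atTop, 0 ≤ P.eval (k : ℚ)) : 0 ≤ P.leadingCoeff := by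
  by_contra! hlt
  rcases lt_or_ge 0 P.degree with hdeg | hdeg
  · have h1 := (P.tendsto_atBot_of_leadingCoeff_nonpos hdeg hlt.le).comp
      (tendsto_natCast_atTop_atTop (R := ℚ))
    obtain ⟨k, h2, h3⟩ := (h.and (h1.eventually_lt_atBot 0)).exists
    exact absurd h2 (not_le.mpr h3)
  · obtain ⟨k, hk⟩ := h.exists
    rw [Polynomial.eq_C_of_degree_le_zero hdeg] at hk hlt
    rw [Polynomial.eval_C] at hk
    rw [Polynomial.leadingCoeff_C] at hlt
    exact absurd hk (not_le.mpr hlt)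

/-- If `P` had larger degree, the leading coefficient of `R - P` would be minus that of `P`, and
both would be nonnegative. -/
lemma natDegree_le_of_eval_le {P R : Polynomial ℚ}
    (h0 : ∀ᶠ k : ℕ in atTop, 0 ≤ P.eval (k : ℚ))
    (h : ∀ᶠ k : ℕ in atTop, P.eval (k : ℚ) ≤ R.eval (k : ℚ)) : P.natDegree ≤ R.natDegree := by
  by_contra! hlt
  have hdeg : R.degree < P.degree := Polynomial.degree_lt_degree hlt
  have h1 : (R - P).leadingCoeff = - P.leadingCoeff :=
    Polynomial.leadingCoeff_sub_of_degree_lt' hdeg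
  have h2 : 0 ≤ (R - P).leadingCoeff := leadingCoeff_nonneg_of_eval_nonneg (by
    filter_upwards [h] with k hk
    rw [Polynomial.eval_sub]
    linarith)
  have h3 := leadingCoeff_nonneg_of_eval_nonneg h0
  have h4 : P.leadingCoeff = 0 := by linarith
  rw [Polynomial.leadingCoeff_eq_zero] at h4
  rw [h4, Polynomial.natDegree_zero] at hlt
  exact Nat.not_lt_zero _ hlt

variable {K : Type*} [Field K] {n : ℕ} {I : Ideal (MvPolynomial (Fin n) K)}

lemma eval_hilbertPoly_eq_hilbertFunction {N : Polynomial ℚ} {m : ℕ}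
    (h : hilbertSeries I * (1 - PowerSeries.X) ^ m = (N : PowerSeries ℚ)) {k : ℕ}
    (hk : N.natDegree < k) : (Polynomial.hilbertPoly N m).eval (k : ℚ) = hilbertFunction I k := by
  rw [← Polynomial.coeff_mul_invOneSubPow_eq_hilbertPoly_eval m hk, ← h, mul_assoc]
  have h1 := PowerSeries.one_sub_pow_mul_invOneSubPow_val_add_eq_invOneSubPow_val ℚ 0 m
  rw [zero_add, PowerSeries.invOneSubPow_zero, Units.val_one] at h1
  rw [h1, mul_one, coeff_hilbertSeries]

/-- One more factor $1/(1-t)$ passes to partial sums. Their polynomial is nonzero even for finite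
length, so dimension zero needs no separate treatment. -/
lemma eval_hilbertPoly_eq_sum_hilbertFunction {N : Polynomial ℚ} {m : ℕ}
    (h : hilbertSeries I * (1 - PowerSeries.X) ^ m = (N : PowerSeries ℚ)) {k : ℕ}
    (hk : N.natDegree < k) : (Polynomial.hilbertPoly N (m + 1)).eval (k : ℚ) =
      ∑ i ∈ Finset.range (k + 1), (hilbertFunction I i : ℚ) := by
  rw [← Polynomial.coeff_mul_invOneSubPow_eq_hilbertPoly_eval (m + 1) hk, ← h, mul_assoc]
  have h1 := PowerSeries.one_sub_pow_mul_invOneSubPow_val_add_eq_invOneSubPow_val ℚ 1 m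
  rw [add_comm m 1, h1, PowerSeries.coeff_mul,
    Finset.Nat.sum_antidiagonal_eq_sum_range_succ_mk]
  refine Finset.sum_congr rfl fun i _ => ?_
  rw [coeff_hilbertSeries, PowerSeries.invOneSubPow_val_succ_eq_mk_add_choose ℚ 0,
    PowerSeries.coeff_mk]
  simp

/-- The coefficients of `Q` are integers, since the product can be formed over the integers. -/
lemma exists_int_eval_one {Q : Polynomial ℚ} {m : ℕ}
    (h : hilbertSeries I * (1 - PowerSeries.X) ^ m = (Q : PowerSeries ℚ)) :
    ∃ z : ℤ, Q.eval 1 = z := by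
  let H : PowerSeries ℤ := PowerSeries.mk fun k => (hilbertFunction I k : ℤ)
  have h1 : PowerSeries.map (Int.castRingHom ℚ) (H * (1 - PowerSeries.X) ^ m) =
      (Q : PowerSeries ℚ) := by
    rw [← h, map_mul, map_pow, map_sub, map_one, PowerSeries.map_X]
    congr 1
  refine ⟨∑ i ∈ Finset.range (Q.natDegree + 1),
    PowerSeries.coeff i (H * (1 - PowerSeries.X) ^ m), ?_⟩
  rw [Polynomial.eval_eq_sum_range, Int.cast_sum]
  refine Finset.sum_congr rfl fun i _ => ?_
  rw [one_pow, mul_one, ← Polynomial.coeff_coe, ← h1, PowerSeries.coeff_map]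
  rfl

lemma exists_nat_of_le_nat {x : WithBot ℕ∞} {m : ℕ} (h0 : 0 ≤ x) (h : x ≤ m) :
    ∃ k : ℕ, x = k := by
  induction x using WithBot.recBotCoe with
  | bot => simp at h0
  | coe x =>
    have h1 : x ≤ m := by exact_mod_cast h
    obtain ⟨k, rfl⟩ := ENat.ne_top_iff_exists.mp (ne_top_of_le_ne_top (ENat.natCast_ne_top m) h1)
    exact ⟨k, rfl⟩

/-- The multiplicity is the value at `1` of the reduced numerator of the Hilbert series. -/
lemma exists_isMultiplicity (hI : IsGradedIdeal I) {Q : Polynomial ℚ} {d : ℕ}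
    (h : hilbertSeries I * (1 - PowerSeries.X) ^ d = (Q : PowerSeries ℚ)) (hQ : Q.eval 1 ≠ 0) :
    ∃ e : ℕ, IsMultiplicity I e ∧ Q.eval 1 = e := by
  rcases d with _ | d
  · rw [pow_zero, mul_one] at h
    have hcoeff : ∀ k, Q.coeff k = hilbertFunction I k := fun k => by
      rw [← coeff_hilbertSeries, h, Polynomial.coeff_coe]
    have hzero : ∀ k, Q.natDegree < k → hilbertFunction I k = 0 := fun k hk => by
      have := hcoeff k
      rw [Polynomial.coeff_eq_zero_of_natDegree_lt hk] at this
      exact_mod_cast this.symm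
    refine ⟨Module.finrank K (MvPolynomial (Fin n) K ⧸ I), ⟨0, ?_, fun h => absurd rfl h,
      fun _ => rfl⟩, ?_⟩
    · filter_upwards [eventually_gt_atTop Q.natDegree] with k hk
      rw [hzero k hk, Polynomial.eval_zero, Nat.cast_zero]
    · have htop : lowPart I (Q.natDegree + 1) = ⊤ := by
        rw [eq_top_iff]
        rintro x -
        obtain ⟨p, rfl⟩ := Ideal.Quotient.mk_surjective x
        refine mk_mem_lowPart fun j hj => ?_
        have h1 : component I j = ⊥ := Submodule.finrank_eq_zero.mp (hzero j hj)
        have h2 : Ideal.Quotient.mk I (homogeneousComponent j p) ∈ component I j :=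
          ⟨_, homogeneousComponent_mem j p, rfl⟩
        rw [h1, Submodule.mem_bot] at h2
        exact Ideal.Quotient.eq_zero_iff_mem.mp h2
      have h3 := finrank_lowPart hI (Q.natDegree + 1)
      rw [htop, finrank_top] at h3
      rw [h3, Polynomial.eval_eq_sum_range, Nat.cast_sum]
      simp [hcoeff]
  · let P := Polynomial.hilbertPoly Q (d + 1)
    have hdeg : P.natDegree ≤ d := Polynomial.natDegree_sum_le_of_forall_le _ _ fun i _ =>
      (Polynomial.natDegree_smul_le _ _).trans (Polynomial.natDegree_preHilbertPoly ℚ d i).le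
    -- Each coefficient of `Q` contributes a polynomial of degree `d` with leading coefficient
    -- $1/d!$.
    have hcoeff : P.coeff d = Q.eval 1 / d.factorial := by
      rw [Polynomial.eval_eq_sum, Polynomial.sum, Finset.sum_div]
      simp only [P, Polynomial.hilbertPoly_succ, Polynomial.finsetSum_coeff]
      refine Finset.sum_congr rfl fun i _ => ?_
      rw [Polynomial.coeff_smul, Polynomial.coeff_preHilbertPoly_self, one_pow, mul_one,
        smul_eq_mul, div_eq_mul_inv]
    have hfac : (d.factorial : ℚ) ≠ 0 := Nat.cast_ne_zero.mpr (Nat.factorial_ne_zero d)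
    have hne : P.coeff d ≠ 0 := by
      rw [hcoeff]
      exact div_ne_zero hQ hfac
    have hdeg' : P.natDegree = d := le_antisymm hdeg (Polynomial.le_natDegree_of_ne_zero hne)
    have hP : IsHilbertPolynomial I P := by
      filter_upwards [eventually_gt_atTop Q.natDegree] with k hk
      exact eval_hilbertPoly_eq_hilbertFunction h hk
    have hlc : Q.eval 1 = d.factorial * P.leadingCoeff := by
      rw [Polynomial.leadingCoeff, hdeg', hcoeff, mul_div_cancel₀ _ hfac]
    obtain ⟨z, hz⟩ := exists_int_eval_one h
    have hz0 : 0 ≤ z := by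
      have h1 : 0 ≤ P.leadingCoeff := leadingCoeff_nonneg_of_eval_nonneg (by
        filter_upwards [hP] with k hk
        rw [hk]
        exact Nat.cast_nonneg _)
      have h2 : (0 : ℚ) ≤ z := by
        rw [← hz, hlc]
        positivity
      exact_mod_cast h2
    lift z to ℕ using hz0
    refine ⟨z, ⟨P, hP, fun _ => ?_, fun h0 => absurd (by rw [h0, Polynomial.coeff_zero]) hne⟩, ?_⟩
    · rw [hdeg', ← hlc, hz, Int.cast_natCast]
    · rw [hz, Int.cast_natCast]

/-- For ideals of height two, the numerator of the Hilbert series is divisible by `(1 - t)^2`, and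
the value of the quotient at `1` is the multiplicity. -/
theorem exists_multiplicity_of_height_eq_two (hcodim : I.height = 2)
    (F : MinimalGradedFreeResolution I) :
    ∃ d, n = d + 2 ∧ ringKrullDim (MvPolynomial (Fin n) K ⧸ I) = d ∧
      ∃ (Q : Polynomial ℚ) (e : ℕ), F.numerator = Q * (1 - Polynomial.X) ^ 2 ∧ Q.eval 1 = e ∧
        IsMultiplicity I e := by
  have hI := F.isGradedIdeal
  have hser := F.hilbertSeries_mul_one_sub_pow
  have htop : I ≠ ⊤ := fun h =>
    (isMaximal_maxIdeal (K := K) (n := n)).ne_top (top_le_iff.mp (h ▸ F.le_maxIdeal))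
  have hnontriv : Nontrivial (MvPolynomial (Fin n) K ⧸ I) := Ideal.Quotient.nontrivial_iff.mpr htop
  have hdimS : ∀ m, ringKrullDim (MvPolynomial (Fin m) K) = m := fun m => by
    rw [MvPolynomial.ringKrullDim_of_isNoetherianRing, ringKrullDim_eq_zero_of_field, zero_add,
      Nat.card_fin]
  -- A prime of height two over `I` leaves at least $n-2$ variables independent modulo `I`, bounding
  -- growth from below; Noether normalization bounds it from above.
  obtain ⟨p, hp, hIp, hph⟩ := Ideal.exists_isPrime_height_eq (I := I) (n := 2) hcodim
  obtain ⟨s, τ, hs, hτ⟩ := exists_independent_variables n p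
  rw [hph] at hs
  replace hs : n ≤ s + 2 := by exact_mod_cast hs
  obtain ⟨k, hk⟩ := exists_nat_of_le_nat
    (ringKrullDim_nonneg_of_nontrivial (R := MvPolynomial (Fin n) K ⧸ I))
    ((ringKrullDim_quotient_le I).trans (hdimS n).le)
  have hkn : k + 2 ≤ n := by
    have := ringKrullDim_quotient_add_height_le I hk.ge (h := 2) hcodim.ge
    rw [hdimS] at this
    exact_mod_cast this
  obtain ⟨t, g, hginj, hgfin⟩ := exists_finite_inj_algHom_of_fg K (MvPolynomial (Fin n) K ⧸ I)
  have htk : t ≤ k := by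
    have h1 := ringKrullDim_le_of_finite g.toRingHom hginj hgfin
    rw [hk, hdimS] at h1
    exact_mod_cast h1
  obtain ⟨J, D, hJD⟩ := exists_sum_hilbertFunction_le hI g hgfin
  have hlow := fun i => multichoose_le_hilbertFunction (fun f hf => hτ f (hIp hf)) i
  have hlow' : ∀ m, (m + s).choose s ≤ ∑ i ∈ Finset.range (m + 1), hilbertFunction I i := fun m => by
    rw [← sum_multichoose]
    exact Finset.sum_le_sum fun i _ => hlow i
  let P := Polynomial.hilbertPoly F.numerator (n + 1)
  have hP : ∀ᶠ m : ℕ in atTop, P.eval (m : ℚ) =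
      ∑ i ∈ Finset.range (m + 1), (hilbertFunction I i : ℚ) := by
    filter_upwards [eventually_gt_atTop F.numerator.natDegree] with m hm
    exact eval_hilbertPoly_eq_sum_hilbertFunction hser hm
  have hchoose : ∀ a m : ℕ, (Polynomial.preHilbertPoly ℚ a 0).eval (m : ℚ) = (m + a).choose a :=
    fun a m => by
      rw [Polynomial.preHilbertPoly_eq_choose_sub_add ℚ a (Nat.zero_le m), Nat.sub_zero]
  have hsP : s ≤ P.natDegree := by
    rw [← Polynomial.natDegree_preHilbertPoly ℚ s 0]
    refine natDegree_le_of_eval_le (Eventually.of_forall fun m => ?_) ?_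
    · rw [hchoose]
      exact Nat.cast_nonneg _
    · filter_upwards [hP] with m hm
      rw [hm, hchoose]
      exact_mod_cast hlow' m
  have hP0 : P ≠ 0 := by
    intro h0
    obtain ⟨m, hm⟩ := hP.exists
    rw [h0, Polynomial.eval_zero] at hm
    have h1 := hlow' m
    have h2 : 0 < (m + s).choose s := Nat.choose_pos (by omega)
    have h3 : ∑ i ∈ Finset.range (m + 1), hilbertFunction I i = 0 := by exact_mod_cast hm.symm
    omega
  have hPt : P.natDegree ≤ t := by
    have h1 : P.natDegree ≤ (Polynomial.C (J : ℚ) * (Polynomial.preHilbertPoly ℚ t 0).comp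
        (Polynomial.C (D : ℚ) * (Polynomial.X + 1))).natDegree := by
      refine natDegree_le_of_eval_le ?_ ?_
      · filter_upwards [hP] with m hm
        rw [hm]
        positivity
      · filter_upwards [hP] with m hm
        have h2 := hJD m
        have h3 := hchoose t (D * (m + 1))
        push_cast at h3
        rw [hm, Polynomial.eval_mul, Polynomial.eval_C, Polynomial.eval_comp, Polynomial.eval_mul,
          Polynomial.eval_C, Polynomial.eval_add, Polynomial.eval_X, Polynomial.eval_one, h3]
        exact_mod_cast h2
    refine h1.trans ((Polynomial.natDegree_C_mul_le _ _).trans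
      (Polynomial.natDegree_comp_le.trans ?_))
    rw [Polynomial.natDegree_preHilbertPoly]
    refine (Nat.mul_le_mul_left t ?_).trans (mul_one t).le
    exact (Polynomial.natDegree_C_mul_le _ _).trans (Polynomial.natDegree_X_add_C (1 : ℚ)).le
  have hr1 := Polynomial.natDegree_hilbertPoly_of_ne_zero hP0
  have hr2 : F.numerator.rootMultiplicity 1 < n + 1 := by
    by_contra! h
    exact hP0 (Polynomial.hilbertPoly_eq_zero_of_le_rootMultiplicity_one h)
  change P.natDegree = _ at hr1
  have hN0 : F.numerator ≠ 0 := fun h => hP0 (by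
    simp only [P, h, Polynomial.hilbertPoly_zero_left])
  -- The chain $n-2\le s\le\deg P\le t\le k\le n-2$ collapses, and $\deg P$ is $n$ minus the root
  -- multiplicity.
  have hr : F.numerator.rootMultiplicity 1 = 2 := by omega
  obtain ⟨Q, hQ, hQ1⟩ := Polynomial.exists_eq_pow_rootMultiplicity_mul_and_not_dvd _ hN0 1
  rw [hr] at hQ
  have hQ' : F.numerator = Q * (1 - Polynomial.X) ^ 2 := by
    rw [hQ, map_one]
    ring
  obtain ⟨d, rfl⟩ : ∃ d, n = d + 2 := ⟨n - 2, by omega⟩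
  have hserQ : hilbertSeries I * (1 - PowerSeries.X) ^ d = (Q : PowerSeries ℚ) := by
    rw [hQ', pow_add, ← mul_assoc] at hser
    refine mul_right_cancel₀ (pow_ne_zero 2 one_sub_X_ne_zero) (hser.trans ?_)
    push_cast
    rfl
  obtain ⟨e, he, hQe⟩ := exists_isMultiplicity hI hserQ
    fun h => hQ1 (Polynomial.dvd_iff_isRoot.mpr h)
  exact ⟨d, rfl, by rw [hk]; congr 1; omega, Q, e, hQ', hQe, he⟩

end Multiplicity

end MultiplicityConjecture

end

/-! ### The theorem over an arbitrary field -/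

open MultiplicityConjecture in
theorem theorem3p1 {K : Type*} [Field K] {n : ℕ} (I : Ideal (MvPolynomial (Fin n) K))
    (hI : I.IsHomogeneous (MvPolynomial.homogeneousSubmodule (Fin n) K))
    (hcodim : I.height = 2) (F : MinimalGradedFreeResolution I) :
    ∃ e : ℕ, IsMultiplicity I e ∧
      -- the upper bound, for all graded ideals of codimension 2
      (e : ℚ) ≤ (F.maxShift 1 : ℚ) * F.maxShift 2 / 2 ∧
      ((e : ℚ) = (F.maxShift 1 : ℚ) * F.maxShift 2 / 2 → IsCohenMacaulay I ∧ F.IsPure) ∧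
      -- both bounds, over the length of the resolution, in the Cohen–Macaulay case
      (IsCohenMacaulay I →
        F.lowerBound F.length ≤ e ∧ (e : ℚ) ≤ F.upperBound F.length ∧
        ((e : ℚ) = F.lowerBound F.length ∨ (e : ℚ) = F.upperBound F.length → F.IsPure)) := by
  obtain ⟨d, rfl, hdim, Q, e, hQ, hQe, he⟩ := exists_multiplicity_of_height_eq_two hcodim F
  -- The length is the same over `K` and over its algebraic closure, so this criterion carries
  -- Cohen–Macaulayness back to `K`.
  have hcm : IsCohenMacaulay I ↔ F.length ≤ 2 :=
    (isCohenMacaulay_iff_hasRegularSequence F.le_maxIdeal hdim).trans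
      ⟨F.length_le_two_of_hasRegularSequence rfl,
        fun h => F.hasRegularSequence_of_length_le_two h le_rfl⟩
  have hup : F.upperBound 2 = F.maxShift 1 * F.maxShift 2 / 2 := by
    simp [MinimalGradedFreeResolution.upperBound, Finset.prod_Icc_succ_top, Nat.factorial]
  -- the maximal shifts are unchanged by the passage to an infinite field
  obtain ⟨hle, heq⟩ := two_mul_eval_one_le_maxShift (F.baseChange (AlgebraicClosure K)) (Q := Q) hQ
  change 2 * Q.eval 1 ≤ (F.maxShift 1 : ℚ) * F.maxShift 2 at hle
  change 2 * Q.eval 1 = (F.maxShift 1 : ℚ) * F.maxShift 2 → _ at heq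
  rw [hQe] at hle heq
  refine ⟨e, he, by linarith, fun h => ?_, fun h => ?_⟩
  -- The regular sequence exists only over the algebraic closure; what descends is the length.
  · have hlen : F.length ≤ 2 :=
      (F.baseChange (AlgebraicClosure K)).length_le_two_of_hasRegularSequence rfl
        (heq (by linarith))
    refine ⟨hcm.mpr hlen, (F.bounds_of_length_le_two hlen hQ).2.2.2 (Or.inr ?_)⟩
    rw [hQe, hup, h]
  · obtain ⟨hlen, h1, h2, h3⟩ := F.bounds_of_length_le_two (hcm.mp h) hQ
    rw [hQe] at h1 h2 h3
    rw [hlen]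
    exact ⟨h1, h2, h3⟩
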